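/- Let $\mathbb F$ be an algebraically closed field of characteristic $p>2$, and let $\mathfrak g=\mathfrak g_{\bar 0}\oplus\mathfrak g_{\bar 1}$ be a finite-dimensional Lie superalgebra over $\mathbb F$ with $[\mathfrak g_{\bar 1},\mathfrak g_{\bar 1}]=0$, equipped with a symmetric bilinear form $\langle\cdot,\cdot\rangle$ such that $\langle\mathfrak g_{\bar 0},\mathfrak g_{\bar 1}\rangle=0$ and $\langle[a,u],v\rangle=-\langle u,[a,v]\rangle$ for $a\in\mathfrak g_{\bar 0}$, $u,v\in\mathfrak g$. Let $\widehat{\mathfrak g}=\mathfrak g\otimes\mathbb F[t,t^{-1}]\oplus\mathbb F\mathbf k$ be the affine Lie superalgebra with $\mathbf k$ central and $$[a\otimes t^m,b\otimes t^n]=[a,b]\otimes t^{m+n}+m\,\delta_{m+n,0}\langle a,b\rangle\mathbf k,\quad [a\otimes t^m,u\otimes t^n]=[a,u]\otimes t^{m+n},\quad [u\otimes t^m,v\otimes t^n]=\delta_{m+n+1,0}\langle u,v\rangle\mathbf k$$ for $a,b\in\mathfrak g_{\bar 0}$, $u,v\in\mathfrak g_{\bar 1}$, $m,n\in\mathbb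 Z$. For $\ell\in\mathbb F$ let $V_{\widehat{\mathfrak g}}(\ell,0)$ be the $\widehat{\mathfrak g}$-module induced from the one-dimensional $(\mathfrak g\otimes\mathbb F[t]\oplus\mathbb F\mathbf k)$-module on which $\mathfrak g\otimes\mathbb F[t]$ acts as $0$ and $\mathbf k$ acts as $\ell$, with $\mathbf 1=1\otimes 1$ and its induced $\mathbb Z_2$-grading; write $a$ also for the vector $(a\otimes t^{-1})\mathbf 1$, $a\in\mathfrak g$. Let $\tau$ be an automorphism of the Lie superalgebra $\mathfrak g$ preserving $\langle\cdot,\cdot\rangle$ with $\tau^T=1$, where $T$ is a positive integer prime to $p$. Let $\eta\in\mathbb F$ be a primitive $T$-th root of unity and $\mathfrak g_i=\{a\in\mathfrak g:\tau a=\eta^i a\}$. Let $\widehat{\mathfrak g}[\tau]=\bigoplus_{i=0}^{T-1}\mathfrak g_i\otimes t^{i/T}\mathbb F[t,t^{-1}]\oplus\mathbb F\mathbf k$ be the Lie superalgebra whose bracket is given by the same formulas with exponents $m,n\in\frac1T\mathbb Z$. A (not necessarily $\mathbb Z_2$-graded) $\widehat{\mathfrak g}[\tau]$-module $W$ has level $\ell$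 if $\mathbf k$ acts as $\ell$, and it is locally truncated if for every $w\in W$ one has $(\mathfrak g_i\otimes t^{n+i/T})w=0$ for all $i$ and all sufficiently large $n$. For $a\in\mathfrak g_i$ put $a_\tau(z)=\sum_{n\in\mathbb Z}(a\otimes t^{n+i/T})z^{-n-1-i/T}$. Then: (0) There is a unique vertex superalgebra structure on the superspace $V_{\widehat{\mathfrak g}}(\ell,0)$ with vacuum vector $\mathbf 1$ and $Y(a,x)=\sum_{n\in\mathbb Z}(a\otimes t^n)x^{-n-1}$ for $a\in\mathfrak g$. The map induced by $\tau$ on $V_{\widehat{\mathfrak g}}(\ell,0)$, also denoted $\tau$, is an automorphism of this vertex superalgebra, and $\tau^T=1$ on it. (1) On every locally truncated $\widehat{\mathfrak g}[\tau]$-module $W$ of level $\ell$ there is a unique $\tau$-twisted $V_{\widehat{\mathfrak g}}(\ell,0)$-module structure $Y_W$ such that $Y_W(a,z)=a_\tau(z)$ for all $a\in\mathfrak g_i$, $i=0,\dots,T-1$. (2) Conversely, on every $\tau$-twisted $V_{\widehat{\mathfrak g}}(\ell,0)$-module $(W,Y_W)$ there is a unique structure of locally truncated $\widehat{\mathfrak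 g}[\tau]$-module of level $\ell$ such that $a_\tau(z)=Y_W(a,z)$ for all $a\in\mathfrak g_i$, $i=0,\dots,T-1$. Here a $\tau$-twisted $V$-module, for a vertex superalgebra $V$ with an automorphism $\tau$ satisfying $\tau^T=1$ and $V^r=\{u\in V:\tau u=\eta^r u\}$, is a vector space $W$ (not necessarily $\mathbb Z_2$-graded) with a linear map $v\mapsto Y_W(v,x)=\sum_{n\in\frac1T\mathbb Z}v_nx^{-n-1}$, $v_n\in\operatorname{End}W$, such that for every $v\in V$ and $w\in W$ one has $v_nw=0$ for $n$ large, $Y_W(\mathbf 1,x)=1_W$, and for $u\in V^r$ ($0\le r<T$) one has $Y_W(u,x)=\sum_{n\in\frac rT+\mathbb Z}u_nx^{-n-1}$ and, for all $\mathbb Z_2$-homogeneous $u\in V^r$ and $v\in V$, the twisted Jacobi identity $$x_0^{-1}\delta\Big(\tfrac{x_1-x_2}{x_0}\Big)Y_W(u,x_1)Y_W(v,x_2)-(-1)^{|u||v|}x_0^{-1}\delta\Big(\tfrac{x_2-x_1}{-x_0}\Big)Y_W(v,x_2)Y_W(u,x_1)=x_2^{-1}\delta\Big(\tfrac{x_1-x_0}{x_2}\Big)\Big(\tfrac{x_1-x_0}{x_2}\Big)^{-r/T}Y_W(Y(u,x_0)v,x_2),$$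 where binomial coefficients $\binom{\alpha}{i}$ of rational numbers $\alpha$ with denominator prime to $p$ are reduced modulo $p$. -/

import Mathlib

namespace SuperVA

/-- The sign `(-1)^{αβ}` attached to two parities. -/
def sgn (F : Type*) [Field F] (α β : ZMod 2) : F := (-1) ^ (α.val * β.val)

/-- The image in `F` of the rational binomial coefficient `α(α-1)⋯(α-i+1)/i!`. If `F` has
characteristic `p` and the denominator of `α` is prime to `p`, so is the denominator of the
binomial coefficient, and the cast is the reduction modulo `p`. -/
def binom (F : Type*) [Field F] (α : ℚ) (i : ℕ) : F :=
  (((∏ j ∈ Finset.range i, (α - j)) / (Nat.factorial i : ℚ) : ℚ) : F)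

/-! ### Lie superalgebras -/

/-- A Lie superalgebra over a field of characteristic `≠ 2`, on the vector space `L`
(the axiom `odd_cube` follows from the others if the characteristic is not `3`). -/
structure LieSuperalgebra (F : Type*) (L : Type*) [Field F] [AddCommGroup L] [Module F L] where
  part : ZMod 2 → Submodule F L
  isCompl : IsCompl (part 0) (part 1)
  bracket : L →ₗ[F] L →ₗ[F] L
  bracket_mem : ∀ {α β : ZMod 2} {x y : L}, x ∈ part α → y ∈ part β →
    bracket x y ∈ part (α + β)
  skew : ∀ {α β : ZMod 2} {x y : L}, x ∈ part α → y ∈ part β →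
    bracket x y = -(sgn F α β • bracket y x)
  jacobi : ∀ {α β γ : ZMod 2} {x y z : L}, x ∈ part α → y ∈ part β → z ∈ part γ →
    bracket x (bracket y z) = bracket (bracket x y) z + sgn F α β • bracket y (bracket x z)
  odd_cube : ∀ {x : L}, x ∈ part 1 → bracket x (bracket x x) = 0

namespace LieSuperalgebra

variable {F : Type*} {L : Type*} [Field F] [AddCommGroup L] [Module F L]

/-- `ρ` makes `M` a module (not necessarily `ℤ/2`-graded) over the Lie superalgebra. -/
def IsModule (A : LieSuperalgebra F L) {M : Type*} [AddCommGroup M] [Module F M]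
    (ρ : L →ₗ[F] Module.End F M) : Prop :=
  ∀ (α β : ZMod 2) (x y : L), x ∈ A.part α → y ∈ A.part β →
    ρ (A.bracket x y) = ρ x * ρ y - sgn F α β • (ρ y * ρ x)

/-- The defining relations of the universal enveloping algebra. -/
inductive UEARel (A : LieSuperalgebra F L) : TensorAlgebra F L → TensorAlgebra F L → Prop
  | super_comm (α β : ZMod 2) (x y : L) (hx : x ∈ A.part α) (hy : y ∈ A.part β) :
      UEARel A (TensorAlgebra.ι F x * TensorAlgebra.ι F y)
        (sgn F α β • (TensorAlgebra.ι F y * TensorAlgebra.ι F x)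
          + TensorAlgebra.ι F (A.bracket x y))

/-- The universal enveloping algebra of a Lie superalgebra. -/
def UEA (A : LieSuperalgebra F L) : Type _ := RingQuot (UEARel A)

noncomputable instance (A : LieSuperalgebra F L) : Ring A.UEA :=
  inferInstanceAs (Ring (RingQuot (UEARel A)))

noncomputable instance (A : LieSuperalgebra F L) : Algebra F A.UEA :=
  inferInstanceAs (Algebra F (RingQuot (UEARel A)))

/-- The canonical map to the universal enveloping algebra. -/
noncomputable def ι (A : LieSuperalgebra F L) : L →ₗ[F] A.UEA :=
  (RingQuot.mkAlgHom F (UEARel A)).toLinearMap ∘ₗ TensorAlgebra.ι F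

/-- The component of parity `α` of the universal enveloping algebra. -/
noncomputable def ueaPart (A : LieSuperalgebra F L) (α : ZMod 2) : Submodule F A.UEA :=
  Submodule.span F {u | ∃ l : List (ZMod 2 × L), (∀ x ∈ l, x.2 ∈ A.part x.1) ∧
    (l.map Prod.fst).sum = α ∧ u = (l.map fun x => A.ι x.2).prod}

theorem ι_mul_ι (A : LieSuperalgebra F L) {α β : ZMod 2} {x y : L}
    (hx : x ∈ A.part α) (hy : y ∈ A.part β) :
    A.ι x * A.ι y = sgn F α β • (A.ι y * A.ι x) + A.ι (A.bracket x y) := by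
  have h := RingQuot.mkAlgHom_rel F (UEARel.super_comm α β x y hx hy)
  rw [map_mul, map_add, map_smul, map_mul] at h
  exact h

/-- The algebra endomorphism of the universal enveloping algebra induced by an endomorphism of
the Lie superalgebra. -/
noncomputable def ueaMap (A : LieSuperalgebra F L) (f : L →ₗ[F] L)
    (hf : ∀ x y, f (A.bracket x y) = A.bracket (f x) (f y))
    (hp : ∀ α x, x ∈ A.part α → f x ∈ A.part α) : A.UEA →ₐ[F] A.UEA :=
  RingQuot.liftAlgHom F ⟨TensorAlgebra.lift F (A.ι ∘ₗ f), by
    intro a b h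
    induction h with
    | super_comm α β x y hx hy =>
      simp only [map_mul, map_add, map_smul, TensorAlgebra.lift_ι_apply, LinearMap.comp_apply, hf]
      exact A.ι_mul_ι (hp α x hx) (hp β y hy)⟩

theorem ueaMap_ι (A : LieSuperalgebra F L) (f : L →ₗ[F] L)
    (hf : ∀ x y, f (A.bracket x y) = A.bracket (f x) (f y))
    (hp : ∀ α x, x ∈ A.part α → f x ∈ A.part α) (x : L) :
    A.ueaMap f hf hp (A.ι x) = A.ι (f x) := by
  change RingQuot.liftAlgHom F _ (RingQuot.mkAlgHom F (UEARel A) (TensorAlgebra.ι F x)) = _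
  rw [RingQuot.liftAlgHom_mkAlgHom_apply, TensorAlgebra.lift_ι_apply]
  rfl

/-- The Lie superalgebra structure on a graded subspace closed under the bracket. -/
def restrict (A : LieSuperalgebra F L) (N : Submodule F L)
    (hN : ∀ x ∈ N, ∀ y ∈ N, A.bracket x y ∈ N)
    (hg : ∀ x ∈ N, ∃ a ∈ N, ∃ b ∈ N, a ∈ A.part 0 ∧ b ∈ A.part 1 ∧ a + b = x) :
    LieSuperalgebra F N where
  part α := (A.part α).comap N.subtype
  isCompl := by
    constructor
    · rw [Submodule.disjoint_def]
      intro x h0 h1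
      exact Subtype.ext (Submodule.disjoint_def.1 A.isCompl.disjoint x.1 h0 h1)
    · rw [codisjoint_iff, eq_top_iff]
      rintro ⟨x, hx⟩ -
      obtain ⟨a, ha, b, hb, ha0, hb1, h⟩ := hg x hx
      exact Submodule.mem_sup.2 ⟨⟨a, ha⟩, ha0, ⟨b, hb⟩, hb1, Subtype.ext h⟩
  bracket := LinearMap.mk₂ F (fun x y => ⟨A.bracket x.1 y.1, hN _ x.2 _ y.2⟩)
    (fun _ _ _ => Subtype.ext (by simp)) (fun _ _ _ => Subtype.ext (by simp))
    (fun _ _ _ => Subtype.ext (by simp)) (fun _ _ _ => Subtype.ext (by simp))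
  bracket_mem hx hy := A.bracket_mem hx hy
  skew hx hy := Subtype.ext (A.skew hx hy)
  jacobi hx hy hz := Subtype.ext (A.jacobi hx hy hz)
  odd_cube hx := Subtype.ext (A.odd_cube hx)

end LieSuperalgebra

/-! ### Vertex superalgebras and twisted modules -/

/-- A vertex superalgebra structure on `V`. Here `Y v n` is the mode `v_n` in
`Y(v,x) = ∑ v_n x^{-n-1}`; `jacobi` is the equality of the coefficients of
`x₀^{-l-1} x₁^{-m-1} x₂^{-n-1}` in the Jacobi identity applied to `w`. By truncation all the sums
have only finitely many nonzero terms. -/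
structure VertexSuperalgebra (F : Type*) (V : Type*) [Field F] [AddCommGroup V] [Module F V] where
  part : ZMod 2 → Submodule F V
  isCompl : IsCompl (part 0) (part 1)
  vacuum : V
  vacuum_mem : vacuum ∈ part 0
  Y : V →ₗ[F] (ℤ → Module.End F V)
  Y_mem : ∀ {α β : ZMod 2} {u v : V} (n : ℤ), u ∈ part α → v ∈ part β → Y u n v ∈ part (α + β)
  truncation : ∀ u v : V, ∃ N : ℤ, ∀ n ≥ N, Y u n v = 0
  Y_vacuum : ∀ n : ℤ, Y vacuum n = if n = -1 then 1 else 0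
  creation : ∀ v : V, Y v (-1) vacuum = v ∧ ∀ n : ℤ, 0 ≤ n → Y v n vacuum = 0
  jacobi : ∀ {α β : ZMod 2} {u v : V}, u ∈ part α → v ∈ part β → ∀ (w : V) (l m n : ℤ),
    (∑ᶠ i : ℕ, ((-1) ^ i * binom F l i) • Y u (m + l - i) (Y v (n + i) w))
      - (sgn F α β * (-1) ^ l) •
        (∑ᶠ i : ℕ, ((-1) ^ i * binom F l i) • Y v (n + l - i) (Y u (m + i) w))
      = ∑ᶠ i : ℕ, binom F m i • Y (Y u (l + i) v) (m + n - i) w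

namespace VertexSuperalgebra

variable {F : Type*} {V : Type*} [Field F] [AddCommGroup V] [Module F V]

/-- `g` is an automorphism of the vertex superalgebra. -/
structure IsAutomorphism (S : VertexSuperalgebra F V) (g : V →ₗ[F] V) : Prop where
  bijective : Function.Bijective g
  map_part : ∀ (α : ZMod 2) (v : V), v ∈ S.part α → g v ∈ S.part α
  map_vacuum : g S.vacuum = S.vacuum
  map_Y : ∀ (u v : V) (n : ℤ), g (S.Y u n v) = S.Y (g u) n (g v)

/-- `Y` is a `g`-twisted module structure on `W`, where `g ^ T = 1` and `η` is the fixed primitive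
`T`-th root of unity. Here `Y v n` is the mode `v_{n/T}` in
`Y_W(v,x) = ∑ v_{n/T} x^{-n/T-1}`; `jacobi` is the equality of the coefficients of
`x₀^{-l-1} x₁^{-m/T-1} x₂^{-n/T-1}` in the twisted Jacobi identity applied to `w` (for `m` not
congruent to `r` both sides of that identity have coefficient zero). By truncation all the sums
have only finitely many nonzero terms. -/
structure IsTwistedModule (S : VertexSuperalgebra F V) (g : V →ₗ[F] V) (T : ℕ) (η : F)
    {W : Type*} [AddCommGroup W] [Module F W] (Y : V →ₗ[F] (ℤ → Module.End F W)) : Prop where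
  support : ∀ (r : ℕ) (u : V), g u = η ^ r • u → ∀ n : ℤ, ¬ n ≡ r [ZMOD T] → Y u n = 0
  truncation : ∀ (u : V) (w : W), ∃ N : ℤ, ∀ n ≥ N, Y u n w = 0
  Y_vacuum : ∀ n : ℤ, Y S.vacuum n = if n = -T then 1 else 0
  jacobi : ∀ (r : ℕ) (α β : ZMod 2) (u v : V), g u = η ^ r • u → u ∈ S.part α → v ∈ S.part β →
    ∀ (w : W) (l m n : ℤ), m ≡ r [ZMOD T] →
    (∑ᶠ i : ℕ, ((-1) ^ i * binom F l i) • Y u (m + T * (l - i)) (Y v (n + T * i) w))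
      - (sgn F α β * (-1) ^ l) •
        (∑ᶠ i : ℕ, ((-1) ^ i * binom F l i) • Y v (n + T * (l - i)) (Y u (m + T * i) w))
      = ∑ᶠ i : ℕ, binom F ((m : ℚ) / T) i • Y (S.Y u (l + i) v) (m + n - T * i) w

end VertexSuperalgebra

/-! ### Affine Lie superalgebras -/

/-- A Lie superalgebra `𝔤` with `[𝔤₁, 𝔤₁] = 0` and a symmetric bilinear form with
`⟨𝔤₀, 𝔤₁⟩ = 0` which is invariant under `𝔤₀`. -/
structure AffineDatum (F : Type*) (𝔤 : Type*) [Field F] [AddCommGroup 𝔤] [Module F 𝔤]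
    extends LieSuperalgebra F 𝔤 where
  odd_bracket : ∀ {u v : 𝔤}, u ∈ part 1 → v ∈ part 1 → bracket u v = 0
  form : 𝔤 →ₗ[F] 𝔤 →ₗ[F] F
  form_symm : ∀ x y : 𝔤, form x y = form y x
  form_even_odd : ∀ {a u : 𝔤}, a ∈ part 0 → u ∈ part 1 → form a u = 0
  form_invariant : ∀ {a : 𝔤}, a ∈ part 0 → ∀ u v : 𝔤,
    form (bracket a u) v = -form u (bracket a v)

/-- Automorphisms of `𝔤` (as a Lie superalgebra) which preserve the form. -/
structure AffineDatum.Aut {F : Type*} {𝔤 : Type*} [Field F] [AddCommGroup 𝔤] [Module F 𝔤]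
    (D : AffineDatum F 𝔤) where
  toEquiv : 𝔤 ≃ₗ[F] 𝔤
  map_part : ∀ (α : ZMod 2) (x : 𝔤), x ∈ D.part α → toEquiv x ∈ D.part α
  map_bracket : ∀ x y : 𝔤, toEquiv (D.bracket x y) = D.bracket (toEquiv x) (toEquiv y)
  map_form : ∀ x y : 𝔤, D.form (toEquiv x) (toEquiv y) = D.form x y

namespace AffineDatum

variable {F : Type*} {𝔤 : Type*} [Field F] [AddCommGroup 𝔤] [Module F 𝔤] (D : AffineDatum F 𝔤)

/-- The underlying space of `𝔤 ⊗ F[t^{1/T}, t^{-1/T}] ⊕ F 𝐤`: the pair `(x, c)` stands for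
`∑ x n ⊗ t^{n/T} + c 𝐤`. -/
abbrev Loop (F : Type*) (𝔤 : Type*) [Field F] [AddCommGroup 𝔤] [Module F 𝔤] : Type _ :=
  (ℤ →₀ 𝔤) × F

/-- The element `a ⊗ t^{n/T}`. -/
noncomputable def elt (F : Type*) {𝔤 : Type*} [Field F] [AddCommGroup 𝔤] [Module F 𝔤]
    (n : ℤ) (a : 𝔤) : Loop F 𝔤 := (Finsupp.single n a, 0)

/-- The central element `𝐤`. -/
def central (F : Type*) (𝔤 : Type*) [Field F] [AddCommGroup 𝔤] [Module F 𝔤] : Loop F 𝔤 := (0, 1)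

/-- The projection of `𝔤` onto its even part. -/
noncomputable def proj0 : 𝔤 →ₗ[F] 𝔤 := Submodule.projection _ _ D.isCompl

/-- The projection of `𝔤` onto its odd part. -/
noncomputable def proj1 : 𝔤 →ₗ[F] 𝔤 := Submodule.projection _ _ D.isCompl.symm

/-- The coefficient of `𝐤` in `[a ⊗ t^{m/T}, b ⊗ t^{n/T}]`: it is `(m/T) δ_{m/T+n/T,0} ⟨a,b⟩` for
`a, b` even, `δ_{m/T+n/T+1,0} ⟨a,b⟩` for `a, b` odd, and zero for opposite parities. -/
noncomputable def cocycle (T : ℕ) (m n : ℤ) : 𝔤 →ₗ[F] 𝔤 →ₗ[F] F :=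
  (if m + n = 0 then (m : F) / T else 0) • D.form.compl₁₂ D.proj0 D.proj0
    + (if m + n + T = 0 then (1 : F) else 0) • D.form.compl₁₂ D.proj1 D.proj1

/-- `[a ⊗ t^{m/T}, b ⊗ t^{n/T}]` as a bilinear function of `a` and `b`. -/
noncomputable def eltBracket (T : ℕ) (m n : ℤ) : 𝔤 →ₗ[F] 𝔤 →ₗ[F] Loop F 𝔤 :=
  D.bracket.compr₂ (LinearMap.inl F (ℤ →₀ 𝔤) F ∘ₗ Finsupp.lsingle (m + n))
    + (D.cocycle T m n).compr₂ (LinearMap.inr F (ℤ →₀ 𝔤) F)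

/-- The bracket on `𝔤 ⊗ F[t^{1/T}, t^{-1/T}] ⊕ F 𝐤`, with `𝐤` central. -/
noncomputable def loopBracket (T : ℕ) : Loop F 𝔤 →ₗ[F] Loop F 𝔤 →ₗ[F] Loop F 𝔤 :=
  LinearMap.compl₁₂
    (Finsupp.lsum F fun m => LinearMap.flip (Finsupp.lsum F fun n =>
      LinearMap.flip (D.eltBracket T m n)))
    (LinearMap.fst F (ℤ →₀ 𝔤) F) (LinearMap.fst F (ℤ →₀ 𝔤) F)

/-- The even part `𝔤₀ ⊗ F[t^{1/T}, t^{-1/T}] ⊕ F 𝐤` and the odd part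
`𝔤₁ ⊗ F[t^{1/T}, t^{-1/T}]`. -/
def loopPart (α : ZMod 2) : Submodule F (Loop F 𝔤) where
  carrier := {x | (∀ n, x.1 n ∈ D.part α) ∧ (α = 1 → x.2 = 0)}
  add_mem' := fun {x y} hx hy => ⟨fun n => (D.part α).add_mem (hx.1 n) (hy.1 n), fun h => by
    simp [hx.2 h, hy.2 h]⟩
  zero_mem' := ⟨fun n => (D.part α).zero_mem, fun _ => rfl⟩
  smul_mem' := fun c x hx => ⟨fun n => (D.part α).smul_mem c (hx.1 n), fun h => by
    simp [hx.2 h]⟩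

theorem zmod_two (α : ZMod 2) : α = 0 ∨ α = 1 := by revert α; decide

theorem proj_even {a : 𝔤} (h : a ∈ D.part 0) : D.proj0 a = a ∧ D.proj1 a = 0 :=
  ⟨(Submodule.projection_eq_self_iff D.isCompl a).2 h,
    (Submodule.projection_apply_eq_zero_iff D.isCompl.symm).2 h⟩

theorem proj_odd {a : 𝔤} (h : a ∈ D.part 1) : D.proj0 a = 0 ∧ D.proj1 a = a :=
  ⟨(Submodule.projection_apply_eq_zero_iff D.isCompl).2 h,
    (Submodule.projection_eq_self_iff D.isCompl.symm a).2 h⟩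

theorem proj_add (a : 𝔤) : D.proj0 a + D.proj1 a = a := by
  obtain ⟨x, hx, y, hy, rfl⟩ := Submodule.mem_sup.1
    ((codisjoint_iff.1 D.isCompl.codisjoint).symm ▸ Submodule.mem_top : a ∈ D.part 0 ⊔ D.part 1)
  rw [map_add, map_add, (D.proj_even hx).1, (D.proj_even hx).2, (D.proj_odd hy).1,
    (D.proj_odd hy).2, add_zero, zero_add]

theorem cocycle_apply (T : ℕ) (m n : ℤ) (a b : 𝔤) : D.cocycle T m n a b =
    (if m + n = 0 then (m : F) / T else 0) * D.form (D.proj0 a) (D.proj0 b)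
      + (if m + n + T = 0 then (1 : F) else 0) * D.form (D.proj1 a) (D.proj1 b) := by
  simp only [cocycle, LinearMap.add_apply, LinearMap.smul_apply, LinearMap.compl₁₂_apply,
    smul_eq_mul]

theorem loopBracket_elt (T : ℕ) (m n : ℤ) (a b : 𝔤) :
    D.loopBracket T (elt F m a) (elt F n b)
      = elt F (m + n) (D.bracket a b) + D.cocycle T m n a b • central F 𝔤 := by
  simp [loopBracket, elt, eltBracket, central]

theorem loopBracket_central_left (T : ℕ) (x : Loop F 𝔤) :
    D.loopBracket T (central F 𝔤) x = 0 := by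
  simp [loopBracket, central]

theorem loopBracket_central_right (T : ℕ) (x : Loop F 𝔤) :
    D.loopBracket T x (central F 𝔤) = 0 := by
  simp [loopBracket, central]

/-- Homogeneous generators of parity `α`. -/
def loopGen (α : ZMod 2) : Set (Loop F 𝔤) :=
  {x | (∃ n, ∃ a ∈ D.part α, x = elt F n a) ∨ (α = 0 ∧ x = central F 𝔤)}

theorem loop_eq_sum (x : Loop F 𝔤) :
    x = (∑ n ∈ x.1.support, elt F n (x.1 n)) + x.2 • central F 𝔤 := by
  refine Prod.ext ?_ ?_
  · simp only [elt, central, Prod.fst_add, Prod.fst_sum, Prod.smul_fst, smul_zero, add_zero]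
    exact (Finsupp.sum_single x.1).symm
  · simp [elt, central, Prod.snd_sum]

theorem elt_neg (n : ℤ) (a : 𝔤) : elt F n (-a) = -elt F n a := by simp [elt]

theorem elt_add (n : ℤ) (a b : 𝔤) : elt F n (a + b) = elt F n a + elt F n b := by simp [elt]

theorem elt_smul (n : ℤ) (c : F) (a : 𝔤) : elt F n (c • a) = c • elt F n a := by simp [elt]

theorem loopPart_le (α : ZMod 2) : D.loopPart α ≤ Submodule.span F (D.loopGen α) := by
  rintro ⟨x, c⟩ ⟨hx, hc⟩
  have h1 := loop_eq_sum ((x, c) : Loop F 𝔤)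
  rw [h1]
  refine Submodule.add_mem _ (Submodule.sum_mem _ fun n _ =>
    Submodule.subset_span (Or.inl ⟨n, x n, hx n, rfl⟩)) ?_
  by_cases hα : α = 0
  · exact Submodule.smul_mem _ _ (Submodule.subset_span (Or.inr ⟨hα, rfl⟩))
  · have : α = 1 := (zmod_two α).resolve_left hα
    have hc' : c = 0 := hc this
    simp [hc']

theorem elt_mem {α : ZMod 2} (n : ℤ) {a : 𝔤} (ha : a ∈ D.part α) :
    elt F n a ∈ D.loopPart α := by
  refine ⟨fun k => ?_, fun _ => rfl⟩
  simp only [elt, Finsupp.single_apply]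
  split_ifs
  · exact ha
  · exact (D.part α).zero_mem

theorem central_mem : central F 𝔤 ∈ D.loopPart 0 :=
  ⟨fun _ => (D.part 0).zero_mem, fun h => absurd h (by decide)⟩

theorem cocycle_mixed (T : ℕ) (m n : ℤ) {α β : ZMod 2} {a b : 𝔤} (ha : a ∈ D.part α)
    (hb : b ∈ D.part β) (h : α + β = 1) : D.cocycle T m n a b = 0 := by
  rw [cocycle_apply]
  rcases zmod_two α with rfl | rfl <;> rcases zmod_two β with rfl | rfl
  · exact absurd h (by decide)
  · simp [D.proj_even ha, D.proj_odd hb]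
  · simp [D.proj_even hb, D.proj_odd ha]
  · exact absurd h (by decide)

theorem cocycle_even (T : ℕ) (m n : ℤ) {a b : 𝔤} (ha : a ∈ D.part 0)
    (hb : b ∈ D.part 0) :
    D.cocycle T m n a b = (if m + n = 0 then (m : F) / T else 0) * D.form a b := by
  rw [cocycle_apply]
  simp [D.proj_even ha, D.proj_even hb]

theorem cocycle_odd (T : ℕ) (m n : ℤ) {a b : 𝔤} (ha : a ∈ D.part 1)
    (hb : b ∈ D.part 1) :
    D.cocycle T m n a b = (if m + n + T = 0 then (1 : F) else 0) * D.form a b := by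
  rw [cocycle_apply]
  simp [D.proj_odd ha, D.proj_odd hb]

theorem sgn_00 : sgn F 0 0 = 1 := by simp [sgn]
theorem sgn_01 : sgn F 0 1 = 1 := by simp [sgn]
theorem sgn_10 : sgn F 1 0 = 1 := by simp [sgn]
theorem sgn_11 : sgn F 1 1 = -1 := by simp [sgn, ZMod.val_one]

theorem cocycle_skew (T : ℕ) (m n : ℤ) {α β : ZMod 2} {a b : 𝔤} (ha : a ∈ D.part α)
    (hb : b ∈ D.part β) :
    D.cocycle T m n a b = -(sgn F α β * D.cocycle T n m b a) := by
  rcases zmod_two α with rfl | rfl <;> rcases zmod_two β with rfl | rfl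
  · rw [D.cocycle_even T m n ha hb, D.cocycle_even T n m hb ha, D.form_symm b a, sgn_00,
      add_comm n m]
    split_ifs with h
    · have : (m : F) = -n := by
        rw [show m = -n by omega]; push_cast; rfl
      rw [this]; ring
    · ring
  · rw [D.cocycle_mixed T m n ha hb (by decide), D.cocycle_mixed T n m hb ha (by decide)]; simp
  · rw [D.cocycle_mixed T m n ha hb (by decide), D.cocycle_mixed T n m hb ha (by decide)]; simp
  · rw [D.cocycle_odd T m n ha hb, D.cocycle_odd T n m hb ha, D.form_symm b a, sgn_11,
      add_comm n m]
    ring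

theorem cocycle_jacobi (T : ℕ) (l m n : ℤ) {α β γ : ZMod 2} {a b c : 𝔤} (ha : a ∈ D.part α)
    (hb : b ∈ D.part β) (hc : c ∈ D.part γ) :
    D.cocycle T l (m + n) a (D.bracket b c) = D.cocycle T (l + m) n (D.bracket a b) c
      + sgn F α β * D.cocycle T m (l + n) b (D.bracket a c) := by
  have hab := D.bracket_mem ha hb
  have hac := D.bracket_mem ha hc
  have hbc := D.bracket_mem hb hc
  by_cases h : α + β + γ = 1
  · rw [D.cocycle_mixed T _ _ ha hbc (by rw [← h]; ring),
      D.cocycle_mixed T _ _ hab hc h,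
      D.cocycle_mixed T _ _ hb hac (by rw [← h]; ring)]
    simp
  rcases zmod_two α with rfl | rfl <;> rcases zmod_two β with rfl | rfl <;>
    rcases zmod_two γ with rfl | rfl <;> (try exact absurd (by decide) h)
  · rw [D.cocycle_even T _ _ ha hbc, D.cocycle_even T _ _ hab hc, D.cocycle_even T _ _ hb hac,
      sgn_00, add_assoc l m n, show m + (l + n) = l + (m + n) by ring]
    split_ifs
    · have h1 : D.form b (D.bracket a c) = -D.form (D.bracket a b) c := by
        rw [D.form_invariant ha]; simp
      have h2 : D.form (D.bracket a b) c = D.form a (D.bracket b c) := by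
        rw [D.skew ha hb, sgn_00, one_smul, map_neg, LinearMap.neg_apply, D.form_invariant hb]
        simp
      rw [h1, h2]; push_cast; ring
    · ring
  · have hs : sgn F 0 1 = 1 := sgn_01
    rw [show D.bracket b c = 0 from D.odd_bracket hb hc, D.cocycle_odd T _ _ hab hc,
      D.cocycle_odd T _ _ hb hac, hs, add_assoc l m n, show m + (l + n) = l + (m + n) by ring,
      D.form_invariant ha, map_zero]
    ring
  · have hs : sgn F 1 0 = 1 := sgn_10
    rw [show D.bracket a c = 0 from D.odd_bracket ha hc, D.cocycle_odd T _ _ ha hbc,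
      D.cocycle_odd T _ _ hab hc, add_assoc l m n, D.skew ha hb, hs, one_smul,
      map_neg, LinearMap.neg_apply, D.form_invariant hb, map_zero]
    ring
  · have hs : sgn F 1 0 = 1 := sgn_10
    have hca : D.bracket c a ∈ D.part (0 + 1) := D.bracket_mem hc ha
    have h1 : D.form a (D.bracket b c) = -D.form b (D.bracket a c) := by
      rw [D.skew hb hc, D.skew ha hc, hs, one_smul, one_smul, map_neg, map_neg, neg_neg,
        D.form_symm b, D.form_invariant hc]
    rw [show D.bracket a b = 0 from D.odd_bracket ha hb, D.cocycle_odd T _ _ ha hbc,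
      D.cocycle_odd T _ _ hb hac, sgn_11,
      show m + (l + n) = l + (m + n) by ring, h1, map_zero, LinearMap.zero_apply]
    ring

/-- The Lie superalgebra `𝔤 ⊗ F[t^{1/T}, t^{-1/T}] ⊕ F 𝐤`. -/
noncomputable def loop (T : ℕ) : LieSuperalgebra F (Loop F 𝔤) where
  part := D.loopPart
  isCompl := by
    constructor
    · rw [Submodule.disjoint_def]
      intro x h0 h1
      refine Prod.ext (Finsupp.ext fun n => ?_) (h1.2 rfl)
      exact Submodule.disjoint_def.1 D.isCompl.disjoint _ (h0.1 n) (h1.1 n)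
    · rw [codisjoint_iff, eq_top_iff]
      intro x _
      refine Submodule.mem_sup.2 ⟨(x.1.mapRange D.proj0 (map_zero _), x.2), ⟨fun n => ?_, ?_⟩,
        (x.1.mapRange D.proj1 (map_zero _), 0), ⟨fun n => ?_, fun _ => rfl⟩, ?_⟩
      · exact Submodule.projection_apply_mem _ _
      · exact fun h => absurd h (by decide)
      · exact Submodule.projection_apply_mem _ _
      · exact Prod.ext (Finsupp.ext fun n => D.proj_add (x.1 n)) (add_zero _)
  bracket := D.loopBracket T
  bracket_mem {α β x y} hx hy := by
    refine Submodule.span_induction₂ (p := fun x y _ _ => D.loopBracket T x y ∈ D.loopPart (α + β))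
      ?_ ?_ ?_ ?_ ?_ ?_ ?_ (D.loopPart_le α hx) (D.loopPart_le β hy)
    · rintro x y (⟨m, a, ha, rfl⟩ | ⟨-, rfl⟩) (⟨n, b, hb, rfl⟩ | ⟨-, rfl⟩)
      · rw [loopBracket_elt]
        refine Submodule.add_mem _ (D.elt_mem _ (D.bracket_mem ha hb)) ?_
        rcases zmod_two (α + β) with h | h
        · rw [h]; exact Submodule.smul_mem _ _ D.central_mem
        · rw [D.cocycle_mixed T m n ha hb h, zero_smul]; exact Submodule.zero_mem _
      all_goals simp [loopBracket_central_left, loopBracket_central_right]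
    · intro y _; simp
    · intro y _; simp
    · intro x y z _ _ _ h1 h2
      rw [map_add, LinearMap.add_apply]; exact Submodule.add_mem _ h1 h2
    · intro x y z _ _ _ h1 h2
      rw [map_add]; exact Submodule.add_mem _ h1 h2
    · intro r x y _ _ h
      rw [map_smul, LinearMap.smul_apply]; exact Submodule.smul_mem _ _ h
    · intro r x y _ _ h
      rw [map_smul]; exact Submodule.smul_mem _ _ h
  skew {α β x y} hx hy := by
    refine Submodule.span_induction₂
      (p := fun x y _ _ => D.loopBracket T x y = -(sgn F α β • D.loopBracket T y x))
      ?_ ?_ ?_ ?_ ?_ ?_ ?_ (D.loopPart_le α hx) (D.loopPart_le β hy)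
    · rintro x y (⟨m, a, ha, rfl⟩ | ⟨-, rfl⟩) (⟨n, b, hb, rfl⟩ | ⟨-, rfl⟩)
      · rw [loopBracket_elt, loopBracket_elt, D.skew ha hb, D.cocycle_skew T m n ha hb,
          elt_neg, elt_smul, add_comm n m]
        module
      all_goals simp [loopBracket_central_left, loopBracket_central_right]
    · intro y _; simp
    · intro y _; simp
    · intro x y z _ _ _ h1 h2
      rw [map_add, LinearMap.add_apply, h1, h2, map_add]; module
    · intro x y z _ _ _ h1 h2
      rw [map_add, h1, h2, map_add, LinearMap.add_apply]; module
    · intro r x y _ _ h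
      rw [map_smul, LinearMap.smul_apply, h, map_smul]; module
    · intro r x y _ _ h
      rw [map_smul, h, map_smul, LinearMap.smul_apply]; module
  jacobi {α β γ x y z} hx hy hz := by
    refine Submodule.span_induction (p := fun z _ =>
      D.loopBracket T x (D.loopBracket T y z) = D.loopBracket T (D.loopBracket T x y) z
        + sgn F α β • D.loopBracket T y (D.loopBracket T x z))
      ?_ (by simp) ?_ ?_ (D.loopPart_le γ hz)
    · intro z hz
      refine Submodule.span_induction₂ (p := fun x y _ _ =>
        D.loopBracket T x (D.loopBracket T y z) = D.loopBracket T (D.loopBracket T x y) z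
          + sgn F α β • D.loopBracket T y (D.loopBracket T x z))
        ?_ ?_ ?_ ?_ ?_ ?_ ?_ (D.loopPart_le α hx) (D.loopPart_le β hy)
      · rcases hz with ⟨n, c, hc, rfl⟩ | ⟨-, rfl⟩
        · rintro x y (⟨l, a, ha, rfl⟩ | ⟨-, rfl⟩) (⟨m, b, hb, rfl⟩ | ⟨-, rfl⟩)
          · simp only [loopBracket_elt, map_add, LinearMap.add_apply, map_smul,
              LinearMap.smul_apply, loopBracket_central_left, loopBracket_central_right,
              smul_zero, add_zero]
            rw [D.jacobi ha hb hc, D.cocycle_jacobi T l m n ha hb hc, elt_add, elt_smul,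
              add_assoc l m n, show m + (l + n) = l + (m + n) by ring]
            module
          all_goals simp [loopBracket_central_left, loopBracket_central_right]
        · intro x y _ _
          simp [loopBracket_central_right]
      · intro y _; simp
      · intro y _; simp
      · intro x y w _ _ _ h1 h2
        simp only [map_add, LinearMap.add_apply, h1, h2]; module
      · intro x y w _ _ _ h1 h2
        simp only [map_add, LinearMap.add_apply, h1, h2]; module
      · intro r x y _ _ h
        simp only [map_smul, LinearMap.smul_apply, h]; module
      · intro r x y _ _ h
        simp only [map_smul, LinearMap.smul_apply, h]; module
    · intro z w _ _ h1 h2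
      simp only [map_add, h1, h2]; module
    · intro r z _ h
      simp only [map_smul, h]; module
  odd_cube {x} hx := by
    have key : ∀ y ∈ D.loopPart 1, ∃ c : F, D.loopBracket T x y = c • central F 𝔤 := by
      intro y hy
      refine Submodule.span_induction₂ (p := fun x y _ _ =>
        ∃ c : F, D.loopBracket T x y = c • central F 𝔤)
        ?_ ?_ ?_ ?_ ?_ ?_ ?_ (D.loopPart_le 1 hx) (D.loopPart_le 1 hy)
      · rintro x y (⟨m, a, ha, rfl⟩ | ⟨h, -⟩) (⟨n, b, hb, rfl⟩ | ⟨h, -⟩)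
        · refine ⟨D.cocycle T m n a b, ?_⟩
          rw [loopBracket_elt, D.odd_bracket ha hb]
          simp [elt]
        all_goals exact absurd h (by decide)
      · intro y _; exact ⟨0, by simp⟩
      · intro y _; exact ⟨0, by simp⟩
      · rintro x y z _ _ _ ⟨c, h1⟩ ⟨d, h2⟩
        exact ⟨c + d, by rw [map_add, LinearMap.add_apply, h1, h2, add_smul]⟩
      · rintro x y z _ _ _ ⟨c, h1⟩ ⟨d, h2⟩
        exact ⟨c + d, by rw [map_add, h1, h2, add_smul]⟩
      · rintro r x y _ _ ⟨c, h⟩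
        exact ⟨r * c, by rw [map_smul, LinearMap.smul_apply, h, mul_smul]⟩
      · rintro r x y _ _ ⟨c, h⟩
        exact ⟨r * c, by rw [map_smul, h, mul_smul]⟩
    obtain ⟨c, hc⟩ := key x hx
    rw [hc, map_smul, loopBracket_central_right, smul_zero]

/-- The affine Lie superalgebra `ĝ = 𝔤 ⊗ F[t, t⁻¹] ⊕ F 𝐤`. -/
noncomputable abbrev affine : LieSuperalgebra F (Loop F 𝔤) := D.loop 1

/-! ### The vacuum module `V_ĝ(ℓ,0)` -/

/-- The left ideal of `U(ĝ)` generated by `a ⊗ tⁿ` (`a ∈ 𝔤`, `n ≥ 0`) and `𝐤 - ℓ`. -/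
noncomputable def vacIdeal (ℓ : F) : Submodule D.affine.UEA D.affine.UEA :=
  Submodule.span D.affine.UEA ({u | ∃ (n : ℕ) (a : 𝔤), u = D.affine.ι (elt F n a)} ∪
    {D.affine.ι (central F 𝔤) - algebraMap F D.affine.UEA ℓ})

/-- The vacuum module `V_ĝ(ℓ,0)`: the `ĝ`-module induced from the one-dimensional module over
`𝔤 ⊗ F[t] ⊕ F 𝐤` on which `𝔤 ⊗ F[t]` acts as zero and `𝐤` as `ℓ`. -/
abbrev Vac (ℓ : F) : Type _ := D.affine.UEA ⧸ D.vacIdeal ℓ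

/-- The vacuum vector `𝟏 = 1 ⊗ 1`. -/
noncomputable def vac (ℓ : F) : D.Vac ℓ := Submodule.Quotient.mk 1

/-- The vector `(a ⊗ t⁻¹)𝟏`, which is identified with `a ∈ 𝔤`. -/
noncomputable def state (ℓ : F) (a : 𝔤) : D.Vac ℓ := D.affine.ι (elt F (-1) a) • D.vac ℓ

/-- The component of parity `α` of `V_ĝ(ℓ,0)`. -/
noncomputable def vacPart (ℓ : F) (α : ZMod 2) : Submodule F (D.Vac ℓ) :=
  (D.affine.ueaPart α).map ((D.vacIdeal ℓ).mkQ.restrictScalars F)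

/-- `S` is a vertex superalgebra structure on the superspace `V_ĝ(ℓ,0)` with vacuum vector `𝟏` and
`Y(a,x) = a(x) = ∑ (a ⊗ tⁿ) x^{-n-1}` for `a ∈ 𝔤`. -/
structure IsAffineVA (ℓ : F) (S : VertexSuperalgebra F (D.Vac ℓ)) : Prop where
  part_eq : S.part = D.vacPart ℓ
  vacuum_eq : S.vacuum = D.vac ℓ
  Y_state : ∀ (a : 𝔤) (n : ℤ) (v : D.Vac ℓ),
    S.Y (D.state ℓ a) n v = D.affine.ι (elt F n a) • v

variable {D}

/-- The automorphism `a ⊗ tⁿ ↦ τ(a) ⊗ tⁿ`, `𝐤 ↦ 𝐤` of `ĝ`. -/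
noncomputable def Aut.affineMap (τ : D.Aut) : Loop F 𝔤 →ₗ[F] Loop F 𝔤 :=
  LinearMap.prodMap (Finsupp.mapRange.linearMap τ.toEquiv.toLinearMap) LinearMap.id

theorem Aut.proj_comm (τ : D.Aut) (x : 𝔤) :
    τ.toEquiv (D.proj0 x) = D.proj0 (τ.toEquiv x) ∧
      τ.toEquiv (D.proj1 x) = D.proj1 (τ.toEquiv x) := by
  have h0 := D.proj_even (τ.map_part 0 _ (Submodule.projection_apply_mem D.isCompl x))
  have h1 := D.proj_odd (τ.map_part 1 _ (Submodule.projection_apply_mem D.isCompl.symm x))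
  change D.proj0 (τ.toEquiv (D.proj0 x)) = τ.toEquiv (D.proj0 x) ∧
    D.proj1 (τ.toEquiv (D.proj0 x)) = 0 at h0
  change D.proj0 (τ.toEquiv (D.proj1 x)) = 0 ∧
    D.proj1 (τ.toEquiv (D.proj1 x)) = τ.toEquiv (D.proj1 x) at h1
  have hx : τ.toEquiv x = τ.toEquiv (D.proj0 x) + τ.toEquiv (D.proj1 x) := by
    rw [← map_add, D.proj_add]
  constructor
  · rw [hx, map_add, h0.1, h1.1, add_zero]
  · rw [hx, map_add, h0.2, h1.2, zero_add]

theorem Aut.affineMap_elt (τ : D.Aut) (n : ℤ) (a : 𝔤) :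
    τ.affineMap (elt F n a) = elt F n (τ.toEquiv a) := by
  simp [Aut.affineMap, elt]

theorem Aut.affineMap_central (τ : D.Aut) : τ.affineMap (central F 𝔤) = central F 𝔤 := by
  simp [Aut.affineMap, central]

theorem Aut.cocycle_map (τ : D.Aut) (T : ℕ) (m n : ℤ) (a b : 𝔤) :
    D.cocycle T m n (τ.toEquiv a) (τ.toEquiv b) = D.cocycle T m n a b := by
  simp only [cocycle_apply, ← (τ.proj_comm _).1, ← (τ.proj_comm _).2, τ.map_form]

theorem Aut.affineMap_bracket (τ : D.Aut) (T : ℕ) (x y : Loop F 𝔤) :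
    τ.affineMap ((D.loop T).bracket x y) = (D.loop T).bracket (τ.affineMap x) (τ.affineMap y) := by
  change τ.affineMap (D.loopBracket T x y) = D.loopBracket T (τ.affineMap x) (τ.affineMap y)
  rw [loop_eq_sum x, loop_eq_sum y]
  simp only [map_add, map_sum, map_smul, LinearMap.add_apply, LinearMap.sum_apply,
    LinearMap.smul_apply, loopBracket_elt, loopBracket_central_left, loopBracket_central_right,
    τ.affineMap_elt, τ.affineMap_central, τ.cocycle_map, τ.map_bracket, smul_zero, map_zero]

theorem Aut.affineMap_part (τ : D.Aut) (T : ℕ) (α : ZMod 2) (x : Loop F 𝔤)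
    (hx : x ∈ (D.loop T).part α) : τ.affineMap x ∈ (D.loop T).part α :=
  ⟨fun n => τ.map_part α _ (hx.1 n), hx.2⟩

/-- The algebra endomorphism of `U(ĝ)` induced by `τ`. -/
noncomputable def Aut.affineUEA (τ : D.Aut) : D.affine.UEA →ₐ[F] D.affine.UEA :=
  D.affine.ueaMap τ.affineMap (τ.affineMap_bracket 1) (τ.affineMap_part 1)

theorem Aut.affineUEA_mem (τ : D.Aut) (ℓ : F) (u : D.affine.UEA) (hu : u ∈ D.vacIdeal ℓ) :
    τ.affineUEA u ∈ D.vacIdeal ℓ := by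
  refine Submodule.span_induction (p := fun u _ => τ.affineUEA u ∈ D.vacIdeal ℓ) ?_ ?_ ?_ ?_ hu
  · rintro u (⟨n, a, rfl⟩ | rfl)
    · rw [Aut.affineUEA, LieSuperalgebra.ueaMap_ι, τ.affineMap_elt]
      exact Submodule.subset_span (Or.inl ⟨n, _, rfl⟩)
    · rw [map_sub, AlgHom.commutes, Aut.affineUEA, LieSuperalgebra.ueaMap_ι, τ.affineMap_central]
      exact Submodule.subset_span (Or.inr rfl)
  · rw [map_zero]; exact Submodule.zero_mem _
  · intro x y _ _ h1 h2; rw [map_add]; exact Submodule.add_mem _ h1 h2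
  · intro a x _ h; rw [smul_eq_mul, map_mul]; exact Submodule.smul_mem _ _ h

/-- The map induced by `τ` on `V_ĝ(ℓ,0)`. -/
noncomputable def Aut.onVac (τ : D.Aut) (ℓ : F) : D.Vac ℓ →ₗ[F] D.Vac ℓ :=
  (Submodule.Quotient.restrictScalarsEquiv F (D.vacIdeal ℓ)).toLinearMap ∘ₗ
    (Submodule.mapQ ((D.vacIdeal ℓ).restrictScalars F) ((D.vacIdeal ℓ).restrictScalars F)
      τ.affineUEA.toLinearMap (τ.affineUEA_mem ℓ)) ∘ₗ
    (Submodule.Quotient.restrictScalarsEquiv F (D.vacIdeal ℓ)).symm.toLinearMap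

/-! ### The twisted affine Lie superalgebra -/

/-- The underlying space of `ĝ[τ] = ⨁ᵢ 𝔤ᵢ ⊗ t^{i/T} F[t, t⁻¹] ⊕ F 𝐤`, where `𝔤ᵢ` is the
`ηⁱ`-eigenspace of `τ`: the coefficient of `t^{n/T}` lies in `𝔤ₙ`. -/
def Aut.twistedSpace (τ : D.Aut) (η : Fˣ) : Submodule F (Loop F 𝔤) where
  carrier := {x | ∀ n : ℤ, τ.toEquiv (x.1 n) = ((η ^ n : Fˣ) : F) • x.1 n}
  add_mem' := fun {x y} hx hy n => by
    rw [Prod.fst_add, Finsupp.add_apply, map_add, hx n, hy n, smul_add]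
  zero_mem' := fun n => by simp
  smul_mem' := fun c x hx n => by
    rw [Prod.smul_fst, Finsupp.smul_apply, map_smul, hx n, smul_comm]

theorem Aut.elt_mem_twisted (τ : D.Aut) (η : Fˣ) {n : ℤ} {a : 𝔤}
    (h : τ.toEquiv a = ((η ^ n : Fˣ) : F) • a) : elt F n a ∈ τ.twistedSpace η := by
  intro k
  by_cases hk : n = k
  · subst hk; simpa [elt] using h
  · simp [elt, Finsupp.single_eq_of_ne' hk]

theorem Aut.central_mem_twisted (τ : D.Aut) (η : Fˣ) : central F 𝔤 ∈ τ.twistedSpace η := by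
  intro k; simp [central]

theorem Aut.bracket_mem_twisted (τ : D.Aut) (η : Fˣ) (T : ℕ) : ∀ x ∈ τ.twistedSpace η,
    ∀ y ∈ τ.twistedSpace η, (D.loop T).bracket x y ∈ τ.twistedSpace η := by
  intro x hx y hy
  change D.loopBracket T x y ∈ _
  rw [loop_eq_sum x, loop_eq_sum y]
  simp only [map_add, map_sum, map_smul, LinearMap.add_apply, LinearMap.sum_apply,
    LinearMap.smul_apply, loopBracket_central_left, loopBracket_central_right, smul_zero,
    Finset.sum_const_zero, add_zero]
  refine Submodule.sum_mem _ fun m _ => Submodule.sum_mem _ fun n _ => ?_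
  rw [loopBracket_elt]
  refine Submodule.add_mem _ (τ.elt_mem_twisted η ?_)
    (Submodule.smul_mem _ _ (τ.central_mem_twisted η))
  rw [τ.map_bracket]
  simp only [hx _, hy _, map_smul, LinearMap.smul_apply, smul_smul, zpow_add, Units.val_mul]
  try rw [mul_comm]

theorem Aut.graded_twisted (τ : D.Aut) (η : Fˣ) (T : ℕ) : ∀ x ∈ τ.twistedSpace η,
    ∃ a ∈ τ.twistedSpace η, ∃ b ∈ τ.twistedSpace η,
      a ∈ (D.loop T).part 0 ∧ b ∈ (D.loop T).part 1 ∧ a + b = x := by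
  intro x hx
  refine ⟨(x.1.mapRange D.proj0 (map_zero _), x.2), fun n => ?_,
    (x.1.mapRange D.proj1 (map_zero _), 0), fun n => ?_, ⟨fun n => ?_, ?_⟩,
    ⟨fun n => ?_, fun _ => rfl⟩, ?_⟩
  · simp [(τ.proj_comm _).1, hx n]
  · simp [(τ.proj_comm _).2, hx n]
  · exact Submodule.projection_apply_mem _ _
  · exact fun h => absurd h (by decide)
  · exact Submodule.projection_apply_mem _ _
  · exact Prod.ext (Finsupp.ext fun n => D.proj_add (x.1 n)) (add_zero _)

/-- The twisted affine Lie superalgebra `ĝ[τ]`. -/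
noncomputable def Aut.twistedAffine (τ : D.Aut) (T : ℕ) (η : Fˣ) :
    LieSuperalgebra F (τ.twistedSpace η) :=
  (D.loop T).restrict (τ.twistedSpace η) (τ.bracket_mem_twisted η T) (τ.graded_twisted η T)

/-- The element `a ⊗ t^{n/T}` of `ĝ[τ]`, for `a ∈ 𝔤ₙ`. -/
noncomputable def Aut.mode (τ : D.Aut) (η : Fˣ) (n : ℤ) (a : 𝔤)
    (h : τ.toEquiv a = ((η ^ n : Fˣ) : F) • a) : τ.twistedSpace η :=
  ⟨elt F n a, τ.elt_mem_twisted η h⟩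

/-- `ρ` makes `W` a locally truncated `ĝ[τ]`-module of level `ℓ`. -/
structure Aut.IsLocallyTruncatedModule (τ : D.Aut) (T : ℕ) (η : Fˣ) (ℓ : F) {W : Type*}
    [AddCommGroup W] [Module F W] (ρ : τ.twistedSpace η →ₗ[F] Module.End F W) : Prop where
  isModule : (τ.twistedAffine T η).IsModule ρ
  level : ρ ⟨central F 𝔤, τ.central_mem_twisted η⟩ = ℓ • 1
  truncated : ∀ w : W, ∃ N : ℤ, ∀ n ≥ N, ∀ (a : 𝔤) (h : τ.toEquiv a = ((η ^ n : Fˣ) : F) • a),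
    ρ (τ.mode η n a h) w = 0

theorem Aut.eigen_congr (τ : D.Aut) {T : ℕ} {η : Fˣ} (hη : IsPrimitiveRoot η T) {i k : ℤ} {a : 𝔤}
    (h : τ.toEquiv a = ((η ^ i : Fˣ) : F) • a) (hk : k ≡ i [ZMOD T]) :
    τ.toEquiv a = ((η ^ k : Fˣ) : F) • a := by
  obtain ⟨c, hc⟩ := hk.dvd
  have : η ^ i = η ^ k := by
    rw [show i = k + T * c by omega, zpow_add, zpow_mul, zpow_natCast, hη.pow_eq_one]
    simp
  rw [← this]; exact h

open Classical in
/-- For `a ∈ 𝔤ᵢ`, the coefficients of `a_τ(z) = ∑ (a ⊗ t^{k/T}) z^{-k/T-1}`, the sum being over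
the integers `k ≡ i` modulo `T`: the value at `k` is the coefficient of `z^{-k/T-1}`. -/
noncomputable def Aut.twistedField (τ : D.Aut) {T : ℕ} {η : Fˣ} (hη : IsPrimitiveRoot η T)
    {W : Type*} [AddCommGroup W] [Module F W] (ρ : τ.twistedSpace η →ₗ[F] Module.End F W)
    (i : ℤ) (a : 𝔤) (h : τ.toEquiv a = ((η ^ i : Fˣ) : F) • a) (k : ℤ) : Module.End F W :=
  if hk : k ≡ i [ZMOD T] then ρ (τ.mode η k a (τ.eigen_congr hη h hk)) else 0

end AffineDatum

end SuperVA

open SuperVA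

set_option linter.unusedSectionVars false

/-! Since `T` is prime to `p`, every `m/T` is a `p`-adic integer, and the `p`-adic integers form a
binomial ring. All coefficients are therefore reductions of `p`-adic binomial coefficients (`bin`,
`binom_eq_bin`). Pascal's rule, Vandermonde's identity and trinomial revision then hold in
characteristic `p`, where formulas with `i!` in a denominator are not available.

For fields `A` and `C` on `W`, `br ε A C l m n` is the coefficient of the left side of the twisted
Jacobi identity. The right side `rhs` applies `∑ (m/T choose i) Sⁱ` to the family `D` of products
`A_l C`, where `S` raises `l` by one and lowers `n` by `T`. Both sides obey `e(l+1, m, n) = e(l,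
m+T, n) - e(l, m, n+T)`. So once the bracket vanishes for large `l` (locality), the identity `Jac`
follows from a single value of `m` (`Jac.of_fst`) or from representative values of `n`
(`Jac.of_snd`). On families vanishing for large `l` the operator is `(1+S)^(m/T)`, invertible with
inverse `(1+S)^(-m/T)`. Hence products are unique (`Jac.unique`), and local fields have them
(`exists_jac`).

The commutator of two bracket operators (`br_br`) is binomial algebra. It yields Dong's lemma
(`Jac.isLocal`) and a commutator formula for products (`Jac.commute`). For the generating fields of
`ĝ[τ]` this says that the fields local with all generators form a `ĝ`-module of level `ℓ` under the
products (`act_comm`): the fields are twisted, but the product index is an integer, so the untwisted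
algebra acts. As `W` carries no grading, parity is recorded by working with pairs of fields. The
identity field is killed by `𝔤 ⊗ F[t]`, so the universal property of the induced module gives a map
`vertexMap` from `V` to fields on `W`, without any basis of `V`. It satisfies the Jacobi identity
when the left entry is a generator (`isVacRep`), and it is the only such map, because `V` is
generated from `𝟏` and products are unique (`IsVacRep.unique`).

With `T = 1` and `W = V` this defines the vertex operators of `V`. The Jacobi identity for arbitrary
`u` and `v` (`IsVacRep.jac_of_eigen`) goes by induction on `v`. For `v = 𝟏` it says that `Y(u_{-j-1}
𝟏)` is a divided derivative of `Y(u)` (`IsVacRep.deriv`); the passage from `v` to `a_k v` is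
`Jac.commute` again. This one statement proves both the vertex superalgebra axiom and the twisted
module axiom. That the two parity components of `V` are independent follows from the parity
involution and `p > 2`.

Conversely, in a twisted module the case `l = 0` of the identity for two generators is the
commutation relation of `ĝ[τ]`, since among the `a_q b` with `q ≥ 0` only `a_0 b` and `a_1 b` can be
nonzero. -/

namespace SuperVA

open Finset.HasAntidiagonal (antidiagonal mem_antidiagonal)

/-! ### Binomial coefficients -/

section Binomial

variable {p : ℕ} [Fact p.Prime] {F : Type*} [Field F] [CharP F p]

/-- The reduction map from the `p`-adic integers to a field of characteristic `p`. -/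
noncomputable def resHom (p : ℕ) [Fact p.Prime] (F : Type*) [Field F] [CharP F p] : ℤ_[p] →+* F :=
  (ZMod.castHom dvd_rfl F).comp PadicInt.toZMod

/-- The reduction modulo `p` of a binomial coefficient with `p`-adic integral argument. -/
noncomputable def bin (a : ℤ_[p]) (i : ℕ) : F := resHom p F (Ring.choose a i)

@[simp] theorem bin_zero (a : ℤ_[p]) : (bin a 0 : F) = 1 := by simp [bin]

@[simp] theorem bin_one (a : ℤ_[p]) : (bin a 1 : F) = resHom p F a := by simp [bin]

theorem bin_natCast (n i : ℕ) : (bin (n : ℤ_[p]) i : F) = (n.choose i : F) := by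
  rw [bin, Ring.choose_natCast, map_natCast]

theorem bin_zero_left (i : ℕ) : (bin (0 : ℤ_[p]) i : F) = if i = 0 then 1 else 0 := by
  have := bin_natCast (p := p) (F := F) 0 i
  rw [Nat.cast_zero] at this
  rw [this]
  cases i <;> simp

theorem bin_add (a b : ℤ_[p]) (n : ℕ) :
    (bin (a + b) n : F) = ∑ ij ∈ antidiagonal n, bin a ij.1 * bin b ij.2 := by
  simp only [bin, Ring.add_choose_eq n (Commute.all a b), map_sum, map_mul]

theorem bin_mul_bin (a : ℤ_[p]) (i j : ℕ) :
    (bin a i * bin (a - (i : ℤ_[p])) j : F) = ((i + j).choose i : F) * bin a (i + j) := by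
  have h := Ring.choose_smul_choose a (Nat.le_add_right i j)
  rw [Nat.add_sub_cancel_left, nsmul_eq_mul] at h
  rw [bin, bin, bin, ← map_mul, ← h, map_mul, map_natCast]

theorem bin_mul_bin' (a : ℤ_[p]) (i j : ℕ) :
    (bin a i * bin (a - (i : ℤ_[p])) j : F) = bin a j * bin (a - (j : ℤ_[p])) i := by
  rw [bin_mul_bin, bin_mul_bin, add_comm j i, Nat.choose_symm_add]

theorem bin_succ (a : ℤ_[p]) (i : ℕ) :
    (bin (a + 1) (i + 1) : F) = bin a i + bin a (i + 1) := by
  rw [bin, bin, bin, Ring.choose_succ_succ, map_add]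

theorem bin_add_neg (a : ℤ_[p]) (n : ℕ) :
    (∑ ij ∈ antidiagonal n, bin a ij.1 * bin (-a) ij.2 : F) = if n = 0 then 1 else 0 := by
  rw [← bin_add, add_neg_cancel, bin_zero_left]

/-- The cast to `F` divides the numerator by the denominator, and would return a junk value if the
latter vanished in `F`. A rational number that is a `p`-adic integer has denominator prime to `p`,
so this cannot happen. -/
theorem resHom_rat (q : ℚ) (a : ℤ_[p]) (h : (a : ℚ_[p]) = q) : (q : F) = resHom p F a := by
  have ha : a * (q.den : ℤ_[p]) = (q.num : ℤ_[p]) := by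
    apply Subtype.ext
    push_cast
    rw [h]
    exact_mod_cast Rat.mul_den_eq_num q
  -- If `p` divided the denominator, `a * den = num` would make it divide the numerator as well,
  -- against lowest terms.
  have hd : ¬ p ∣ q.den := by
    intro hd
    have hn : (p : ℤ) ∣ q.num := by
      have h1 : (p : ℤ_[p]) ∣ (q.num : ℤ_[p]) := by
        rw [← ha]
        exact Dvd.dvd.mul_left (Nat.cast_dvd_cast hd) a
      rw [← PadicInt.norm_int_lt_one_iff_dvd]
      exact PadicInt.norm_lt_one_iff_dvd _ |>.2 h1
    have h2 : p ∣ q.num.natAbs := Int.natCast_dvd.1 hn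
    have h3 := Nat.dvd_gcd h2 hd
    rw [Nat.Coprime.gcd_eq_one q.reduced] at h3
    exact (Fact.out : p.Prime).one_lt.ne' (Nat.dvd_one.1 h3)
  have hd' : ((q.den : ℕ) : F) ≠ 0 := by
    rwa [Ne, CharP.cast_eq_zero_iff F p]
  rw [Rat.cast_def, div_eq_iff hd', ← map_natCast (resHom p F), ← map_mul, ha, map_intCast]

theorem factorial_mul_choose (a : ℤ_[p]) (i : ℕ) :
    (i.factorial : ℤ_[p]) * Ring.choose a i = ∏ j ∈ Finset.range i, (a - (j : ℤ_[p])) := by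
  induction i with
  | zero => simp
  | succ i ih =>
    have h := Ring.choose_smul_choose a (Nat.le_succ i)
    rw [Nat.succ_sub (le_refl i), Nat.sub_self, Ring.choose_one_right, nsmul_eq_mul,
      Nat.succ_eq_add_one, Nat.choose_succ_self_right] at h
    rw [Finset.prod_range_succ, ← ih, mul_assoc, ← h, Nat.factorial_succ]
    push_cast
    ring

/-- The bridge from the rational coefficients of the statement to `bin`. As `i!` may vanish in `F`,
the comparison is made in `ℚ_[p]` before reducing. -/
theorem binom_eq_bin (q : ℚ) (a : ℤ_[p]) (h : (a : ℚ_[p]) = q) (i : ℕ) :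
    binom F q i = bin a i := by
  refine resHom_rat _ _ ?_
  have h1 := congrArg (fun x : ℤ_[p] => (x : ℚ_[p])) (factorial_mul_choose a i)
  have h2 : ((i.factorial : ℕ) : ℚ_[p]) ≠ 0 := by
    exact_mod_cast Nat.factorial_ne_zero i
  have h3 : ((∏ j ∈ Finset.range i, (a - (j : ℤ_[p])) : ℤ_[p]) : ℚ_[p])
      = ∏ j ∈ Finset.range i, ((q : ℚ_[p]) - j) := by
    have := map_prod (PadicInt.Coe.ringHom (p := p)) (fun j : ℕ => a - (j : ℤ_[p])) (Finset.range i)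
    refine this.trans (Finset.prod_congr rfl fun j _ => ?_)
    change ((a - (j : ℤ_[p]) : ℤ_[p]) : ℚ_[p]) = _
    push_cast
    rw [h]
  push_cast at h1
  rw [h3] at h1
  push_cast
  rw [eq_div_iff h2, ← h1, mul_comm]

/-- Both sides are the coefficient of `x^t y^q` in `(1+y)^μ (1+x(1+y))^κ (1+x)^l`; on the right the
middle factor is expanded as `((1+x) + xy)^κ`. -/
theorem bin_sum_mul_bin_add (κ l μ : ℤ_[p]) (q t : ℕ) :
    (∑ ij ∈ antidiagonal t, bin κ ij.1 * bin l ij.2 * bin (μ + (ij.1 : ℤ_[p])) q : F)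
      = ∑ sr ∈ antidiagonal q, bin μ sr.1 * bin κ sr.2 *
          (if sr.2 ≤ t then bin (κ + l - (sr.2 : ℤ_[p])) (t - sr.2) else 0) := by
  simp only [bin_add μ, Finset.mul_sum]
  rw [Finset.sum_comm]
  refine Finset.sum_congr rfl fun sr _ => ?_
  have h1 : ∀ ij ∈ antidiagonal t,
      (bin κ ij.1 * bin l ij.2 * (bin μ sr.1 * bin (ij.1 : ℤ_[p]) sr.2) : F) =
      bin μ sr.1 * bin κ sr.2 * ((if sr.2 ≤ ij.1 then bin (κ - (sr.2 : ℤ_[p])) (ij.1 - sr.2)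
        else 0) * bin l ij.2) := by
    rintro ⟨i, j⟩ -
    dsimp only
    rw [bin_natCast]
    split_ifs with h
    · obtain ⟨c, rfl⟩ := Nat.exists_eq_add_of_le h
      rw [Nat.add_sub_cancel_left, mul_assoc (bin μ _), ← mul_assoc (bin κ sr.2), bin_mul_bin]
      ring
    · rw [Nat.choose_eq_zero_of_lt (not_le.1 h)]
      simp
  rw [Finset.sum_congr rfl h1, ← Finset.mul_sum]
  congr 1
  split_ifs with h
  · obtain ⟨c, rfl⟩ := Nat.exists_eq_add_of_le h
    rw [Nat.add_sub_cancel_left, show κ + l - (sr.2 : ℤ_[p]) = (κ - (sr.2 : ℤ_[p])) + l by ring,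
      bin_add]
    symm
    refine Finset.sum_of_injOn (fun ij => (sr.2 + ij.1, ij.2)) ?_ ?_ ?_ ?_
    · rintro ⟨a, b⟩ _ ⟨a', b'⟩ _ h
      simpa using h
    · rintro ⟨a, b⟩ h
      rw [Finset.mem_coe, mem_antidiagonal] at h ⊢
      dsimp only at h ⊢
      omega
    · rintro ⟨a, b⟩ hab hn
      rw [mem_antidiagonal] at hab
      dsimp only at hab ⊢
      rw [if_neg, zero_mul]
      intro hs
      refine hn ⟨(a - sr.2, b), ?_, by ext <;> dsimp only; omega⟩
      rw [Finset.mem_coe, mem_antidiagonal]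
      dsimp only
      omega
    · rintro ⟨a, b⟩ _
      simp
  · refine Finset.sum_eq_zero fun ij hij => ?_
    have := mem_antidiagonal.1 hij
    rw [if_neg (by omega), zero_mul]

/-- Both sides are the coefficient of `x^t y^q` in `(1+y)^μ (1+x+y)^κ (1+x)^l`, the middle factor
being expanded in powers of `x` on the left and of `y` on the right. -/
theorem bin_sum_mul_bin_sub (κ l μ : ℤ_[p]) (q t : ℕ) :
    (∑ ij ∈ antidiagonal t, bin κ ij.1 * bin l ij.2 * bin (μ + κ - (ij.1 : ℤ_[p])) q : F)
      = ∑ sr ∈ antidiagonal q, bin μ sr.1 * bin κ sr.2 * bin (κ + l - (sr.2 : ℤ_[p])) t := by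
  simp only [add_sub_assoc, bin_add μ, Finset.mul_sum]
  rw [Finset.sum_comm]
  refine Finset.sum_congr rfl fun sr _ => ?_
  rw [← add_sub_assoc, show κ + l - (sr.2 : ℤ_[p]) = (κ - (sr.2 : ℤ_[p])) + l by ring,
      bin_add, Finset.mul_sum]
  refine Finset.sum_congr rfl fun ij _ => ?_
  have := bin_mul_bin' (F := F) κ ij.1 sr.2
  linear_combination (bin l ij.2 * bin μ sr.1) * this

end Binomial

/-! ### Finite sums over the natural numbers -/

section Finsum

variable {W : Type*} [AddCommGroup W]

theorem finsum_eq_range {f : ℕ → W} (N : ℕ) (h : ∀ i ≥ N, f i = 0) :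
    ∑ᶠ i, f i = ∑ i ∈ Finset.range N, f i :=
  finsum_eq_sum_of_support_subset _ fun i hi => by
    simp only [Finset.coe_range, Set.mem_Iio]
    by_contra hc
    exact hi (h i (not_lt.1 hc))

theorem finsum_finsum_comm {f : ℕ → ℕ → W} (N : ℕ) (h : ∀ i j, N ≤ i + j → f i j = 0) :
    ∑ᶠ i, ∑ᶠ j, f i j = ∑ᶠ j, ∑ᶠ i, f i j := by
  have h1 : ∀ i, ∑ᶠ j, f i j = ∑ j ∈ Finset.range N, f i j := fun i =>
    finsum_eq_range N fun j hj => h i j (by omega)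
  have h2 : ∀ j, ∑ᶠ i, f i j = ∑ i ∈ Finset.range N, f i j := fun j =>
    finsum_eq_range N fun i hi => h i j (by omega)
  simp only [h1, h2]
  rw [finsum_eq_range N fun i hi => Finset.sum_eq_zero fun j _ => h i j (by omega),
    finsum_eq_range N fun j hj => Finset.sum_eq_zero fun i _ => h i j (by omega),
    Finset.sum_comm]

theorem finsum_finsum_antidiagonal {f : ℕ → ℕ → W} (N : ℕ) (h : ∀ i j, N ≤ i + j → f i j = 0) :
    ∑ᶠ i, ∑ᶠ j, f i j = ∑ᶠ t, ∑ ij ∈ antidiagonal t, f ij.1 ij.2 := by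
  have h1 : ∀ i, ∑ᶠ j, f i j = ∑ j ∈ Finset.range N, f i j := fun i =>
    finsum_eq_range N fun j hj => h i j (by omega)
  simp only [h1]
  rw [finsum_eq_range N fun i hi => Finset.sum_eq_zero fun j _ => h i j (by omega),
    finsum_eq_range N fun t ht => Finset.sum_eq_zero fun ij hij => h _ _ (by
      rw [mem_antidiagonal.1 hij]; exact ht), ← Finset.sum_product',
    ← Finset.sum_fiberwise_of_maps_to (g := fun ij => ij.1 + ij.2) (t := Finset.range (N + N))
      (by
        rintro ⟨i, j⟩ hij
        simp only [Finset.mem_product, Finset.mem_range] at hij ⊢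
        omega)]
  -- The square of side `N` is covered by the antidiagonals below `2N`. Those from `N` on contribute
  -- nothing, and those below `N` lie inside the square.
  symm
  refine Finset.sum_subset_zero_on_sdiff (by simp) ?_ ?_
  · intro t ht
    refine Finset.sum_eq_zero fun ij hij => h _ _ ?_
    simp only [Finset.mem_sdiff, Finset.mem_range, Finset.mem_filter] at ht hij
    omega
  · intro t ht
    rw [Finset.mem_range] at ht
    refine Finset.sum_congr ?_ fun _ _ => rfl
    ext ⟨i, j⟩
    simp only [mem_antidiagonal, Finset.mem_filter, Finset.mem_product, Finset.mem_range]
    omega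

theorem finsum_shift {f : ℕ → W} (s : ℕ) (h : ∀ i < s, f i = 0) :
    ∑ᶠ i, f i = ∑ᶠ i, f (s + i) := by
  rw [← finsum_mem_univ, ← finsum_mem_univ (f := fun i => f (s + i)),
    ← finsum_mem_image (f := f) (g := fun i => s + i) (fun _ _ _ _ h => by simpa using h)]
  refine finsum_mem_inter_support_eq _ _ _ ?_
  ext i
  simp only [Set.mem_inter_iff, Set.mem_univ, true_and, Set.image_univ, Set.mem_range,
    Function.mem_support]
  refine ⟨fun hi => ⟨⟨i - s, ?_⟩, hi⟩, fun hi => hi.2⟩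
  have : ¬ i < s := fun hc => hi (h i hc)
  omega

end Finsum

end SuperVA

namespace SuperVA

open Finset.HasAntidiagonal (antidiagonal mem_antidiagonal)

/-! ### The coefficients of the twisted Jacobi identity -/

/-- A primitive `T`-th root of unity `η` in `F`, together with the inverse `θ` of `T` in the
`p`-adic integers. -/
structure TwistDatum (p : ℕ) [Fact p.Prime] (F : Type*) [Field F] where
  T : ℕ
  η : Fˣ
  θ : ℤ_[p]
  T_mul_θ : (T : ℤ_[p]) * θ = 1
  primitive : IsPrimitiveRoot η T

namespace TwistDatum

variable {p : ℕ} [Fact p.Prime] {F : Type*} [Field F] (t : TwistDatum p F)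

theorem T_pos : 0 < t.T := by
  refine Nat.pos_of_ne_zero fun h => ?_
  have := t.T_mul_θ
  rw [h, Nat.cast_zero, zero_mul] at this
  exact zero_ne_one this

/-- The eigenvalue attached to the exponent `m/T`. -/
def cls (m : ℤ) : F := ((t.η ^ m : Fˣ) : F)

/-- The `p`-adic integer `m/T`. -/
noncomputable def frac (m : ℤ) : ℤ_[p] := m * t.θ

theorem cls_add (m n : ℤ) : t.cls (m + n) = t.cls m * t.cls n := by
  simp [cls, zpow_add]

@[simp] theorem cls_zero : t.cls 0 = 1 := by simp [cls]

@[simp] theorem cls_T_mul (k : ℤ) : t.cls (t.T * k) = 1 := by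
  simp [cls, zpow_mul, t.primitive.pow_eq_one]

@[simp] theorem cls_add_T_mul (m k : ℤ) : t.cls (m + t.T * k) = t.cls m := by
  rw [cls_add, cls_T_mul, mul_one]

@[simp] theorem cls_sub_T_mul (m k : ℤ) : t.cls (m - t.T * k) = t.cls m := by
  rw [sub_eq_add_neg, ← mul_neg, cls_add_T_mul]

/-- Primitivity of `η` makes `cls` a faithful record of exponents modulo `T`, so congruences can be
handled as equations in `F`. -/
theorem exists_of_cls_eq {m n : ℤ} (h : t.cls m = t.cls n) : ∃ k : ℤ, m = n + t.T * k := by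
  have h1 : t.η ^ (m - n) = 1 := by
    rw [zpow_sub, mul_inv_eq_one]
    exact Units.ext h
  obtain ⟨k, hk⟩ := (t.primitive.zpow_eq_one_iff_dvd _).1 h1
  exact ⟨k, by omega⟩

theorem frac_add (m n : ℤ) : t.frac (m + n) = t.frac m + t.frac n := by
  simp [frac, add_mul]

theorem frac_sub (m n : ℤ) : t.frac (m - n) = t.frac m - t.frac n := by
  simp [frac, sub_mul]

@[simp] theorem frac_T_mul (k : ℤ) : t.frac (t.T * k) = k := by
  have := t.T_mul_θ
  simp only [frac]
  push_cast
  linear_combination (k : ℤ_[p]) * this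

@[simp] theorem frac_T : t.frac t.T = 1 := by
  simpa using t.frac_T_mul 1

@[simp] theorem frac_zero : t.frac 0 = 0 := by simp [frac]

end TwistDatum

/-- A sequence of maps is truncated if it vanishes at every vector for large indices. -/
def IsField {W : Type*} [Zero W] (C : ℤ → W → W) : Prop :=
  ∀ w, ∃ N : ℤ, ∀ n ≥ N, C n w = 0

/-- Shifting a lattice function that satisfies Pascal's recursion: it vanishes as soon as it
vanishes for large `l` and on one line. -/
theorem eq_zero_of_recursion {W : Type*} [AddCommGroup W] (e : ℤ → ℤ → ℤ → W)
    (hrec : ∀ l a b, e (l + 1) a b = e l (a + 1) b - e l a (b + 1)) (N : ℤ)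
    (hN : ∀ l ≥ N, ∀ a b, e l a b = 0) (h0 : ∀ l b, e l 0 b = 0) (l a b : ℤ) : e l a b = 0 := by
  -- Descending induction on `l`, starting from `N`.
  have key : ∀ j : ℕ, ∀ l ≥ N - j, ∀ a b, e l a b = 0 := by
    intro j
    induction j with
    | zero => intro l hl; exact hN l (by simpa using hl)
    | succ j ih =>
      intro l hl a
      -- With level `l + 1` already zero, the recursion makes level `l` constant along the lines `a
      -- + b = const`, each of which meets the line `a = 0`.
      have h1 : ∀ a b, e l (a + 1) b = e l a (b + 1) := fun a b => by
        have := hrec l a b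
        rw [ih (l + 1) (by push_cast at hl; omega)] at this
        exact (sub_eq_zero.1 this.symm)
      induction a using Int.induction_on with
      | zero => exact h0 l
      | succ a iha => intro b; rw [h1, iha]
      | pred a iha =>
        intro b
        have := h1 (-(a : ℤ) - 1) (b - 1)
        rw [sub_add_cancel, sub_add_cancel] at this
        rw [← this, iha]
  exact key (N - l).toNat l (by omega) a b

section Bracket

variable {p : ℕ} [Fact p.Prime] {F : Type*} [Field F] [CharP F p]
  {W : Type*} [AddCommGroup W] [Module F W]

/-- The alternating binomial sum `∑ (-1)ⁱ (l choose i) f i`. -/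
noncomputable def altSum (p : ℕ) [Fact p.Prime] (F : Type*) [Field F] [CharP F p]
    {W : Type*} [AddCommGroup W] [Module F W] (l : ℤ) (f : ℕ → W) : W :=
  ∑ᶠ i : ℕ, ((-1) ^ i * bin (l : ℤ_[p]) i : F) • f i

theorem altSum_succ (l : ℤ) (f : ℕ → W) (N : ℕ) (h : ∀ i ≥ N, f i = 0) :
    altSum p F (l + 1) f = altSum p F l f - altSum p F l (fun i => f (i + 1)) := by
  simp only [altSum]
  rw [finsum_eq_range (N + 1) fun i hi => by rw [h i (by omega), smul_zero],
    finsum_eq_range (N + 1) fun i hi => by rw [h i (by omega), smul_zero],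
    finsum_eq_range N fun i hi => by rw [h _ (by omega), smul_zero],
    Finset.sum_range_succ', Finset.sum_range_succ', ← sub_eq_zero]
  simp only [pow_zero, bin_zero, mul_one, one_smul]
  have : ∀ i ∈ Finset.range N, ((-1) ^ (i + 1) * bin ((l + 1 : ℤ) : ℤ_[p]) (i + 1) : F) • f (i + 1)
      = ((-1) ^ (i + 1) * bin (l : ℤ_[p]) (i + 1) : F) • f (i + 1)
        - ((-1) ^ i * bin (l : ℤ_[p]) i : F) • f (i + 1) := by
    intro i _
    rw [Int.cast_add, Int.cast_one, bin_succ]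
    module
  rw [Finset.sum_congr rfl this, Finset.sum_sub_distrib]
  abel

theorem altSum_add (l : ℤ) (f g : ℕ → W) (N : ℕ) (hf : ∀ i ≥ N, f i = 0) (hg : ∀ i ≥ N, g i = 0) :
    altSum p F l (fun i => f i + g i) = altSum p F l f + altSum p F l g := by
  simp only [altSum]
  rw [finsum_eq_range N fun i hi => by rw [hf i hi, hg i hi, add_zero, smul_zero],
    finsum_eq_range N fun i hi => by rw [hf i hi, smul_zero],
    finsum_eq_range N fun i hi => by rw [hg i hi, smul_zero], ← Finset.sum_add_distrib]
  simp only [smul_add]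

theorem altSum_smul (l : ℤ) (f : ℕ → W) (c : F) :
    altSum p F l (fun i => c • f i) = c • altSum p F l f := by
  simp only [altSum]
  rw [smul_finsum]
  simp only [smul_comm c]

theorem altSum_eq_zero (l : ℤ) (f : ℕ → W) (h : ∀ i, f i = 0) : altSum p F l f = 0 := by
  simp [altSum, h]

namespace TwistDatum

variable (t : TwistDatum p F)

theorem exists_bound {C : ℤ → W → W} (hC : IsField C) (n : ℤ) (w : W) :
    ∃ N : ℕ, ∀ i ≥ N, C (n + t.T * (i : ℕ)) w = 0 := by
  obtain ⟨N, hN⟩ := hC w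
  refine ⟨(N - n).toNat, fun i hi => hN _ ?_⟩
  have h1 : (i : ℤ) ≤ t.T * i := by
    have := t.T_pos
    nlinarith
  omega

/-- The coefficient of `x₀^{-l-1} x₁^{-m/T-1} x₂^{-n/T-1}` in the left hand side of the twisted
Jacobi identity for `A` and `C`, with sign `ε`. -/
noncomputable def br (ε : F) (A : ℤ → Module.End F W) (C : ℤ → W → W) (l m n : ℤ) (w : W) : W :=
  altSum p F l (fun i => A (m + t.T * (l - i)) (C (n + t.T * i) w))
    - (ε * (-1) ^ l) • altSum p F l (fun i => C (n + t.T * (l - i)) (A (m + t.T * i) w))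

/-- The coefficient of the right hand side of the twisted Jacobi identity. -/
noncomputable def rhs {W : Type*} [AddCommGroup W] [Module F W] (D : ℤ → ℤ → W) (l m n : ℤ) : W :=
  ∑ᶠ i : ℕ, (bin (t.frac m) i : F) • D (l + i) (m + n - t.T * i)

variable {A B : ℤ → Module.End F W} {C : ℤ → W → W}

/-- This is `(x₁ - x₂)^(l+1) = (x₁ - x₂)^l (x₁ - x₂)`, valid in both directions of expansion;
multiplying by `x₁` or `x₂` moves an exponent by `T`. -/
theorem br_succ (ε : F) (hA : IsField fun n => A n) (hC : IsField C)
    (hC0 : ∀ n, C n 0 = 0) (l m n : ℤ) (w : W) :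
    t.br ε A C (l + 1) m n w = t.br ε A C l (m + t.T) n w - t.br ε A C l m (n + t.T) w := by
  obtain ⟨N, hN⟩ := t.exists_bound hC n w
  obtain ⟨M, hM⟩ := t.exists_bound hA m w
  simp only [br]
  rw [altSum_succ l _ N fun i hi => by rw [hN i hi, map_zero],
    altSum_succ l _ M fun i hi => by rw [hM i hi, hC0]]
  have e1 : ∀ i : ℕ, m + (t.T : ℤ) * (l + 1 - i) = m + t.T + t.T * (l - i) := fun i => by ring
  have e2 : ∀ i : ℕ, n + (t.T : ℤ) * (l + 1 - i) = n + t.T + t.T * (l - i) := fun i => by ring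
  have e3 : ∀ i : ℕ, n + (t.T : ℤ) * ((i + 1 : ℕ) : ℤ) = n + t.T + t.T * i := fun i => by
    push_cast; ring
  have e4 : ∀ i : ℕ, m + (t.T : ℤ) * ((i + 1 : ℕ) : ℤ) = m + t.T + t.T * i := fun i => by
    push_cast; ring
  have e5 : ∀ i : ℕ, m + (t.T : ℤ) * (l + 1 - (i + 1 : ℕ)) = m + t.T * (l - i) := fun i => by
    push_cast; ring
  have e6 : ∀ i : ℕ, n + (t.T : ℤ) * (l + 1 - (i + 1 : ℕ)) = n + t.T * (l - i) := fun i => by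
    push_cast; ring
  simp only [e5, e6, e3, e4]
  simp only [e1, e2]
  rw [zpow_add_one₀ (by norm_num)]
  module

theorem rhs_eq_range (D : ℤ → ℤ → W) (l m n : ℤ) (N : ℕ) (h : ∀ i ≥ N, D (l + (i : ℕ)) = 0) :
    t.rhs D l m n
      = ∑ i ∈ Finset.range N, (bin (t.frac m) i : F) • D (l + i) (m + n - t.T * i) :=
  finsum_eq_range N fun i hi => by rw [h i hi, Pi.zero_apply, smul_zero]

/-- Raising `m` by `T` raises `m/T` by one, so this is Pascal's rule. The recursion is the same as
in `br_succ`, which is why the Jacobi identity need only be checked on part of the lattice. -/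
theorem rhs_succ (D : ℤ → ℤ → W) (hD : ∃ N : ℤ, ∀ l ≥ N, D l = 0) (l m n : ℤ) :
    t.rhs D (l + 1) m n = t.rhs D l (m + t.T) n - t.rhs D l m (n + t.T) := by
  obtain ⟨N, hN⟩ := hD
  rw [t.rhs_eq_range D (l + 1) m n (N - l).toNat fun i hi => hN _ (by omega),
    t.rhs_eq_range D l _ _ ((N - l).toNat + 1) fun i hi => hN _ (by omega),
    t.rhs_eq_range D l _ _ ((N - l).toNat + 1) fun i hi => hN _ (by omega),
    Finset.sum_range_succ', Finset.sum_range_succ', ← sub_eq_zero]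
  have : ∀ i ∈ Finset.range (N - l).toNat,
      (bin (t.frac (m + t.T)) (i + 1) : F) • D (l + (i + 1 : ℕ)) (m + t.T + n - t.T * (i + 1 : ℕ))
      = (bin (t.frac m) i : F) • D (l + 1 + i) (m + n - t.T * i)
        + (bin (t.frac m) (i + 1) : F) •
          D (l + (i + 1 : ℕ)) (m + (n + t.T) - t.T * (i + 1 : ℕ)) := by
    intro i _
    rw [frac_add, frac_T, bin_succ, show l + ((i + 1 : ℕ) : ℤ) = l + 1 + i by push_cast; ring,
      show m + t.T + n - (t.T : ℤ) * ((i + 1 : ℕ) : ℤ) = m + n - t.T * i by push_cast; ring,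
      show m + (n + t.T) - (t.T : ℤ) * ((i + 1 : ℕ) : ℤ) = m + n - t.T * i by push_cast; ring]
    module
  rw [Finset.sum_congr rfl this, Finset.sum_add_distrib]
  simp only [bin_zero, Nat.cast_zero, mul_zero, add_zero, sub_zero, one_smul]
  rw [show m + t.T + n = m + (n + t.T) by ring]
  abel

/-- A family that is annihilated by the operator `∑ (m/T choose i) (shift)ⁱ` vanishes. -/
theorem eq_zero_of_rhs {D : ℤ → ℤ → W} (hD : ∃ N : ℤ, ∀ l ≥ N, D l = 0) (m l₀ : ℤ)
    (h : ∀ l ≥ l₀, ∀ n, t.rhs D l m n = 0) : ∀ l ≥ l₀, D l = 0 := by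
  obtain ⟨N, hN⟩ := hD
  -- The operator is unipotent with respect to `l`: descending from the bound `N`, only its term `i
  -- = 0` survives.
  have key : ∀ j : ℕ, ∀ l ≥ N - j, l₀ ≤ l → D l = 0 := by
    intro j
    induction j with
    | zero => intro l hl _; exact hN l (by simpa using hl)
    | succ j ih =>
      intro l hl hl₀
      funext n
      -- Evaluating at `n - m` makes the surviving term exactly `D l n`.
      have := h l hl₀ (n - m)
      rw [t.rhs_eq_range D l _ _ 1 fun i hi => ih _ (by push_cast at hl; omega) (by omega)] at this
      simpa using this
  exact fun l hl => key (N - l).toNat l (by omega) hl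

theorem br_smul (ε : F) (c : F) (l m n : ℤ) (w : W) :
    t.br ε A (fun n w => c • C n w) l m n w = c • t.br ε A C l m n w := by
  simp only [br, map_smul, altSum_smul]
  module

theorem br_add (ε : F) {C' : ℤ → W → W} (hA : IsField fun n => A n) (hC : IsField C)
    (hC' : IsField C') (h0 : ∀ n, C n 0 = 0) (h0' : ∀ n, C' n 0 = 0) (l m n : ℤ) (w : W) :
    t.br ε A (fun n w => C n w + C' n w) l m n w = t.br ε A C l m n w + t.br ε A C' l m n w := by
  obtain ⟨N, hN⟩ := t.exists_bound hC n w
  obtain ⟨N', hN'⟩ := t.exists_bound hC' n w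
  obtain ⟨M, hM⟩ := t.exists_bound hA m w
  simp only [br, map_add]
  rw [altSum_add l _ _ (max N N') (fun i hi => by rw [hN i (le_of_max_le_left hi), map_zero])
      (fun i hi => by rw [hN' i (le_of_max_le_right hi), map_zero]),
    altSum_add l _ _ M (fun i hi => by rw [hM i hi, h0]) (fun i hi => by rw [hM i hi, h0'])]
  module

theorem br_zero (ε : F) (l m n : ℤ) (w : W) : t.br ε A (0 : ℤ → W → W) l m n w = 0 := by
  simp [br, altSum_eq_zero]

theorem br_sum (ε : F) {ι : Type*} (s : Finset ι) (c : ι → F) (X : ι → ℤ → W → W)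
    (hA : IsField fun n => A n) (hX : ∀ i, IsField (X i)) (h0 : ∀ i n, X i n 0 = 0)
    (l m n : ℤ) (w : W) :
    t.br ε A (fun n w => ∑ i ∈ s, c i • X i n w) l m n w
      = ∑ i ∈ s, c i • t.br ε A (X i) l m n w := by
  classical
  have hf : ∀ s : Finset ι, IsField (fun n w => ∑ i ∈ s, c i • X i n w) := by
    intro s w
    choose N hN using fun i => hX i w
    obtain ⟨K, hK⟩ := (s.image N).finite_toSet.bddAbove
    refine ⟨K, fun n hn => Finset.sum_eq_zero fun i hi => ?_⟩
    rw [hN i n ((hK (Finset.mem_coe.2 (Finset.mem_image_of_mem _ hi))).trans hn), smul_zero]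
  induction s using Finset.induction_on with
  | empty =>
    simp only [Finset.sum_empty]
    exact t.br_zero ε l m n w
  | insert i s hi ih =>
    simp only [Finset.sum_insert hi]
    rw [t.br_add ε hA (C := fun n w => c i • X i n w) ?_ (hf s) ?_ ?_, t.br_smul, ih]
    · intro w
      obtain ⟨N, hN⟩ := hX i w
      exact ⟨N, fun n hn => by simp only [hN n hn, smul_zero]⟩
    · intro n; rw [h0, smul_zero]
    · intro n
      simp [h0]

theorem br_shift (ε : F) (s : ℤ) (l m n : ℤ) (w : W) :
    t.br ε A (fun n w => C (n + s) w) l m n w = t.br ε A C l m (n + s) w := by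
  simp only [br]
  congr 2
  · funext i
    rw [add_right_comm]
  · congr 1
    funext i
    rw [add_right_comm]

theorem br_isField (ε : F) (hA : IsField fun n => A n) (hC : IsField C) (h0 : ∀ n, C n 0 = 0)
    (l m : ℤ) : IsField (t.br ε A C l m) := by
  intro w
  obtain ⟨N, hN⟩ := hC w
  obtain ⟨M, hM⟩ := t.exists_bound hA m w
  -- In the second sum only the indices `i < M` matter, since `A` truncates at `w`; each of these
  -- finitely many terms has its own bound.
  choose K hK using fun i : ℕ => hC (A (m + t.T * i) w)
  obtain ⟨K', hK'⟩ := ((Finset.range M).image fun i : ℕ => K i - t.T * (l - i)).finite_toSet.bddAbove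
  refine ⟨max N K', fun n hn => ?_⟩
  rw [br, altSum_eq_zero, altSum_eq_zero, smul_zero, sub_zero]
  · intro i
    rcases le_or_gt M i with h | h
    · rw [hM i h, h0]
    · refine hK i _ ?_
      have h2 := le_of_max_le_right hn
      have := hK' (Finset.mem_coe.2 (Finset.mem_image_of_mem _ (Finset.mem_range.2 h)))
      linarith
  · intro i
    rw [hN, map_zero]
    have : (0 : ℤ) ≤ t.T * i := by positivity
    have := le_of_max_le_left hn
    linarith

/-- The bracket as a linear map. -/
noncomputable def brEnd (ε : F) {A C : ℤ → Module.End F W} (hA : IsField fun n => A n)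
    (hC : IsField fun n => C n) (l m n : ℤ) : Module.End F W where
  toFun := t.br ε A (fun n => C n) l m n
  map_add' v w := by
    obtain ⟨N, hN⟩ := t.exists_bound hC n v
    obtain ⟨N', hN'⟩ := t.exists_bound hC n w
    obtain ⟨M, hM⟩ := t.exists_bound hA m v
    obtain ⟨M', hM'⟩ := t.exists_bound hA m w
    simp only [br, map_add]
    rw [altSum_add l _ _ (max N N') (fun i hi => by rw [hN i (le_of_max_le_left hi), map_zero])
        (fun i hi => by rw [hN' i (le_of_max_le_right hi), map_zero]),
      altSum_add l _ _ (max M M') (fun i hi => by rw [hM i (le_of_max_le_left hi), map_zero])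
        (fun i hi => by rw [hM' i (le_of_max_le_right hi), map_zero])]
    module
  map_smul' c w := by
    simp only [br, map_smul, altSum_smul, RingHom.id_apply]
    module

end TwistDatum
end Bracket
end SuperVA

namespace SuperVA

/-! ### The twisted Jacobi identity: reductions and existence of products -/

open Finset.HasAntidiagonal (antidiagonal mem_antidiagonal)

section Jac

variable {p : ℕ} [Fact p.Prime] {F : Type*} [Field F] [CharP F p]
  {W : Type*} [AddCommGroup W] [Module F W]

namespace TwistDatum

variable (t : TwistDatum p F)

/-- The twisted Jacobi identity for a field `A` with exponents in the class `c` and a field `C`,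
the family `D` playing the role of the products `A_l C`. -/
structure Jac (c ε : F) (A C : ℤ → Module.End F W) (D : ℤ → ℤ → Module.End F W) : Prop where
  bound : ∃ N : ℤ, ∀ l ≥ N, D l = 0
  field : ∀ l, IsField fun n => D l n
  eq : ∀ l m n w, t.cls m = c →
    t.br ε A (fun n => C n) l m n w = t.rhs (fun l n => D l n w) l m n

variable {t} {c ε : F} {A C : ℤ → Module.End F W} {D : ℤ → ℤ → Module.End F W}

theorem Jac.bound_apply (h : t.Jac c ε A C D) (w : W) :
    ∃ N : ℤ, ∀ l ≥ N, (fun n => D l n w) = 0 := by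
  obtain ⟨N, hN⟩ := h.bound
  exact ⟨N, fun l hl => by funext n; rw [hN l hl]; rfl⟩

variable (t) in
theorem rhs_sub (D D' : ℤ → ℤ → W) (hD : ∃ N : ℤ, ∀ l ≥ N, D l = 0)
    (hD' : ∃ N : ℤ, ∀ l ≥ N, D' l = 0) (l m n : ℤ) :
    t.rhs (fun l n => D l n - D' l n) l m n = t.rhs D l m n - t.rhs D' l m n := by
  obtain ⟨N, hN⟩ := hD
  obtain ⟨N', hN'⟩ := hD'
  rw [t.rhs_eq_range D l m n (max N N' - l).toNat fun i hi => hN _ (by omega),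
    t.rhs_eq_range D' l m n (max N N' - l).toNat fun i hi => hN' _ (by omega),
    t.rhs_eq_range _ l m n (max N N' - l).toNat fun i hi => by
      funext n
      rw [hN _ (by omega), hN' _ (by omega)]
      simp, ← Finset.sum_sub_distrib]
  simp only [smul_sub]

variable (t) in
theorem rhs_add (D D' : ℤ → ℤ → W) (hD : ∃ N : ℤ, ∀ l ≥ N, D l = 0)
    (hD' : ∃ N : ℤ, ∀ l ≥ N, D' l = 0) (l m n : ℤ) :
    t.rhs (fun l n => D l n + D' l n) l m n = t.rhs D l m n + t.rhs D' l m n := by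
  have h0 := t.rhs_sub (fun _ _ => 0) D' ⟨0, fun _ _ => rfl⟩ hD' l m n
  have h1 := t.rhs_sub D (fun l n => 0 - D' l n) hD (by
    obtain ⟨N, hN⟩ := hD'
    exact ⟨N, fun l hl => by funext n; rw [hN l hl]; simp⟩) l m n
  simp only [zero_sub, sub_neg_eq_add] at h0 h1
  rw [h1, h0]
  simp [rhs]

variable (t) in
theorem rhs_smul (D : ℤ → ℤ → W) (a : F) (l m n : ℤ) :
    t.rhs (fun l n => a • D l n) l m n = a • t.rhs D l m n := by
  simp only [rhs]
  rw [smul_finsum]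
  simp only [smul_comm a]

/-- At one `m` in the class `c`, the difference of two families of products is annihilated by the
unipotent operator of `eq_zero_of_rhs`. The class must be inhabited, as otherwise the identity is
vacuous. -/
theorem Jac.unique {D' : ℤ → ℤ → Module.End F W} (hc : ∃ m, t.cls m = c)
    (h : t.Jac c ε A C D) (h' : t.Jac c ε A C D') : D = D' := by
  obtain ⟨m, hm⟩ := hc
  funext l n
  refine LinearMap.ext fun w => ?_
  obtain ⟨N, hN⟩ := h.bound_apply w
  obtain ⟨N', hN'⟩ := h'.bound_apply w
  have := t.eq_zero_of_rhs (D := fun l n => D l n w - D' l n w)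
    ⟨max N N', fun l hl => by
      have h1 := hN l (le_of_max_le_left hl)
      have h2 := hN' l (le_of_max_le_right hl)
      funext n
      exact sub_eq_zero.2 ((congrFun h1 n).trans (congrFun h2 n).symm)⟩ m l fun l _ n => by
      rw [t.rhs_sub _ _ (h.bound_apply w) (h'.bound_apply w), ← h.eq l m n w hm,
        ← h'.eq l m n w hm, sub_self]
  exact sub_eq_zero.1 (congrFun (this l le_rfl) n)

theorem Jac.zero_right (hD : t.Jac c ε A 0 D) (hc : ∃ m, t.cls m = c) : D = 0 := by
  refine hD.unique hc ⟨⟨0, fun _ _ => rfl⟩, fun _ _ => ⟨0, fun _ _ => rfl⟩, fun l m n w _ => ?_⟩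
  have := t.br_zero (A := A) ε l m n w
  exact this.trans (by simp [rhs])

theorem Jac.add_right {C' : ℤ → Module.End F W} {D' : ℤ → ℤ → Module.End F W}
    (hA : IsField fun n => A n) (hC : IsField fun n => C n) (hC' : IsField fun n => C' n)
    (h : t.Jac c ε A C D) (h' : t.Jac c ε A C' D') : t.Jac c ε A (C + C') (D + D') where
  bound := by
    obtain ⟨N, hN⟩ := h.bound
    obtain ⟨N', hN'⟩ := h'.bound
    exact ⟨max N N', fun l hl => by
      rw [Pi.add_apply, hN l (le_of_max_le_left hl), hN' l (le_of_max_le_right hl), add_zero]⟩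
  field l w := by
    obtain ⟨N, hN⟩ := h.field l w
    obtain ⟨N', hN'⟩ := h'.field l w
    exact ⟨max N N', fun n hn => by
      have h1 := hN n (le_of_max_le_left hn)
      have h2 := hN' n (le_of_max_le_right hn)
      simp only [Pi.add_apply, LinearMap.add_apply, h1, h2, add_zero]⟩
  eq l m n w hm := by
    have h1 := t.br_add ε hA hC hC' (fun n => map_zero _) (fun n => map_zero _) l m n w
    have h2 := t.rhs_add _ _ (h.bound_apply w) (h'.bound_apply w) l m n
    rw [← h.eq l m n w hm, ← h'.eq l m n w hm] at h2
    exact h1.trans h2.symm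

theorem Jac.smul_right (a : F) (h : t.Jac c ε A C D) : t.Jac c ε A (a • C) (a • D) where
  bound := by
    obtain ⟨N, hN⟩ := h.bound
    exact ⟨N, fun l hl => by rw [Pi.smul_apply, hN l hl, smul_zero]⟩
  field l w := by
    obtain ⟨N, hN⟩ := h.field l w
    exact ⟨N, fun n hn => by
      have h1 := hN n hn
      simp only [Pi.smul_apply, LinearMap.smul_apply, h1, smul_zero]⟩
  eq l m n w hm := by
    have h1 := t.br_smul (A := A) (C := fun n => C n) ε a l m n w
    have h2 := t.rhs_smul (fun l n => D l n w) a l m n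
    rw [← h.eq l m n w hm] at h2
    exact h1.trans h2.symm

theorem br_add_left (ε : F) {A A' : ℤ → Module.End F W} {C : ℤ → Module.End F W}
    (hA : IsField fun n => A n) (hA' : IsField fun n => A' n) (hC : IsField fun n => C n)
    (l m n : ℤ) (w : W) :
    t.br ε (A + A') (fun n => C n) l m n w
      = t.br ε A (fun n => C n) l m n w + t.br ε A' (fun n => C n) l m n w := by
  obtain ⟨N, hN⟩ := t.exists_bound hC n w
  obtain ⟨M, hM⟩ := t.exists_bound hA m w
  obtain ⟨M', hM'⟩ := t.exists_bound hA' m w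
  simp only [br, map_add, Pi.add_apply, LinearMap.add_apply]
  rw [altSum_add l _ _ N (fun i hi => by rw [hN i hi, map_zero])
      (fun i hi => by rw [hN i hi, map_zero]),
    altSum_add l _ _ (max M M') (fun i hi => by rw [hM i (le_of_max_le_left hi), map_zero])
      (fun i hi => by rw [hM' i (le_of_max_le_right hi), map_zero])]
  module

theorem br_smul_left (ε a : F) {A : ℤ → Module.End F W} {C : ℤ → Module.End F W}
    (l m n : ℤ) (w : W) :
    t.br ε (a • A) (fun n => C n) l m n w = a • t.br ε A (fun n => C n) l m n w := by
  simp only [br, map_smul, Pi.smul_apply, LinearMap.smul_apply, altSum_smul]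
  module

theorem Jac.add_left {A' : ℤ → Module.End F W} {D' : ℤ → ℤ → Module.End F W}
    (hA : IsField fun n => A n) (hA' : IsField fun n => A' n) (hC : IsField fun n => C n)
    (h : t.Jac c ε A C D) (h' : t.Jac c ε A' C D') : t.Jac c ε (A + A') C (D + D') where
  bound := by
    obtain ⟨N, hN⟩ := h.bound
    obtain ⟨N', hN'⟩ := h'.bound
    exact ⟨max N N', fun l hl => by
      rw [Pi.add_apply, hN l (le_of_max_le_left hl), hN' l (le_of_max_le_right hl), add_zero]⟩
  field l w := by
    obtain ⟨N, hN⟩ := h.field l w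
    obtain ⟨N', hN'⟩ := h'.field l w
    exact ⟨max N N', fun n hn => by
      have h1 := hN n (le_of_max_le_left hn)
      have h2 := hN' n (le_of_max_le_right hn)
      simp only [Pi.add_apply, LinearMap.add_apply, h1, h2, add_zero]⟩
  eq l m n w hm := by
    have h1 := br_add_left (t := t) ε hA hA' hC l m n w
    have h2 := t.rhs_add _ _ (h.bound_apply w) (h'.bound_apply w) l m n
    rw [← h.eq l m n w hm, ← h'.eq l m n w hm] at h2
    exact h1.trans h2.symm

theorem Jac.smul_left (a : F) (h : t.Jac c ε A C D) : t.Jac c ε (a • A) C (a • D) where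
  bound := (h.smul_right a).bound
  field := (h.smul_right a).field
  eq l m n w hm := by
    have h1 := br_smul_left (t := t) (A := A) (C := C) ε a l m n w
    have h2 := t.rhs_smul (fun l n => D l n w) a l m n
    rw [← h.eq l m n w hm] at h2
    exact h1.trans h2.symm

theorem Jac.zero_left : t.Jac c ε 0 C 0 where
  bound := ⟨0, fun _ _ => rfl⟩
  field _ _ := ⟨0, fun _ _ => rfl⟩
  eq l m n w hm := by simp [br, rhs, altSum_eq_zero]

theorem Jac.zero_right' : t.Jac c ε A 0 0 where
  bound := ⟨0, fun _ _ => rfl⟩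
  field _ _ := ⟨0, fun _ _ => rfl⟩
  eq l m n w hm := by simp [br, rhs, altSum_eq_zero]

theorem diff_succ (hA : IsField fun n => A n) (hC : IsField fun n => C n)
    (hD : ∃ N : ℤ, ∀ l ≥ N, D l = 0) (l m n : ℤ) (w : W) :
    t.br ε A (fun n => C n) (l + 1) m n w - t.rhs (fun l n => D l n w) (l + 1) m n
      = (t.br ε A (fun n => C n) l (m + t.T) n w - t.rhs (fun l n => D l n w) l (m + t.T) n)
        - (t.br ε A (fun n => C n) l m (n + t.T) w
          - t.rhs (fun l n => D l n w) l m (n + t.T)) := by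
  rw [t.br_succ ε hA hC fun n => map_zero _, t.rhs_succ _ (by
    obtain ⟨N, hN⟩ := hD
    exact ⟨N, fun l hl => by funext n; rw [hN l hl]; rfl⟩)]
  abel

/-- The twisted Jacobi identity follows from locality and the cases with `m = m₀`. -/
theorem Jac.of_fst (hA : IsField fun n => A n) (hC : IsField fun n => C n) (N : ℤ)
    (hD : ∀ l ≥ N, D l = 0) (hf : ∀ l, IsField fun n => D l n)
    (hbr : ∀ l ≥ N, ∀ m n w, t.cls m = c → t.br ε A (fun n => C n) l m n w = 0)
    (m₀ : ℤ) (hm₀ : t.cls m₀ = c)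
    (h0 : ∀ l n w, t.br ε A (fun n => C n) l m₀ n w = t.rhs (fun l n => D l n w) l m₀ n) :
    t.Jac c ε A C D where
  bound := ⟨N, hD⟩
  field := hf
  eq l m n w hm := by
    obtain ⟨k, rfl⟩ := t.exists_of_cls_eq (hm.trans hm₀.symm)
    refine sub_eq_zero.1 ?_
    have key := eq_zero_of_recursion (fun l a b => t.br ε A (fun n => C n) l (m₀ + t.T * a)
      (n + t.T * b) w - t.rhs (fun l n => D l n w) l (m₀ + t.T * a) (n + t.T * b)) ?_ N ?_ ?_ l k 0
    · simpa using key
    · intro l a b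
      have := diff_succ (t := t) (ε := ε) hA hC ⟨N, hD⟩ l (m₀ + t.T * a) (n + t.T * b) w
      rw [this, show m₀ + (t.T : ℤ) * (a + 1) = m₀ + t.T * a + t.T by ring,
        show n + (t.T : ℤ) * (b + 1) = n + t.T * b + t.T by ring]
    · intro l hl a b
      rw [hbr l hl _ _ _ (by simpa using hm₀), t.rhs_eq_range _ _ _ _ 0 fun i _ => by
        funext n; rw [hD _ (by omega)]; rfl]
      simp
    · intro l b
      simpa [sub_eq_zero] using h0 l (n + t.T * b) w

/-- The twisted Jacobi identity follows from locality and the cases with `n` in a set of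
representatives of the exponents modulo `T`. -/
theorem Jac.of_snd (hA : IsField fun n => A n) (hC : IsField fun n => C n) (N : ℤ)
    (hD : ∀ l ≥ N, D l = 0) (hf : ∀ l, IsField fun n => D l n)
    (hbr : ∀ l ≥ N, ∀ m n w, t.cls m = c → t.br ε A (fun n => C n) l m n w = 0)
    (h0 : ∀ n, ∃ k : ℤ, ∀ l m w, t.cls m = c → t.br ε A (fun n => C n) l m (n + t.T * k) w
      = t.rhs (fun l n => D l n w) l m (n + t.T * k)) :
    t.Jac c ε A C D where
  bound := ⟨N, hD⟩
  field := hf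
  eq l m n w hm := by
    obtain ⟨k, hk⟩ := h0 n
    refine sub_eq_zero.1 ?_
    -- Exchanging the roles of `m` and `n` reverses the sign in the recursion; the factor `(-1)^l`
    -- restores it.
    have key := eq_zero_of_recursion (fun l a b => ((-1) ^ l : F) •
      (t.br ε A (fun n => C n) l (m + t.T * b)
      (n + t.T * k + t.T * a) w - t.rhs (fun l n => D l n w) l (m + t.T * b)
        (n + t.T * k + t.T * a))) ?_ N ?_ ?_ l (-k) 0
    · rw [smul_eq_zero_iff_right (zpow_ne_zero _ (by norm_num))] at key
      simpa using key
    · intro l a b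
      have := diff_succ (t := t) (ε := ε) hA hC ⟨N, hD⟩ l (m + t.T * b) (n + t.T * k + t.T * a) w
      rw [this, show m + (t.T : ℤ) * (b + 1) = m + t.T * b + t.T by ring,
        show n + t.T * k + (t.T : ℤ) * (a + 1) = n + t.T * k + t.T * a + t.T by ring,
        zpow_add_one₀ (by norm_num)]
      module
    · intro l hl a b
      rw [hbr l hl _ _ _ (by simpa using hm), t.rhs_eq_range _ _ _ _ 0 fun i _ => by
        funext n; rw [hD _ (by omega)]; rfl]
      simp
    · intro l b
      have := hk l (m + t.T * b) w (by simpa using hm)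
      rw [← sub_eq_zero] at this
      simp [this]

/-- Mutually local fields satisfy the twisted Jacobi identity for suitable products. -/
theorem exists_jac (hA : IsField fun n => A n) (hC : IsField fun n => C n) (N : ℤ)
    (hbr : ∀ l ≥ N, ∀ m n w, t.cls m = c → t.br ε A (fun n => C n) l m n w = 0)
    (m₀ : ℤ) (hm₀ : t.cls m₀ = c) : ∃ D, t.Jac c ε A C D := by
  -- The slice `m = m₀` of the identity is solved for `D` by applying the inverse operator
  -- `(1+S)^(-m₀/T)` to the bracket. Locality cuts the series off at `i = N - l`.
  let D : ℤ → ℤ → Module.End F W := fun l n => ∑ i ∈ Finset.range (N - l).toNat,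
    (bin (-t.frac m₀) i : F) • t.brEnd ε hA hC (l + i) m₀ (n - m₀ - t.T * i)
  have hDf : ∀ l n w, D l n w = ∑ᶠ i : ℕ, (bin (-t.frac m₀) i : F) •
      t.br ε A (fun n => C n) (l + i) m₀ (n - m₀ - t.T * i) w := by
    intro l n w
    rw [finsum_eq_range (N - l).toNat fun i hi => by
      rw [hbr _ (by omega) _ _ _ hm₀, smul_zero]]
    simp only [D, LinearMap.sum_apply, LinearMap.smul_apply]
    rfl
  have hD : ∀ l ≥ N, D l = 0 := fun l hl => by
    funext n
    simp only [D]
    rw [show (N - l).toNat = 0 by omega, Finset.sum_range_zero]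
    rfl
  refine ⟨D, Jac.of_fst hA hC N hD ?_ hbr m₀ hm₀ ?_⟩
  · intro l w
    choose K hK using fun i : ℕ => t.br_isField ε hA hC (fun n => map_zero _) (l + i) m₀ w
    obtain ⟨K', hK'⟩ := ((Finset.range (N - l).toNat).image
      fun i : ℕ => K i + m₀ + t.T * i).finite_toSet.bddAbove
    refine ⟨K', fun n hn => ?_⟩
    simp only [D, LinearMap.sum_apply, LinearMap.smul_apply]
    refine Finset.sum_eq_zero fun i hi => ?_
    have h1 := hK' (Finset.mem_coe.2 (Finset.mem_image_of_mem _ hi))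
    have h2 : t.brEnd ε hA hC (l + i) m₀ (n - m₀ - t.T * i) w = 0 := hK i _ (by linarith)
    rw [h2, smul_zero]
  · intro l n w
    have h1 : ∀ (i : ℕ), (bin (t.frac m₀) i : F) • D (l + i) (m₀ + n - t.T * i) w
        = ∑ᶠ j : ℕ, ((bin (t.frac m₀) i : F) * bin (-t.frac m₀) j) •
          t.br ε A (fun n => C n) (l + (i + j : ℕ)) m₀ (n - t.T * (i + j : ℕ)) w := by
      intro i
      rw [hDf, smul_finsum]
      refine finsum_congr fun j => ?_
      rw [smul_smul]
      congr 2 <;> push_cast <;> ring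
    rw [rhs, finsum_congr h1, finsum_finsum_antidiagonal (N - l).toNat fun i j hij => by
      rw [hbr _ (by omega) _ _ _ hm₀, smul_zero]]
    -- Vandermonde's identity for `m₀/T` and `-m₀/T`: the two operators compose to the identity.
    have h2 : ∀ s : ℕ, ∑ ij ∈ antidiagonal s, ((bin (t.frac m₀) ij.1 : F) *
        bin (-t.frac m₀) ij.2) • t.br ε A (fun n => C n) (l + (ij.1 + ij.2 : ℕ)) m₀
          (n - t.T * (ij.1 + ij.2 : ℕ)) w
        = if s = 0 then t.br ε A (fun n => C n) l m₀ n w else 0 := by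
      intro s
      have h3 : ∀ ij ∈ antidiagonal s, ((bin (t.frac m₀) ij.1 : F) *
        bin (-t.frac m₀) ij.2) • t.br ε A (fun n => C n) (l + (ij.1 + ij.2 : ℕ)) m₀
          (n - t.T * (ij.1 + ij.2 : ℕ)) w = ((bin (t.frac m₀) ij.1 : F) *
        bin (-t.frac m₀) ij.2) • t.br ε A (fun n => C n) (l + (s : ℕ)) m₀
          (n - t.T * (s : ℕ)) w := fun ij hij => by rw [mem_antidiagonal.1 hij]
      rw [Finset.sum_congr rfl h3, ← Finset.sum_smul, bin_add_neg]
      split_ifs with hs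
      · subst hs; simp
      · simp
    rw [finsum_congr h2, finsum_eq_single _ 0 fun s hs => if_neg hs]
    simp

end TwistDatum
end Jac
end SuperVA

namespace SuperVA

/-! ### Iterated brackets -/

open Finset.HasAntidiagonal (antidiagonal mem_antidiagonal)

section Commutator

variable {p : ℕ} [Fact p.Prime] {F : Type*} [Field F] [CharP F p]
  {W : Type*} [AddCommGroup W] [Module F W]

theorem altSum_smul_sub (l : ℤ) (f g : ℕ → W) (a : F) (N : ℕ) (hf : ∀ i ≥ N, f i = 0)
    (hg : ∀ i ≥ N, g i = 0) :
    altSum p F l (fun i => f i - a • g i) = altSum p F l f - a • altSum p F l g := by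
  have := altSum_add (p := p) (F := F) l f (fun i => -a • g i) N hf
    (fun i hi => by rw [hg i hi, smul_zero])
  rw [altSum_smul] at this
  simp only [neg_smul, ← sub_eq_add_neg] at this
  exact this

theorem map_altSum {W' : Type*} [AddCommGroup W'] [Module F W'] (φ : W →ₗ[F] W') (l : ℤ)
    (f : ℕ → W) (N : ℕ) (hf : ∀ i ≥ N, f i = 0) :
    φ (altSum p F l f) = altSum p F l (fun i => φ (f i)) := by
  simp only [altSum]
  rw [finsum_eq_range N fun i hi => by rw [hf i hi, smul_zero],
    finsum_eq_range N fun i hi => by rw [hf i hi, map_zero, smul_zero], map_sum]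
  simp only [map_smul]

/-- The double alternating binomial sum. -/
noncomputable def altSum₂ (p : ℕ) [Fact p.Prime] (F : Type*) [Field F] [CharP F p]
    {W : Type*} [AddCommGroup W] [Module F W] (k l : ℤ) (f : ℕ → ℕ → W) : W :=
  ∑ᶠ s : ℕ, ∑ ij ∈ antidiagonal s,
    ((-1) ^ s * (bin (k : ℤ_[p]) ij.1 * bin (l : ℤ_[p]) ij.2) : F) • f ij.1 ij.2

theorem altSum_altSum (k l : ℤ) (f : ℕ → ℕ → W) (N : ℕ) (hf : ∀ i j, N ≤ i + j → f i j = 0) :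
    altSum p F k (fun i => altSum p F l (f i)) = altSum₂ p F k l f := by
  simp only [altSum, altSum₂, smul_finsum, smul_smul]
  rw [finsum_finsum_antidiagonal N fun i j hij => by rw [hf i j hij, smul_zero]]
  refine finsum_congr fun s => Finset.sum_congr rfl fun ij hij => ?_
  rw [← mem_antidiagonal.1 hij, pow_add]
  congr 1
  ring

theorem altSum_altSum_swap (k l : ℤ) (f : ℕ → ℕ → W) (N : ℕ)
    (hf : ∀ i j, N ≤ i + j → f i j = 0) :
    altSum p F l (fun j => altSum p F k (fun i => f i j)) = altSum₂ p F k l f := by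
  rw [← altSum_altSum k l f N hf]
  simp only [altSum, smul_finsum, smul_smul]
  rw [finsum_finsum_comm N fun i j hij => by rw [hf j i (by omega), smul_zero]]
  simp only [mul_comm]

theorem altSum₂_smul_sub (k l : ℤ) (f g : ℕ → ℕ → W) (a : F) (N : ℕ)
    (hf : ∀ i j, N ≤ i + j → f i j = 0) (hg : ∀ i j, N ≤ i + j → g i j = 0) :
    altSum₂ p F k l f - a • altSum₂ p F k l g
      = altSum₂ p F k l (fun i j => f i j - a • g i j) := by
  simp only [altSum₂]
  rw [finsum_eq_range N fun s hs => Finset.sum_eq_zero fun ij hij => by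
      rw [hf _ _ (hs.trans_eq (mem_antidiagonal.1 hij).symm), smul_zero],
    finsum_eq_range N fun s hs => Finset.sum_eq_zero fun ij hij => by
      rw [hg _ _ (hs.trans_eq (mem_antidiagonal.1 hij).symm), smul_zero],
    finsum_eq_range N fun s hs => Finset.sum_eq_zero fun ij hij => by
      rw [hf _ _ (hs.trans_eq (mem_antidiagonal.1 hij).symm),
        hg _ _ (hs.trans_eq (mem_antidiagonal.1 hij).symm), smul_zero, sub_zero, smul_zero],
    Finset.smul_sum, ← Finset.sum_sub_distrib]
  refine Finset.sum_congr rfl fun s _ => ?_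
  rw [Finset.smul_sum, ← Finset.sum_sub_distrib]
  refine Finset.sum_congr rfl fun ij _ => ?_
  module

/-- Apart from one binomial factor the summand depends only on `i + j`, so `bin_sum_mul_bin_sub`
collapses the double sum into single ones with exponent `l + k - r`. -/
theorem altSum₂_of_sub (k l : ℤ) (μ : ℤ_[p]) (Q : ℕ) (X : ℕ → ℕ → W) (N : ℕ)
    (hX : ∀ q, ∀ s ≥ N, X q s = 0) :
    altSum₂ p F k l (fun i j => ∑ q ∈ Finset.range Q,
        (bin (μ + (k : ℤ_[p]) - (i : ℤ_[p])) q : F) • X q (i + j))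
      = ∑ q ∈ Finset.range Q, ∑ sr ∈ antidiagonal q, (bin μ sr.1 * bin (k : ℤ_[p]) sr.2 : F) •
          altSum p F (l + k - sr.2) (X q) := by
  simp only [altSum₂, altSum]
  rw [finsum_eq_range N fun s hs => Finset.sum_eq_zero fun ij hij => by
    rw [Finset.sum_eq_zero fun q _ => by rw [hX q _ (hs.trans_eq (mem_antidiagonal.1 hij).symm),
      smul_zero], smul_zero]]
  have h1 : ∀ (q : ℕ) (sr : ℕ × ℕ),
      (∑ᶠ i : ℕ, ((-1) ^ i * bin ((l + k - sr.2 : ℤ) : ℤ_[p]) i : F) • X q i)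
      = ∑ i ∈ Finset.range N, ((-1) ^ i * bin ((l + k - sr.2 : ℤ) : ℤ_[p]) i : F) • X q i :=
    fun q sr => finsum_eq_range N fun i hi => by rw [hX q i hi, smul_zero]
  simp only [h1, Finset.smul_sum]
  simp only [smul_smul]
  rw [Finset.sum_congr rfl fun s _ => Finset.sum_comm, Finset.sum_comm]
  refine Finset.sum_congr rfl fun q _ => ?_
  rw [Finset.sum_comm (s := antidiagonal q)]
  refine Finset.sum_congr rfl fun s _ => ?_
  have h2 := bin_sum_mul_bin_sub (F := F) (k : ℤ_[p]) (l : ℤ_[p]) μ q s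
  have h3 : ∀ ij ∈ antidiagonal s, ((-1) ^ s * (bin (k : ℤ_[p]) ij.1 * bin (l : ℤ_[p]) ij.2) *
      bin (μ + (k : ℤ_[p]) - (ij.1 : ℤ_[p])) q : F) • X q (ij.1 + ij.2)
      = ((bin (k : ℤ_[p]) ij.1 * bin (l : ℤ_[p]) ij.2 * bin (μ + (k : ℤ_[p]) - (ij.1 : ℤ_[p])) q : F)) •
        ((-1) ^ s : F) • X q s := fun ij hij => by
    rw [mem_antidiagonal.1 hij, smul_smul]
    congr 1
    ring
  rw [Finset.sum_congr rfl h3, ← Finset.sum_smul, h2, Finset.sum_smul]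
  refine Finset.sum_congr rfl fun sr _ => ?_
  rw [smul_smul]
  push_cast
  rw [add_comm (k : ℤ_[p])]
  congr 1
  ring

/-- The summed form of `bin_sum_mul_bin_add`. It is stated without signs and for `p`-adic
parameters, so that it serves both integral exponents (`br_br`) and fractional ones (`Jac.commute`).
-/
theorem finsum_antidiagonal_bin_add (κ ν μ : ℤ_[p]) (Q : ℕ) (X : ℕ → ℕ → W) (N : ℕ)
    (hX : ∀ q < Q, ∀ s ≥ N, X q s = 0) :
    ∑ᶠ s : ℕ, ∑ ij ∈ antidiagonal s, (bin κ ij.1 * bin ν ij.2 : F) •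
        ∑ q ∈ Finset.range Q, (bin (μ + (ij.1 : ℤ_[p])) q : F) • X q s
      = ∑ q ∈ Finset.range Q, ∑ sr ∈ antidiagonal q, (bin μ sr.1 * bin κ sr.2 : F) •
          ∑ᶠ u : ℕ, (bin (κ + ν - (sr.2 : ℤ_[p])) u : F) • X q (sr.2 + u) := by
  rw [finsum_eq_range N fun s hs => Finset.sum_eq_zero fun ij hij => by
    rw [Finset.sum_eq_zero fun q hq => by rw [hX q (Finset.mem_range.1 hq) _ hs, smul_zero],
      smul_zero]]
  have h1 : ∀ q ∈ Finset.range Q, ∀ sr : ℕ × ℕ,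
      (∑ᶠ u : ℕ, (bin (κ + ν - (sr.2 : ℤ_[p])) u : F) • X q (sr.2 + u))
      = ∑ s ∈ Finset.range N, ((if sr.2 ≤ s then
        bin (κ + ν - (sr.2 : ℤ_[p])) (s - sr.2) else 0) : F) • X q s := by
    intro q hq sr
    rw [← finsum_eq_range N fun i hi => by rw [hX q (Finset.mem_range.1 hq) i hi, smul_zero]]
    symm
    rw [finsum_shift sr.2 fun i hi => by rw [if_neg (by omega), zero_smul]]
    refine finsum_congr fun i => ?_
    rw [if_pos (Nat.le_add_right _ _), Nat.add_sub_cancel_left]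
  rw [Finset.sum_congr (s₁ := Finset.range Q) rfl fun q hq => Finset.sum_congr rfl fun sr _ => by
    rw [h1 q hq sr]]
  simp only [Finset.smul_sum]
  simp only [smul_smul]
  rw [Finset.sum_congr rfl fun s _ => Finset.sum_comm, Finset.sum_comm]
  refine Finset.sum_congr rfl fun q _ => ?_
  rw [Finset.sum_comm (s := antidiagonal q)]
  refine Finset.sum_congr rfl fun s _ => ?_
  rw [← Finset.sum_smul, bin_sum_mul_bin_add, Finset.sum_smul]

theorem altSum₂_of_add (k l : ℤ) (μ : ℤ_[p]) (Q : ℕ) (X : ℕ → ℕ → W) (N : ℕ)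
    (hX : ∀ q < Q, ∀ s ≥ N, X q s = 0) :
    altSum₂ p F k l (fun i j => ∑ q ∈ Finset.range Q,
        (bin (μ + (i : ℤ_[p])) q : F) • X q (i + j))
      = ∑ q ∈ Finset.range Q, ∑ sr ∈ antidiagonal q, (bin μ sr.1 * bin (k : ℤ_[p]) sr.2 : F) •
          ((-1) ^ sr.2 : F) • altSum p F (l + k - sr.2) (fun u => X q (sr.2 + u)) := by
  -- The alternating sign depends only on `s = i + j` and is absorbed into the vectors.
  have h := finsum_antidiagonal_bin_add (F := F) (W := W) (k : ℤ_[p]) (l : ℤ_[p]) μ Q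
    (fun q s => ((-1) ^ s : F) • X q s) N (fun q hq s hs => by rw [hX q hq s hs, smul_zero])
  rw [altSum₂]
  refine Eq.trans ?_ (h.trans ?_)
  · refine finsum_congr fun s => ?_
    refine Finset.sum_congr rfl fun ij hij => ?_
    rw [mem_antidiagonal.1 hij, Finset.smul_sum, Finset.smul_sum]
    refine Finset.sum_congr rfl fun q _ => ?_
    module
  · refine Finset.sum_congr rfl fun q _ => Finset.sum_congr rfl fun sr _ => ?_
    simp only [altSum, smul_finsum]
    refine finsum_congr fun u => ?_
    rw [pow_add]
    push_cast
    rw [add_comm (k : ℤ_[p])]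
    module

namespace TwistDatum

variable (t : TwistDatum p F)

/-- Large `i` are killed by the inner field, and each of the finitely many remaining `i` leaves a
truncation bound for the outer one. -/
theorem exists_bound₂ {X : ℤ → W → W} {Y : ℕ → ℤ → W → W} (hX : IsField X)
    (hY : ∀ i, IsField (Y i)) (hY0 : ∀ i n, Y i n 0 = 0) (m : ℤ) (n : ℕ → ℤ) (w : W) :
    ∃ N : ℕ, ∀ i j : ℕ, N ≤ i + j → Y i (n i + t.T * j) (X (m + t.T * i) w) = 0 := by
  obtain ⟨M, hM⟩ := t.exists_bound hX m w
  choose K hK using fun i : ℕ => t.exists_bound (hY i) (n i) (X (m + t.T * i) w)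
  obtain ⟨K', hK'⟩ := ((Finset.range M).image K).finite_toSet.bddAbove
  refine ⟨M + K', fun i j hij => ?_⟩
  rcases le_or_gt M i with h | h
  · rw [hM i h, hY0]
  · have := hK' (Finset.mem_coe.2 (Finset.mem_image_of_mem _ (Finset.mem_range.2 h)))
    exact hK i j (by omega)

/-- The commutator of the operators `C ↦ [A, C]_{k,m}` and `C ↦ [B, C]_{l,n}`, given the commutator
of the modes of `A` and `B`. -/
theorem br_br {cA cB eAB eAC eBC : F} (hsq : eAB * eAB = 1) {A B C : ℤ → Module.End F W}
    (hA : IsField fun n => A n) (hB : IsField fun n => B n) (hC : IsField fun n => C n)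
    (Q : ℕ) {G : ℕ → ℤ → Module.End F W} (hG : ∀ q < Q, IsField fun n => G q n)
    (hAB : ∀ M N w, t.cls M = cA → t.cls N = cB → A M (B N w) - eAB • B N (A M w)
      = ∑ q ∈ Finset.range Q, (bin (t.frac M) q : F) • G q (M + N - t.T * q) w)
    (k l m n r : ℤ) (w : W) (hm : t.cls m = cA) (hn : t.cls n = cB) :
    t.br (eAB * eAC) A (t.br eBC B (fun n => C n) l n) k m r w
      - eAB • t.br (eAB * eBC) B (t.br eAC A (fun n => C n) k m) l n r w
      = ∑ q ∈ Finset.range Q, ∑ sr ∈ antidiagonal q,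
        (bin (t.frac m) sr.1 * bin (k : ℤ_[p]) sr.2 : F) •
          t.br (eAC * eBC) (G q) (fun n => C n) (l + k - sr.2) (m + n - t.T * sr.1) r w := by
  obtain ⟨N₁, hN₁⟩ := t.exists_bound hC r w
  obtain ⟨N₂, hN₂⟩ := t.exists_bound₂ hB (Y := fun _ n => C n) (fun _ => hC)
    (fun _ _ => map_zero _) n (fun j => r + t.T * (l - j)) w
  obtain ⟨N₃, hN₃⟩ := t.exists_bound₂ hA (Y := fun _ n => C n) (fun _ => hC)
    (fun _ _ => map_zero _) m (fun i => r + t.T * (k - i)) w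
  obtain ⟨N₄, hN₄⟩ := t.exists_bound₂ hA (Y := fun _ n => B n) (fun _ => hB)
    (fun _ _ => map_zero _) m (fun _ => n) w
  obtain ⟨N₅, hN₅⟩ := t.exists_bound₂ hB (Y := fun _ n => A n) (fun _ => hA)
    (fun _ _ => map_zero _) n (fun _ => m) w
  -- The six orders of `A`, `B`, `C`. The terms with `C` in the middle (`f2`, `f3`) occur in both
  -- iterated brackets and cancel, because `eAB * eAB = 1`. The terms with `C` first or last pair up
  -- into commutators of `A` and `B`.
  let f1 : ℕ → ℕ → W := fun i j => A (m + t.T * (k - i)) (B (n + t.T * (l - j))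
    (C (r + t.T * i + t.T * j) w))
  let f1' : ℕ → ℕ → W := fun i j => B (n + t.T * (l - j)) (A (m + t.T * (k - i))
    (C (r + t.T * i + t.T * j) w))
  let f2 : ℕ → ℕ → W := fun i j => A (m + t.T * (k - i)) (C (r + t.T * (l - j) + t.T * i)
    (B (n + t.T * j) w))
  let f3 : ℕ → ℕ → W := fun i j => B (n + t.T * (l - j)) (C (r + t.T * (k - i) + t.T * j)
    (A (m + t.T * i) w))
  let f4 : ℕ → ℕ → W := fun i j => C (r + t.T * (k - i) + t.T * (l - j))
    (B (n + t.T * j) (A (m + t.T * i) w))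
  let f4' : ℕ → ℕ → W := fun i j => C (r + t.T * (k - i) + t.T * (l - j))
    (A (m + t.T * i) (B (n + t.T * j) w))
  have e1 : ∀ i j : ℕ, r + (t.T : ℤ) * i + t.T * j = r + t.T * (i + j : ℕ) := fun i j => by
    push_cast; ring
  have z1 : ∀ i j, N₁ ≤ i + j → f1 i j = 0 := fun i j hij => by
    simp only [f1, e1]; rw [hN₁ _ hij, map_zero, map_zero]
  have z1' : ∀ i j, N₁ ≤ i + j → f1' i j = 0 := fun i j hij => by
    simp only [f1', e1]; rw [hN₁ _ hij, map_zero, map_zero]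
  have z2 : ∀ i j, N₂ ≤ i + j → f2 i j = 0 := fun i j hij => by
    simp only [f2]; rw [hN₂ j i (by omega), map_zero]
  have z3 : ∀ i j, N₃ ≤ i + j → f3 i j = 0 := fun i j hij => by
    simp only [f3]; rw [hN₃ i j hij, map_zero]
  have z4 : ∀ i j, N₄ ≤ i + j → f4 i j = 0 := fun i j hij => by
    simp only [f4]; rw [hN₄ i j hij, map_zero]
  have z4' : ∀ i j, N₅ ≤ i + j → f4' i j = 0 := fun i j hij => by
    simp only [f4']; rw [hN₅ j i (by omega), map_zero]
  have hL : t.br (eAB * eAC) A (t.br eBC B (fun n => C n) l n) k m r w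
      = (altSum₂ p F k l f1 - (eBC * (-1) ^ l) • altSum₂ p F k l f2)
        - (eAB * eAC * (-1) ^ k) •
          (altSum₂ p F k l f3 - (eBC * (-1) ^ l) • altSum₂ p F k l f4) := by
    rw [← altSum_altSum k l f1 N₁ z1, ← altSum_altSum k l f2 N₂ z2, ← altSum_altSum k l f3 N₃ z3,
      ← altSum_altSum k l f4 N₄ z4, ← altSum_smul_sub k _ _ _ (max N₁ N₂) ?_ ?_,
      ← altSum_smul_sub k _ _ _ (max N₃ N₄) ?_ ?_, br]
    · congr 2
      funext i
      simp only [br]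
      rw [map_sub, map_smul, map_altSum _ l _ N₁ fun j hj => ?_, map_altSum _ l _ N₂ fun j hj => ?_]
      · congr 3
        funext j
        simp only [f2]
        rw [add_right_comm]
      · rw [add_right_comm, hN₂ j i (by omega)]
      · rw [e1, hN₁ _ (by omega), map_zero]
    · exact fun i hi => altSum_eq_zero _ _ fun j => z3 i j (by omega)
    · exact fun i hi => altSum_eq_zero _ _ fun j => z4 i j (by omega)
    · exact fun i hi => altSum_eq_zero _ _ fun j => z1 i j (by omega)
    · exact fun i hi => altSum_eq_zero _ _ fun j => z2 i j (by omega)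
  have hR : t.br (eAB * eBC) B (t.br eAC A (fun n => C n) k m) l n r w
      = (altSum₂ p F k l f1' - (eAC * (-1) ^ k) • altSum₂ p F k l f3)
        - (eAB * eBC * (-1) ^ l) •
          (altSum₂ p F k l f2 - (eAC * (-1) ^ k) • altSum₂ p F k l f4') := by
    rw [← altSum_altSum_swap k l f1' N₁ z1', ← altSum_altSum_swap k l f2 N₂ z2,
      ← altSum_altSum_swap k l f3 N₃ z3,
      ← altSum_altSum_swap k l f4' N₅ z4', ← altSum_smul_sub l _ _ _ (max N₁ N₃) ?_ ?_,
      ← altSum_smul_sub l _ _ _ (max N₂ N₅) ?_ ?_, br]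
    · congr 2
      · funext j
        simp only [br]
        rw [map_sub, map_smul, map_altSum _ k _ N₁ fun i hi => ?_,
          map_altSum _ k _ N₃ fun i hi => ?_]
        · congr 2
          · simp only [f1', add_right_comm]
          · simp only [f3, add_right_comm]
        · rw [add_right_comm, hN₃ i j (by omega)]
        · rw [e1, hN₁ _ (by omega), map_zero]
      · congr 1
        funext j
        simp only [br]
        congr 2
        simp only [f4', add_right_comm]
    · exact fun i hi => altSum_eq_zero _ _ fun j => z2 j i (by omega)
    · exact fun i hi => altSum_eq_zero _ _ fun j => z4' j i (by omega)
    · exact fun i hi => altSum_eq_zero _ _ fun j => z1' j i (by omega)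
    · exact fun i hi => altSum_eq_zero _ _ fun j => z3 j i (by omega)
  have hcomb : t.br (eAB * eAC) A (t.br eBC B (fun n => C n) l n) k m r w
      - eAB • t.br (eAB * eBC) B (t.br eAC A (fun n => C n) k m) l n r w
      = (altSum₂ p F k l f1 - eAB • altSum₂ p F k l f1') - (eAC * eBC * (-1) ^ (l + k)) •
        (altSum₂ p F k l f4' - eAB • altSum₂ p F k l f4) := by
    rw [hL, hR, zpow_add₀ (by norm_num)]
    have hs : ∀ x : W, (eAB * eAB) • x = x := fun x => by rw [hsq, one_smul]
    linear_combination (norm := module) (eBC * (-1 : F) ^ l) • hs (altSum₂ p F k l f2)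
      - (eBC * (-1 : F) ^ l * eAC * (-1 : F) ^ k) • hs (altSum₂ p F k l f4')
  rw [hcomb, altSum₂_smul_sub k l f1 f1' eAB N₁ z1 z1',
    altSum₂_smul_sub k l f4' f4 eAB (max N₄ N₅) (fun i j h => z4' i j (by omega))
      (fun i j h => z4 i j (by omega))]
  -- After the commutator of the modes of `A` and `B` is inserted, the indices `i` and `j` enter
  -- only through their sum, except in one binomial coefficient: with top `m/T + k - i` in the first
  -- case and `m/T + i` in the second. These are the shapes treated by `altSum₂_of_sub` and
  -- `altSum₂_of_add`.
  let X1 : ℕ → ℕ → W := fun q s => G q (m + n + t.T * (k + l - (s : ℕ))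
        - t.T * (q : ℕ)) (C (r + t.T * (s : ℕ)) w)
  let X2 : ℕ → ℕ → W := fun q s => C (r + t.T * (k + l - (s : ℕ)))
        (G q (m + n - t.T * (q : ℕ) + t.T * (s : ℕ)) w)
  have h1 : (fun i j => f1 i j - eAB • f1' i j) = fun i j : ℕ => ∑ q ∈ Finset.range Q,
      (bin (t.frac m + (k : ℤ_[p]) - (i : ℤ_[p])) q : F) • X1 q (i + j) := by
    funext i j
    simp only [f1, f1', e1, X1]
    rw [hAB _ _ _ (by simpa using hm) (by simpa using hn), frac_add]
    refine Finset.sum_congr rfl fun q _ => ?_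
    rw [frac_T_mul]
    congr 2
    · push_cast
      rw [add_sub_assoc]
    · congr 1
      push_cast
      ring
  have h4 : (fun i j => f4' i j - eAB • f4 i j) = fun i j : ℕ => ∑ q ∈ Finset.range Q,
      (bin (t.frac m + (i : ℤ_[p])) q : F) • X2 q (i + j) := by
    funext i j
    simp only [f4, f4', X2]
    rw [← map_smul, ← map_sub, hAB _ _ _ (by simpa using hm) (by simpa using hn), frac_add, map_sum]
    refine Finset.sum_congr rfl fun q _ => ?_
    rw [map_smul, show t.frac (t.T * (i : ℤ)) = (i : ℤ_[p]) by simp]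
    congr 2
    · congr 1
      push_cast
      ring
    · congr 1
      push_cast
      ring_nf
  obtain ⟨N₆, hN₆⟩ : ∃ N : ℕ, ∀ q < Q, ∀ s ≥ N, X2 q s = 0 := by
    choose! K hK using fun q (hq : q < Q) => t.exists_bound (hG q hq) (m + n - t.T * (q : ℕ)) w
    obtain ⟨K', hK'⟩ := ((Finset.range Q).image K).finite_toSet.bddAbove
    refine ⟨K', fun q hq s hs => ?_⟩
    have := hK' (Finset.mem_coe.2 (Finset.mem_image_of_mem _ (Finset.mem_range.2 hq)))
    simp only [X2]
    rw [hK q hq s (this.trans hs), map_zero]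
  rw [h1, h4, altSum₂_of_sub k l (t.frac m) Q X1 N₁ (fun q s hs => by
    simp only [X1]; rw [hN₁ s hs, map_zero]), altSum₂_of_add k l (t.frac m) Q X2 N₆ hN₆,
    Finset.smul_sum, ← Finset.sum_sub_distrib]
  refine Finset.sum_congr rfl fun q _ => ?_
  rw [Finset.smul_sum, ← Finset.sum_sub_distrib]
  refine Finset.sum_congr rfl fun sr hsr => ?_
  have hq : (q : ℤ) = sr.1 + sr.2 := by rw [← mem_antidiagonal.1 hsr]; push_cast; rfl
  rw [br, smul_sub]
  congr 1
  · congr 2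
    funext s
    simp only [X1]
    rw [hq]
    congr 2
    ring
  -- The sign `(-1)^r` left by the shift in `altSum₂_of_add` turns `(-1)^(l+k)` into the sign
  -- belonging to the bracket of index `l + k - r`.
  · have h5 : ((-1 : F)) ^ (l + k - (sr.2 : ℤ)) = (-1) ^ (l + k) * (-1) ^ sr.2 := by
      rw [zpow_sub₀ (by norm_num), zpow_natCast, div_eq_mul_inv, ← inv_pow, inv_neg_one]
    rw [h5]
    have h6 : (fun u : ℕ => X2 q (sr.2 + u))
        = fun u : ℕ => C (r + t.T * (l + k - sr.2 - u)) (G q (m + n - t.T * sr.1 + t.T * u) w) := by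
      funext u
      simp only [X2]
      rw [hq]
      congr 2
      · push_cast; ring
      · congr 1; push_cast; ring
    rw [h6, smul_smul, smul_smul, smul_smul]
    congr 1
    ring

end TwistDatum
end Commutator
end SuperVA

namespace SuperVA

/-! ### Products of mutually local fields -/

open Finset.HasAntidiagonal (antidiagonal mem_antidiagonal)

section Products

variable {p : ℕ} [Fact p.Prime] {F : Type*} [Field F] [CharP F p]
  {W : Type*} [AddCommGroup W] [Module F W]

namespace TwistDatum

variable {t : TwistDatum p F} {cA cB eAB eAC eBC : F} {A B C : ℤ → Module.End F W}
  {D : ℤ → ℤ → Module.End F W}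

/-- The Jacobi identity writes the inner bracket as a finite combination of shifted products;
bracketing with `B` is linear in the second entry and commutes with shifts. -/
theorem Jac.br_br (hAC : t.Jac cA eAC A C D) (hB : IsField fun n => B n) (ε : F)
    (k l m n r : ℤ) (w : W) (hm : t.cls m = cA) :
    t.br ε B (t.br eAC A (fun n => C n) k m) l n r w
      = t.rhs (fun k r => t.br ε B (fun n => D k n) l n r w) k m r := by
  obtain ⟨N, hN⟩ := hAC.bound
  have h1 : t.br eAC A (fun n => C n) k m = fun r w => ∑ i ∈ Finset.range (N - k).toNat,
      (bin (t.frac m) i : F) • (fun r w => D (k + i) (r + (m - t.T * i)) w) r w := by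
    funext r w
    rw [hAC.eq k m r w hm, t.rhs_eq_range _ _ _ _ (N - k).toNat fun i hi => by
      funext n; rw [hN _ (by omega)]; rfl]
    refine Finset.sum_congr rfl fun i _ => ?_
    rw [show m + r - (t.T : ℤ) * i = r + (m - t.T * i) by ring]
  rw [h1, t.br_sum ε _ _ (fun i r w => D (k + (i : ℕ)) (r + (m - t.T * (i : ℕ))) w) hB ?_ ?_,
    t.rhs_eq_range _ _ _ _ (N - k).toNat fun i hi => by
      funext n; rw [hN _ (by omega)]; exact t.br_zero ε _ _ _ _]
  · refine Finset.sum_congr rfl fun i _ => ?_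
    rw [t.br_shift ε (C := fun r w => D (k + (i : ℕ)) r w),
      show m + r - (t.T : ℤ) * i = r + (m - t.T * i) by ring]
  · intro i w
    obtain ⟨K, hK⟩ := hAC.field (k + (i : ℕ)) w
    exact ⟨K - (m - t.T * (i : ℕ)), fun n hn => hK _ (by omega)⟩
  · exact fun i n => map_zero _

/-- Products of mutually local fields are local (Dong's lemma). -/
theorem Jac.isLocal (hsq : eAB * eAB = 1) (hA : IsField fun n => A n) (hB : IsField fun n => B n)
    (hC : IsField fun n => C n) (Q : ℕ) {G : ℕ → ℤ → Module.End F W}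
    (hG : ∀ q < Q, IsField fun n => G q n)
    (hAB : ∀ M N w, t.cls M = cA → t.cls N = cB → A M (B N w) - eAB • B N (A M w)
      = ∑ q ∈ Finset.range Q, (bin (t.frac M) q : F) • G q (M + N - t.T * q) w)
    (hcA : ∃ m, t.cls m = cA) (hAC : t.Jac cA eAC A C D)
    (hBC : ∃ N : ℤ, ∀ l ≥ N, ∀ m n w, t.cls m = cB → t.br eBC B (fun n => C n) l m n w = 0)
    (hGC : ∀ q < Q, ∃ N : ℤ, ∀ l ≥ N, ∀ m n w, t.cls m = cA * cB →
      t.br (eAC * eBC) (G q) (fun n => C n) l m n w = 0) (k : ℤ) :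
    ∃ N : ℤ, ∀ l ≥ N, ∀ m n w, t.cls m = cB →
      t.br (eAB * eBC) B (fun n => D k n) l m n w = 0 := by
  obtain ⟨m, hm⟩ := hcA
  obtain ⟨N, hN⟩ := hBC
  choose! K hK using hGC
  obtain ⟨K', hK'⟩ := ((Finset.range Q).image K).finite_toSet.bddAbove
  -- The bound `N` removes the bracket of `B` with `C`. Since `r ≤ q < Q`, the other part gives `l +
  -- k' - r ≥ K'` for every `k' ≥ k`, which removes the brackets of `G q` with `C`.
  refine ⟨max N (K' + Q - k), fun l hl n r w hn => ?_⟩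
  have heAB : eAB ≠ 0 := fun h => by rw [h, zero_mul] at hsq; exact zero_ne_one hsq
  obtain ⟨L, hL⟩ := hAC.bound
  -- By unipotence it suffices that the brackets of `B` with the products, summed as in `rhs` over
  -- the index `k`, vanish for all `k' ≥ k`. That sum is an iterated bracket, hence computable by
  -- `br_br`.
  have key := t.eq_zero_of_rhs (D := fun k r => t.br (eAB * eBC) B (fun n => D k n) l n r w)
    ⟨L, fun k hk => by funext r; rw [hL k hk]; exact t.br_zero _ _ _ _ _⟩ m k (fun k' hk' r => by
      rw [← hAC.br_br hB _ _ _ _ _ _ _ hm]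
      have h1 := t.br_br hsq (eAC := eAC) (eBC := eBC) hA hB hC Q hG hAB k' l m n r w hm hn
      have h2 : t.br eBC B (fun n => C n) l n = 0 := by
        funext r w
        exact hN l (le_of_max_le_left hl) _ _ _ hn
      rw [h2, t.br_zero, zero_sub, Finset.sum_eq_zero fun q hq => Finset.sum_eq_zero fun sr hsr => ?_,
        neg_eq_zero, smul_eq_zero_iff_right heAB] at h1
      · exact h1
      · have h3 := hK' (Finset.mem_coe.2 (Finset.mem_image_of_mem _ hq))
        have h4 := Finset.mem_range.1 hq
        have h5 := mem_antidiagonal.1 hsr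
        have h6 := le_of_max_le_right hl
        rw [hK q h4 _ (by omega) _ _ _ (by rw [cls_sub_T_mul, cls_add, hm, hn]), smul_zero])
  exact congrFun (key k le_rfl) r

/-- The commutator formula for products. -/
theorem Jac.commute (hsq : eAB * eAB = 1) (hA : IsField fun n => A n) (hB : IsField fun n => B n)
    (hC : IsField fun n => C n) (Q : ℕ) {G : ℕ → ℤ → Module.End F W}
    (hG : ∀ q < Q, IsField fun n => G q n)
    (hAB : ∀ M N w, t.cls M = cA → t.cls N = cB → A M (B N w) - eAB • B N (A M w)
      = ∑ q ∈ Finset.range Q, (bin (t.frac M) q : F) • G q (M + N - t.T * q) w)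
    (hcA : ∃ m, t.cls m = cA) (hAC : t.Jac cA eAC A C D)
    {E : ℤ → ℤ → Module.End F W} (hBC : t.Jac cB eBC B C E)
    {M : ℤ → ℤ → ℤ → Module.End F W} (hAE : ∀ l, t.Jac cA (eAB * eAC) A (E l) (M l))
    (hM : ∃ N : ℤ, ∀ l ≥ N, M l = 0)
    {H : ℕ → ℤ → ℤ → Module.End F W}
    (hGC : ∀ q < Q, t.Jac (cA * cB) (eAC * eBC) (G q) C (H q)) (k : ℤ) :
    t.Jac cB (eAB * eBC) B (D k)
      (fun l => eAB • (M l k - ∑ q ∈ Finset.range Q, (bin (k : ℤ_[p]) q : F) • H q (k + l - q))) := by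
  obtain ⟨m, hm⟩ := hcA
  obtain ⟨L, hL⟩ := hM
  choose! hb hhb using fun q hq => (hGC q hq).bound
  obtain ⟨K, hK⟩ : ∃ K : ℤ, ∀ q < Q, ∀ l ≥ K, H q l = 0 := by
    obtain ⟨K', hK'⟩ := ((Finset.range Q).image hb).finite_toSet.bddAbove
    exact ⟨K', fun q hq l hl => hhb q hq l (le_trans (hK' (Finset.mem_coe.2
      (Finset.mem_image_of_mem _ (Finset.mem_range.2 hq)))) hl)⟩
  choose MB hMB using fun l => (hAE l).bound
  -- the products vanish if the sum of the two indices is large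
  have hMM : ∀ l k : ℤ, ∃ N : ℕ, ∀ i j : ℕ, N ≤ i + j → M (l + j) (k + i) = 0 := by
    intro l k
    obtain ⟨K', hK'⟩ := ((Finset.range (L - l).toNat).image
      fun j : ℕ => MB (l + j)).finite_toSet.bddAbove
    refine ⟨(L - l).toNat + (K' - k).toNat, fun i j hij => ?_⟩
    rcases le_or_gt L (l + j) with h | h
    · rw [hL _ h]; rfl
    · have h1 : MB (l + j) ≤ K' := hK' (Finset.mem_coe.2
        (Finset.mem_image_of_mem (fun j : ℕ => MB (l + j)) (Finset.mem_range.2 (by omega))))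
      exact hMB _ _ (by omega)
  have heAB : eAB ≠ 0 := fun h => by rw [h, zero_mul] at hsq; exact zero_ne_one hsq
  obtain ⟨L', hL'⟩ := hAC.bound
  refine ⟨⟨max L (K + Q - k), fun l hl => ?_⟩, fun l => ?_, fun l n r w hn => ?_⟩
  · rw [hL l (le_of_max_le_left hl), Finset.sum_eq_zero fun q hq => ?_]
    · simp
    · have h1 := Finset.mem_range.1 hq
      have h2 := le_of_max_le_right hl
      rw [hK q h1 _ (by omega), smul_zero]
  · intro w
    obtain ⟨N, hN⟩ := (hAE l).field k w
    choose! N' hN' using fun q (hq : q < Q) => (hGC q hq).field (k + l - q) w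
    obtain ⟨K', hK'⟩ := ((Finset.range Q).image N').finite_toSet.bddAbove
    refine ⟨max N K', fun n hn => ?_⟩
    have h0 : M l k n w = 0 := hN n (le_of_max_le_left hn)
    simp only [Pi.smul_apply, Pi.sub_apply, Finset.sum_apply, LinearMap.smul_apply,
      LinearMap.sub_apply, LinearMap.sum_apply]
    rw [h0, Finset.sum_eq_zero fun q hq => ?_]
    · simp
    · have h1 := le_of_max_le_right hn
      have h2 := hK' (Finset.mem_coe.2 (Finset.mem_image_of_mem _ hq))
      have h3 : H q (k + l - q) n w = 0 := hN' q (Finset.mem_range.1 hq) n (by omega)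
      rw [h3, smul_zero]
  -- The claimed value of `B_l (A_k C)`, namely `A_k (B_l C)` corrected by the products
  -- `(G_q)_{k+l-q} C`, applied to `w`.
  let R : ℤ → ℤ → ℤ → W := fun k l n => eAB • (M l k n w
    - ∑ q ∈ Finset.range Q, (bin (k : ℤ_[p]) q : F) • H q (k + l - q) n w)
  have hR : ∀ k l : ℤ, ∃ N : ℕ, ∀ i j : ℕ, N ≤ i + j → R (k + i) (l + j) = 0 := by
    intro k l
    obtain ⟨N, hN⟩ := hMM l k
    refine ⟨max N (K + Q - k - l).toNat, fun i j hij => ?_⟩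
    funext n
    simp only [R]
    rw [hN i j (le_of_max_le_left hij), Finset.sum_eq_zero fun q hq => ?_]
    · simp
    · have h1 := Finset.mem_range.1 hq
      have h2 := le_of_max_le_right hij
      rw [hK q h1 _ (by omega)]
      simp
  have hRl : ∀ k, t.rhs (fun l n => (eAB • (M l k
      - ∑ q ∈ Finset.range Q, (bin (k : ℤ_[p]) q : F) • H q (k + l - q))) n w) l n
      = t.rhs (R k) l n := by
    intro k
    congr 1
    funext l n
    simp only [R, Pi.smul_apply, Pi.sub_apply, Finset.sum_apply, LinearMap.smul_apply,
      LinearMap.sub_apply, LinearMap.sum_apply]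
  rw [hRl]
  have hRR : ∃ N : ℤ, ∀ k ≥ N, (fun r => t.rhs (R k) l n r) = 0 := by
    obtain ⟨N, hN⟩ := hR 0 l
    refine ⟨N, fun k hk => ?_⟩
    funext r
    rw [t.rhs_eq_range _ _ _ _ 0 fun i _ => by
      have := hN k.toNat i (by omega)
      rwa [show (0 : ℤ) + (k.toNat : ℤ) = k by omega] at this]
    rfl
  -- Unipotence in the index `k`: the identity is compared only after the operator for `m/T` has
  -- been applied, where the left side becomes an iterated bracket.
  have key := t.eq_zero_of_rhs (D := fun k r => t.br (eAB * eBC) B (fun n => D k n) l n r w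
      - t.rhs (R k) l n r)
    ⟨max L' hRR.choose, fun k hk => by
      funext r
      rw [hL' k (le_of_max_le_left hk)]
      have h1 := congrFun (hRR.choose_spec k (le_of_max_le_right hk)) r
      rw [h1]
      exact (sub_zero _).trans (t.br_zero _ _ _ _ _)⟩ m k (fun k _ r => ?_)
  · exact sub_eq_zero.1 (congrFun (key k le_rfl) r)
  rw [t.rhs_sub _ _ ⟨L', fun k hk => by
    funext r; rw [hL' k hk]; exact t.br_zero _ _ _ _ _⟩ hRR, ← hAC.br_br hB _ _ _ _ _ _ _ hm]
  have h1 := t.br_br hsq (eAC := eAC) (eBC := eBC) hA hB hC Q hG hAB k l m n r w hm hn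
  rw [hBC.br_br hA _ _ _ _ _ _ _ hn] at h1
  have h2 : t.rhs (fun l r => t.br (eAB * eAC) A (fun n => E l n) k m r w) l n r
      = ∑ᶠ i : ℕ, ∑ᶠ j : ℕ, ((bin (t.frac m) i : F) * bin (t.frac n) j) •
        M (l + j) (k + i) (m + n + r - t.T * (i + j : ℕ)) w := by
    obtain ⟨N, hN⟩ := hMM l k
    rw [finsum_finsum_comm N fun i j hij => by rw [hN i j hij]; simp, rhs]
    refine finsum_congr fun j => ?_
    rw [(hAE _).eq k m _ w hm, rhs, smul_finsum]
    refine finsum_congr fun i => ?_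
    rw [smul_smul, mul_comm (bin (t.frac n) j)]
    congr 3
    push_cast
    ring
  have h3 : ∀ q ∈ Finset.range Q, ∀ sr ∈ antidiagonal q,
      (bin (t.frac m) sr.1 * bin (k : ℤ_[p]) sr.2 : F) •
        t.br (eAC * eBC) (G q) (fun n => C n) (l + k - sr.2) (m + n - t.T * sr.1) r w
      = (bin (k : ℤ_[p]) sr.2 * bin (t.frac m) sr.1 : F) •
        ∑ᶠ u : ℕ, (bin (t.frac m + t.frac n - (sr.1 : ℤ_[p])) u : F) •
          (fun q s : ℕ => H q (k + l - q + s) (m + n + r - t.T * s) w) q (sr.1 + u) := by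
    intro q hq sr hsr
    rw [(hGC q (Finset.mem_range.1 hq)).eq _ _ _ _ (by rw [cls_sub_T_mul, cls_add, hm, hn]), rhs,
      mul_comm]
    congr 1
    refine finsum_congr fun u => ?_
    have hq' : (q : ℤ) = sr.1 + sr.2 := by rw [← mem_antidiagonal.1 hsr]; push_cast; rfl
    rw [frac_sub, frac_add, show t.frac (t.T * (sr.1 : ℤ)) = (sr.1 : ℤ_[p]) by simp]
    congr 1
    dsimp only
    rw [hq']
    congr 2
    · push_cast; ring
    · push_cast; ring
  have h4 : t.rhs (fun k r => t.rhs (R k) l n r) k m r = eAB • ((∑ᶠ i : ℕ, ∑ᶠ j : ℕ,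
        ((bin (t.frac m) i : F) * bin (t.frac n) j) •
        M (l + j) (k + i) (m + n + r - t.T * (i + j : ℕ)) w)
      - ∑ᶠ s : ℕ, ∑ ij ∈ antidiagonal s, (bin (t.frac m) ij.1 * bin (t.frac n) ij.2 : F) •
        ∑ q ∈ Finset.range Q, (bin ((k : ℤ_[p]) + (ij.1 : ℤ_[p])) q : F) •
          (fun q s : ℕ => H q (k + l - q + s) (m + n + r - t.T * s) w) q s) := by
    obtain ⟨N, hN⟩ := hMM l k
    obtain ⟨N', hN'⟩ := hR k l
    have h5 : t.rhs (fun k r => t.rhs (R k) l n r) k m r = ∑ᶠ i : ℕ, ∑ᶠ j : ℕ,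
        ((bin (t.frac m) i : F) * bin (t.frac n) j) •
          R (k + i) (l + j) (m + n + r - t.T * (i + j : ℕ)) := by
      rw [rhs]
      refine finsum_congr fun i => ?_
      rw [rhs, smul_finsum]
      refine finsum_congr fun j => ?_
      rw [smul_smul]
      congr 2
      push_cast
      ring
    have hH : ∀ s ≥ (K + Q - k - l).toNat, ∀ ij ∈ antidiagonal s,
        (bin (t.frac m) ij.1 * bin (t.frac n) ij.2 : F) •
        ∑ q ∈ Finset.range Q, (bin ((k : ℤ_[p]) + (ij.1 : ℤ_[p])) q : F) •
          (fun q s : ℕ => H q (k + l - q + s) (m + n + r - t.T * s) w) q s = 0 := by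
      intro s hs ij _
      rw [Finset.sum_eq_zero fun q hq => ?_, smul_zero]
      have h1 := Finset.mem_range.1 hq
      dsimp only
      rw [hK q h1 _ (by omega)]
      simp
    rw [h5, finsum_finsum_antidiagonal N' fun i j hij => by rw [hN' i j hij]; simp,
      finsum_finsum_antidiagonal N fun i j hij => by rw [hN i j hij]; simp,
      finsum_eq_range (max (max N N') (K + Q - k - l).toNat) fun s hs => Finset.sum_eq_zero
        fun ij hij => by
          rw [hN' _ _ (by rw [mem_antidiagonal.1 hij]; omega)]; simp,
      finsum_eq_range (max (max N N') (K + Q - k - l).toNat) fun s hs => Finset.sum_eq_zero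
        fun ij hij => by
          rw [hN _ _ (by rw [mem_antidiagonal.1 hij]; omega)]; simp,
      finsum_eq_range (max (max N N') (K + Q - k - l).toNat) fun s hs => Finset.sum_eq_zero
        fun ij hij => hH s (by omega) ij hij,
      ← Finset.sum_sub_distrib, Finset.smul_sum]
    refine Finset.sum_congr rfl fun s _ => ?_
    rw [← Finset.sum_sub_distrib, Finset.smul_sum]
    refine Finset.sum_congr rfl fun ij hij => ?_
    simp only [R]
    rw [mem_antidiagonal.1 hij, smul_comm, ← smul_sub]
    congr 4
    funext q
    congr 2
    · push_cast; rfl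
    · congr 1
      rw [← mem_antidiagonal.1 hij]
      push_cast
      ring
  -- The correction terms match by the identity already used for `br_br`, now with the exponents
  -- `m/T`, `n/T` and base `k`.
  have h6 := finsum_antidiagonal_bin_add (F := F) (W := W) (t.frac m) (t.frac n) (k : ℤ_[p]) Q
    (fun q s : ℕ => H q (k + l - q + s) (m + n + r - t.T * s) w) (K + Q - k - l).toNat
    (fun q hq s hs => by rw [hK q hq _ (by omega)]; rfl)
  rw [Finset.sum_congr rfl fun q hq => Finset.sum_congr rfl (h3 q hq)] at h1
  rw [h4, h6, ← h2]
  -- The two sources split `q` as `(r, s)` and `(s, r)`, so one antidiagonal has to be reflected.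
  have h7 : ∀ q : ℕ, ∑ sr ∈ antidiagonal q, (bin (k : ℤ_[p]) sr.1 * bin (t.frac m) sr.2 : F) •
        ∑ᶠ u : ℕ, (bin (t.frac m + t.frac n - (sr.2 : ℤ_[p])) u : F) •
          (fun q s : ℕ => H q (k + l - q + s) (m + n + r - t.T * s) w) q (sr.2 + u)
      = ∑ sr ∈ antidiagonal q, (bin (k : ℤ_[p]) sr.2 * bin (t.frac m) sr.1 : F) •
        ∑ᶠ u : ℕ, (bin (t.frac m + t.frac n - (sr.1 : ℤ_[p])) u : F) •
          (fun q s : ℕ => H q (k + l - q + s) (m + n + r - t.T * s) w) q (sr.1 + u) := fun q => by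
    rw [← Finset.Nat.sum_antidiagonal_swap]
    rfl
  rw [Finset.sum_congr rfl fun q _ => h7 q, ← h1, sub_sub_cancel, smul_smul, hsq, one_smul,
    sub_self]

end TwistDatum
end Products
end SuperVA

namespace SuperVA

/-! ### Divided derivatives -/

open Finset.HasAntidiagonal (antidiagonal mem_antidiagonal)

section Derivative

variable {p : ℕ} [Fact p.Prime] {F : Type*} [Field F] [CharP F p]
  {W : Type*} [AddCommGroup W] [Module F W]

/-- Both sides run over the quadruples with sum `j`, grouped as `(x+y) + (z+v)` or as `(x+z) +
(y+v)`. -/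
theorem sum_antidiagonal_four (j : ℕ) (f : ℕ → ℕ → ℕ → ℕ → W) :
    ∑ su ∈ antidiagonal j, ∑ xy ∈ antidiagonal su.1, ∑ zv ∈ antidiagonal su.2,
        f xy.1 xy.2 zv.1 zv.2
      = ∑ ac ∈ antidiagonal j, ∑ xz ∈ antidiagonal ac.1, ∑ yv ∈ antidiagonal ac.2,
        f xz.1 yv.1 xz.2 yv.2 := by
  simp only [Finset.sum_sigma']
  refine Finset.sum_nbij'
    (fun q => ⟨(q.2.1.1 + q.2.2.1, q.2.1.2 + q.2.2.2), (q.2.1.1, q.2.2.1), (q.2.1.2, q.2.2.2)⟩)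
    (fun q => ⟨(q.2.1.1 + q.2.2.1, q.2.1.2 + q.2.2.2), (q.2.1.1, q.2.2.1), (q.2.1.2, q.2.2.2)⟩)
    ?_ ?_ ?_ ?_ ?_
  · rintro ⟨⟨a, b⟩, ⟨c, d⟩, e, f⟩ h
    simp only [Finset.mem_sigma, mem_antidiagonal] at h ⊢
    exact ⟨by omega, trivial, trivial⟩
  · rintro ⟨⟨a, b⟩, ⟨c, d⟩, e, f⟩ h
    simp only [Finset.mem_sigma, mem_antidiagonal] at h ⊢
    exact ⟨by omega, trivial, trivial⟩
  · rintro ⟨⟨a, b⟩, ⟨c, d⟩, e, f⟩ h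
    simp only [Finset.mem_sigma, mem_antidiagonal] at h ⊢
    obtain ⟨h1, rfl, rfl⟩ := h
    rfl
  · rintro ⟨⟨a, b⟩, ⟨c, d⟩, e, f⟩ h
    simp only [Finset.mem_sigma, mem_antidiagonal] at h ⊢
    obtain ⟨h1, rfl, rfl⟩ := h
    rfl
  · rintro ⟨⟨a, b⟩, ⟨c, d⟩, e, f⟩ h
    rfl

theorem sum_antidiagonal_choose_neg_one (c : ℕ) :
    ∑ yv ∈ antidiagonal c, ((c.choose yv.1 : F) * (-1) ^ yv.2) = if c = 0 then 1 else 0 := by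
  have h := (Commute.all (1 : F) (-1)).add_pow' c
  simp only [one_pow, one_mul, nsmul_eq_mul] at h
  rw [← h, add_neg_cancel, zero_pow_eq]

/-- Vandermonde splits `(ν + i choose j)`, and trinomial revision lets `(i choose s)` lower `(l
choose i)` to `(l - s choose i - s)`; the sign comes from the shift of `i`. -/
theorem altSum_bin_add (l : ℤ) (ν : ℤ_[p]) (j : ℕ) (X : ℕ → W) (N : ℕ) (hX : ∀ i ≥ N, X i = 0) :
    altSum p F l (fun i => (bin (ν + (i : ℤ_[p])) j : F) • X i)
      = ∑ su ∈ antidiagonal j, (bin ν su.2 * bin (l : ℤ_[p]) su.1 * (-1) ^ su.1 : F) •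
        altSum p F (l - su.1) (fun i => X (su.1 + i)) := by
  have h1 : ∀ su : ℕ × ℕ, (bin ν su.2 * bin (l : ℤ_[p]) su.1 * (-1) ^ su.1 : F) •
      altSum p F (l - su.1) (fun i => X (su.1 + i)) = ∑ i ∈ Finset.range N,
      ((-1) ^ i * bin (l : ℤ_[p]) i * (bin (i : ℤ_[p]) su.1 * bin ν su.2) : F) • X i := by
    intro su
    rw [← finsum_eq_range N fun i hi => by rw [hX i hi, smul_zero]]
    symm
    rw [finsum_shift su.1 fun i hi => by
      rw [bin_natCast, Nat.choose_eq_zero_of_lt hi]; simp, altSum, smul_finsum]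
    refine finsum_congr fun i => ?_
    have h2 := bin_mul_bin (F := F) (l : ℤ_[p]) su.1 i
    rw [smul_smul, bin_natCast, pow_add]
    push_cast
    congr 1
    linear_combination (-(bin ν su.2) * (-1) ^ su.1 * (-1) ^ i) * h2
  rw [Finset.sum_congr rfl fun su _ => h1 su, Finset.sum_comm, altSum,
    finsum_eq_range N fun i hi => by rw [hX i hi, smul_zero, smul_zero]]
  refine Finset.sum_congr rfl fun i _ => ?_
  rw [← Finset.sum_smul, ← Finset.mul_sum, ← bin_add, smul_smul, add_comm ν]

/-- As for `altSum_bin_add`, but `(l - i choose s)` lowers `l` without shifting `i`, so no sign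
appears. -/
theorem altSum_bin_sub (l : ℤ) (ν : ℤ_[p]) (j : ℕ) (X : ℕ → W) (N : ℕ) (hX : ∀ i ≥ N, X i = 0) :
    altSum p F l (fun i => (bin (ν + (l : ℤ_[p]) - (i : ℤ_[p])) j : F) • X i)
      = ∑ su ∈ antidiagonal j, (bin ν su.2 * bin (l : ℤ_[p]) su.1 : F) •
        altSum p F (l - su.1) X := by
  have h1 : ∀ su : ℕ × ℕ, (bin ν su.2 * bin (l : ℤ_[p]) su.1 : F) •
      altSum p F (l - su.1) X = ∑ i ∈ Finset.range N,
      ((-1) ^ i * bin (l : ℤ_[p]) i *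
        (bin ((l : ℤ_[p]) - (i : ℤ_[p])) su.1 * bin ν su.2) : F) • X i := by
    intro su
    rw [altSum, finsum_eq_range N fun i hi => by rw [hX i hi, smul_zero], Finset.smul_sum]
    refine Finset.sum_congr rfl fun i _ => ?_
    have h2 := bin_mul_bin' (F := F) (l : ℤ_[p]) su.1 i
    rw [smul_smul]
    push_cast
    congr 1
    linear_combination (bin ν su.2 * (-1) ^ i) * h2
  rw [Finset.sum_congr rfl fun su _ => h1 su, Finset.sum_comm, altSum,
    finsum_eq_range N fun i hi => by rw [hX i hi, smul_zero, smul_zero]]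
  refine Finset.sum_congr rfl fun i _ => ?_
  rw [← Finset.sum_smul, ← Finset.mul_sum, ← bin_add, smul_smul, add_sub_assoc, add_comm ν]

/-- After `i` is shifted by `y`, trinomial revision leaves `(c choose y) (-1)^(c-y)` as the only
dependence on `y`, and `(1 - 1)^c = 0` for `c > 0`. -/
theorem sum_antidiagonal_bin_shift (μ : ℤ_[p]) (c : ℕ) (Z : ℤ → W) :
    ∑ yv ∈ antidiagonal c, ∑ᶠ i : ℕ, (bin μ i * (bin (i : ℤ_[p]) yv.1 *
        ((-1) ^ yv.2 * bin (μ - (i : ℤ_[p])) yv.2)) : F) • Z (i - yv.1)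
      = if c = 0 then ∑ᶠ i : ℕ, (bin μ i : F) • Z i else 0 := by
  have h1 : ∀ yv ∈ antidiagonal c, ∑ᶠ i : ℕ, (bin μ i * (bin (i : ℤ_[p]) yv.1 *
        ((-1) ^ yv.2 * bin (μ - (i : ℤ_[p])) yv.2)) : F) • Z (i - yv.1)
      = ((c.choose yv.1 : F) * (-1) ^ yv.2) •
        ∑ᶠ i : ℕ, (bin μ i * bin (μ - (i : ℤ_[p])) c : F) • Z i := by
    intro yv hyv
    rw [finsum_shift yv.1 fun i hi => by
      rw [bin_natCast, Nat.choose_eq_zero_of_lt hi]; simp, smul_finsum]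
    refine finsum_congr fun i => ?_
    have h2 := bin_mul_bin (F := F) μ i yv.1
    have h3 := bin_mul_bin (F := F) (μ - (i : ℤ_[p])) yv.1 yv.2
    rw [mem_antidiagonal.1 hyv] at h3
    rw [smul_smul, bin_natCast]
    rw [show ((yv.1 + i : ℕ) : ℤ) - yv.1 = i by push_cast; ring]
    congr 1
    rw [add_comm yv.1 i, show (i + yv.1).choose yv.1 = (i + yv.1).choose i by
      rw [Nat.choose_symm_add]]
    rw [sub_sub, ← Nat.cast_add] at h3
    linear_combination (-(-1) ^ yv.2 * bin (μ - ((i + yv.1 : ℕ) : ℤ_[p])) yv.2) * h2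
      + ((-1) ^ yv.2 * bin μ i) * h3
  rw [Finset.sum_congr rfl h1, ← Finset.sum_smul, sum_antidiagonal_choose_neg_one]
  split_ifs with h
  · subst h; simp
  · simp

namespace TwistDatum

variable {t : TwistDatum p F} {c ε : F} {A C : ℤ → Module.End F W}
  {D : ℤ → ℤ → Module.End F W}

variable (t) in
/-- The divided derivative `∂^j/j!` of a field. -/
noncomputable def deriv (j : ℕ) (C : ℤ → Module.End F W) : ℤ → Module.End F W :=
  fun n => ((-1) ^ j * bin (t.frac n) j : F) • C (n - t.T * j)

@[simp] theorem deriv_zero (C : ℤ → Module.End F W) : t.deriv 0 C = C := by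
  funext n
  simp [deriv]

theorem deriv_isField (j : ℕ) {C : ℤ → Module.End F W} (hC : IsField fun n => C n) :
    IsField fun n => t.deriv j C n := by
  intro w
  obtain ⟨N, hN⟩ := hC w
  refine ⟨N + t.T * j, fun n hn => ?_⟩
  change (t.deriv j C n) w = 0
  have h1 : C (n - t.T * j) w = 0 := hN _ (by omega)
  rw [deriv, LinearMap.smul_apply, h1, smul_zero]

/-- The divided Leibniz rule `(x₁-x₂)^l ∂^(j) C = ∑ (l choose s) ∂^(u) ((x₁-x₂)^(l-s) C)` over `s +
u = j`. The signs from integrating by parts and from differentiating `(x₁-x₂)^l` in `x₂` cancel. -/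
theorem br_deriv (hA : IsField fun n => A n) (hC : IsField fun n => C n) (j : ℕ)
    (l m n : ℤ) (w : W) :
    t.br ε A (fun n => t.deriv j C n) l m n w = ∑ su ∈ antidiagonal j,
      ((-1) ^ su.2 * bin (t.frac n) su.2 * bin (l : ℤ_[p]) su.1 : F) •
        t.br ε A (fun n => C n) (l - su.1) m (n - t.T * su.2) w := by
  obtain ⟨N, hN⟩ := t.exists_bound hC (n - t.T * j) w
  obtain ⟨M, hM⟩ := t.exists_bound hA m w
  have h1 := altSum_bin_add (F := F) l (t.frac n) j (fun i =>
    A (m + t.T * (l - i)) (C (n - t.T * j + t.T * i) w)) N fun i hi => by rw [hN i hi, map_zero]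
  have h2 := altSum_bin_sub (F := F) l (t.frac n) j (fun i =>
    C (n - t.T * j + t.T * (l - i)) (A (m + t.T * i) w)) M fun i hi => by rw [hM i hi, map_zero]
  have h3 : (fun i : ℕ => A (m + t.T * (l - i)) (t.deriv j C (n + t.T * i) w))
      = fun i : ℕ => ((-1) ^ j : F) • (bin (t.frac n + (i : ℤ_[p])) j : F) •
        A (m + t.T * (l - i)) (C (n - t.T * j + t.T * i) w) := by
    funext i
    rw [deriv, LinearMap.smul_apply, map_smul, smul_smul, frac_add,
      show t.frac (t.T * (i : ℤ)) = (i : ℤ_[p]) by simp, add_sub_right_comm]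
  have h4 : (fun i : ℕ => t.deriv j C (n + t.T * (l - i)) (A (m + t.T * i) w))
      = fun i : ℕ => ((-1) ^ j : F) • (bin (t.frac n + (l : ℤ_[p]) - (i : ℤ_[p])) j : F) •
        C (n - t.T * j + t.T * (l - i)) (A (m + t.T * i) w) := by
    funext i
    rw [deriv, LinearMap.smul_apply, smul_smul, frac_add, frac_T_mul, add_sub_right_comm]
    push_cast
    rw [add_sub_assoc]
  rw [br, h3, h4, altSum_smul, altSum_smul, h1, h2, Finset.smul_sum, Finset.smul_sum,
    Finset.smul_sum, ← Finset.sum_sub_distrib]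
  refine Finset.sum_congr rfl fun su hsu => ?_
  have hj : (j : ℤ) = su.1 + su.2 := by rw [← mem_antidiagonal.1 hsu]; push_cast; rfl
  have h5 : ((-1 : F)) ^ (l - (su.1 : ℤ)) = (-1) ^ l * (-1) ^ su.1 := by
    rw [zpow_sub₀ (by norm_num), zpow_natCast, div_eq_mul_inv, ← inv_pow, inv_neg_one]
  have h6 : (fun i : ℕ => A (m + t.T * (l - (su.1 + i : ℕ)))
      (C (n - t.T * j + t.T * (su.1 + i : ℕ)) w))
      = fun i : ℕ => A (m + t.T * (l - su.1 - i)) (C (n - t.T * su.2 + t.T * i) w) := by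
    funext i
    rw [hj]
    congr 2
    · push_cast; ring
    · congr 1; push_cast; ring
  have h7 : (fun i : ℕ => C (n - t.T * j + t.T * (l - i)) (A (m + t.T * i) w))
      = fun i : ℕ => C (n - t.T * su.2 + t.T * (l - su.1 - i)) (A (m + t.T * i) w) := by
    funext i
    rw [hj]
    congr 2
    ring
  have h8 : ((-1 : F)) ^ j = (-1) ^ su.1 * (-1) ^ su.2 := by
    rw [← mem_antidiagonal.1 hsu, pow_add]
  have h9 : ((-1 : F)) ^ su.1 * (-1) ^ su.1 = 1 := by
    rw [← mul_pow]; simp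
  rw [h6, h7, br, h5, h8, smul_sub, smul_smul, smul_smul, smul_smul, smul_smul]
  congr 2
  · linear_combination ((-1) ^ su.2 * bin (t.frac n) su.2 * bin (l : ℤ_[p]) su.1) * h9
  · ring

/-- The right side obeys the Leibniz rule of `br_deriv`. Vandermonde splits `(l + i choose ·)` and
`(n/T + (m/T - i) choose ·)` into four indices; the two that involve `i` are grouped together and
cancel by `sum_antidiagonal_bin_shift` unless both are zero. -/
theorem rhs_deriv (hD : ∃ N : ℤ, ∀ l ≥ N, D l = 0) (j : ℕ) (l m n : ℤ) (w : W) :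
    t.rhs (fun (k n : ℤ) => (∑ su ∈ antidiagonal j, (bin (k : ℤ_[p]) su.1 : F) •
        t.deriv su.2 (D (k - su.1))) n w) l m n
      = ∑ su ∈ antidiagonal j, ((-1) ^ su.2 * bin (t.frac n) su.2 * bin (l : ℤ_[p]) su.1 : F) •
        t.rhs (fun k n => D k n w) (l - su.1) m (n - t.T * su.2) := by
  obtain ⟨N, hN⟩ := hD
  have h1 : ∀ i : ℕ, (bin (t.frac m) i : F) • (fun (k n : ℤ) => (∑ su ∈ antidiagonal j,
        (bin (k : ℤ_[p]) su.1 : F) • t.deriv su.2 (D (k - su.1))) n w) (l + i) (m + n - t.T * i)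
      = ∑ ac ∈ antidiagonal j, ∑ xz ∈ antidiagonal ac.1, ∑ yv ∈ antidiagonal ac.2,
        ((-1) ^ xz.2 * bin (t.frac n) xz.2 * bin (l : ℤ_[p]) xz.1 : F) •
        (bin (t.frac m) i * (bin (i : ℤ_[p]) yv.1 *
          ((-1) ^ yv.2 * bin (t.frac m - (i : ℤ_[p])) yv.2)) : F) •
        (fun e : ℤ => D (l - xz.1 + e) (m + (n - t.T * xz.2) - t.T * e - t.T * ac.2) w)
          (i - yv.1) := by
    intro i
    dsimp only
    rw [Finset.sum_apply, LinearMap.sum_apply, Finset.smul_sum]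
    have h2 : ∀ su ∈ antidiagonal j, (bin (t.frac m) i : F) •
        (((bin ((l + i : ℤ) : ℤ_[p]) su.1 : F) • t.deriv su.2 (D (l + i - su.1)))
          (m + n - t.T * i)) w
        = ∑ xy ∈ antidiagonal su.1, ∑ zv ∈ antidiagonal su.2,
          (fun x y z v : ℕ => ((-1) ^ z * bin (t.frac n) z * bin (l : ℤ_[p]) x : F) •
            (bin (t.frac m) i * (bin (i : ℤ_[p]) y *
              ((-1) ^ v * bin (t.frac m - (i : ℤ_[p])) v)) : F) •
            D (l - x + (i - y)) (m + n - t.T * i - t.T * (z + v)) w) xy.1 xy.2 zv.1 zv.2 := by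
      intro su _
      rw [Pi.smul_apply, LinearMap.smul_apply, deriv, LinearMap.smul_apply, frac_sub, frac_add,
        show t.frac (t.T * (i : ℤ)) = (i : ℤ_[p]) by simp,
        show t.frac m + t.frac n - (i : ℤ_[p]) = t.frac n + (t.frac m - (i : ℤ_[p])) by ring,
        Int.cast_add, Int.cast_natCast, bin_add, bin_add, smul_smul, smul_smul, Finset.mul_sum,
        Finset.mul_sum, Finset.sum_mul, Finset.sum_smul]
      refine Finset.sum_congr rfl fun xy hxy => ?_
      rw [Finset.mul_sum, Finset.sum_smul]
      refine Finset.sum_congr rfl fun zv hzv => ?_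
      dsimp only
      rw [smul_smul, ← mem_antidiagonal.1 hxy, ← mem_antidiagonal.1 hzv, pow_add]
      have h3 : l + (i : ℤ) - ((xy.1 + xy.2 : ℕ) : ℤ) = l - xy.1 + (i - xy.2) := by
        push_cast; ring
      have h4 : m + n - t.T * i - t.T * ((zv.1 + zv.2 : ℕ) : ℤ)
          = m + n - t.T * i - t.T * (zv.1 + zv.2) := by push_cast; ring
      rw [h3, h4]
      congr 1
      ring
    rw [Finset.sum_congr rfl h2, sum_antidiagonal_four j (fun x y z v : ℕ =>
      ((-1) ^ z * bin (t.frac n) z * bin (l : ℤ_[p]) x : F) •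
            (bin (t.frac m) i * (bin (i : ℤ_[p]) y *
              ((-1) ^ v * bin (t.frac m - (i : ℤ_[p])) v)) : F) •
            D (l - x + (i - y)) (m + n - t.T * i - t.T * (z + v)) w)]
    refine Finset.sum_congr rfl fun ac _ => Finset.sum_congr rfl fun xz _ =>
      Finset.sum_congr rfl fun yv hyv => ?_
    rw [← mem_antidiagonal.1 hyv]
    congr 4
    push_cast
    ring
  rw [rhs, finsum_congr h1]
  have hz : ∀ i : ℕ, (N - l + j).toNat ≤ i → ∀ x y e : ℕ, x + y ≤ j → ∀ n,
      D (l - (x : ℕ) + ((i : ℤ) - (y : ℕ))) n = 0 := by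
    intro i hi x y e hxy n
    rw [hN _ (by omega)]; rfl
  rw [finsum_eq_range (N - l + j).toNat fun i hi => Finset.sum_eq_zero fun ac hac =>
    Finset.sum_eq_zero fun xz hxz => Finset.sum_eq_zero fun yv hyv => by
      have h2 := mem_antidiagonal.1 hac
      have h3 := mem_antidiagonal.1 hxz
      have h4 := mem_antidiagonal.1 hyv
      dsimp only
      rw [hz i hi _ _ 0 (by omega)]
      simp, Finset.sum_comm]
  have h5 : ∀ ac ∈ antidiagonal j, ∑ i ∈ Finset.range (N - l + j).toNat,
      ∑ xz ∈ antidiagonal ac.1, ∑ yv ∈ antidiagonal ac.2,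
        ((-1) ^ xz.2 * bin (t.frac n) xz.2 * bin (l : ℤ_[p]) xz.1 : F) •
        (bin (t.frac m) i * (bin (i : ℤ_[p]) yv.1 *
          ((-1) ^ yv.2 * bin (t.frac m - (i : ℤ_[p])) yv.2)) : F) •
        (fun e : ℤ => D (l - xz.1 + e) (m + (n - t.T * xz.2) - t.T * e - t.T * ac.2) w)
          (i - yv.1)
      = if ac.2 = 0 then ∑ xz ∈ antidiagonal ac.1,
        ((-1) ^ xz.2 * bin (t.frac n) xz.2 * bin (l : ℤ_[p]) xz.1 : F) •
        t.rhs (fun k n => D k n w) (l - xz.1) m (n - t.T * xz.2) else 0 := by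
    intro ac hac
    have h2 := mem_antidiagonal.1 hac
    rw [Finset.sum_comm]
    have h6 : ∀ xz ∈ antidiagonal ac.1, ∑ i ∈ Finset.range (N - l + j).toNat,
        ∑ yv ∈ antidiagonal ac.2,
        ((-1) ^ xz.2 * bin (t.frac n) xz.2 * bin (l : ℤ_[p]) xz.1 : F) •
        (bin (t.frac m) i * (bin (i : ℤ_[p]) yv.1 *
          ((-1) ^ yv.2 * bin (t.frac m - (i : ℤ_[p])) yv.2)) : F) •
        (fun e : ℤ => D (l - xz.1 + e) (m + (n - t.T * xz.2) - t.T * e - t.T * ac.2) w)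
          (i - yv.1)
        = ((-1) ^ xz.2 * bin (t.frac n) xz.2 * bin (l : ℤ_[p]) xz.1 : F) •
          if ac.2 = 0 then t.rhs (fun k n => D k n w) (l - xz.1) m (n - t.T * xz.2) else 0 := by
      intro xz hxz
      have h3 := mem_antidiagonal.1 hxz
      have h7 := sum_antidiagonal_bin_shift (F := F) (t.frac m) ac.2
        (fun e : ℤ => D (l - xz.1 + e) (m + (n - t.T * xz.2) - t.T * e - t.T * ac.2) w)
      rw [Finset.sum_comm]
      simp only [← Finset.smul_sum]
      congr 1
      rw [Finset.sum_congr rfl fun yv hyv => (finsum_eq_range (N - l + j).toNat fun i hi => by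
        have h4 := mem_antidiagonal.1 hyv
        rw [hz i hi _ _ 0 (by omega)]
        simp).symm, h7]
      split_ifs with h
      · rw [h, rhs]
        refine finsum_congr fun i => ?_
        simp
      · rfl
    rw [Finset.sum_congr rfl h6]
    split_ifs
    · rfl
    · simp
  rw [Finset.sum_congr rfl h5, Finset.sum_eq_single (j, 0)]
  · simp
  · rintro ⟨a, c⟩ hac hne
    rw [if_neg]
    rintro rfl
    rw [mem_antidiagonal] at hac
    exact hne (Prod.ext hac rfl)
  · intro h
    exact absurd (mem_antidiagonal.2 (by simp)) h

/-- Differentiating `C` transforms both sides of its Jacobi identity by the same Leibniz rule. -/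
theorem Jac.deriv_right (hA : IsField fun n => A n) (hC : IsField fun n => C n)
    (h : t.Jac c ε A C D) (j : ℕ) : t.Jac c ε A (t.deriv j C)
      (fun k => ∑ su ∈ antidiagonal j, (bin (k : ℤ_[p]) su.1 : F) •
        t.deriv su.2 (D (k - su.1))) where
  bound := by
    obtain ⟨N, hN⟩ := h.bound
    refine ⟨N + j, fun l hl => Finset.sum_eq_zero fun su hsu => ?_⟩
    have h1 := mem_antidiagonal.1 hsu
    rw [hN _ (by omega)]
    funext n
    simp [deriv]
  field k w := by
    choose K hK using fun su : ℕ × ℕ => deriv_isField (t := t) su.2 (h.field (k - su.1)) w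
    obtain ⟨K', hK'⟩ := ((antidiagonal j).image K).finite_toSet.bddAbove
    refine ⟨K', fun n hn => ?_⟩
    change (∑ su ∈ antidiagonal j, (bin (k : ℤ_[p]) su.1 : F) •
        t.deriv su.2 (D (k - su.1))) n w = 0
    rw [Finset.sum_apply, LinearMap.sum_apply]
    refine Finset.sum_eq_zero fun su hsu => ?_
    have h1 := hK' (Finset.mem_coe.2 (Finset.mem_image_of_mem _ hsu))
    have h2 : t.deriv su.2 (D (k - su.1)) n w = 0 := hK su n (by omega)
    rw [Pi.smul_apply, LinearMap.smul_apply, h2, smul_zero]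
  eq l m n w hm := by
    rw [br_deriv hA hC, rhs_deriv h.bound]
    exact Finset.sum_congr rfl fun su _ => by rw [h.eq _ _ _ _ hm]

/-- The product rule for divided derivatives. -/
theorem deriv_product {D' : ℕ → ℤ → ℤ → Module.End F W} (j : ℕ)
    (hD' : ∀ u ≤ j, ∀ k, D' u k = ∑ sv ∈ antidiagonal u, (bin (k : ℤ_[p]) sv.1 : F) •
      t.deriv sv.2 (D (k - sv.1))) (k : ℤ) :
    t.deriv j (D k)
      = ∑ iu ∈ antidiagonal j, ((-1) ^ iu.1 * bin (k : ℤ_[p]) iu.1 : F) •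
        D' iu.2 (k - iu.1) := by
  -- A dummy index `y`, forced to be zero, turns the sum into the fourfold shape of
  -- `sum_antidiagonal_four`. After regrouping, `i + s = c` is fixed and the alternating sum over
  -- `(c choose s)` kills every `c > 0`.
  have h1 : ∀ iu ∈ antidiagonal j, ((-1) ^ iu.1 * bin (k : ℤ_[p]) iu.1 : F) • D' iu.2 (k - iu.1)
      = ∑ xy ∈ antidiagonal iu.1, ∑ sv ∈ antidiagonal iu.2,
        (fun i y s v : ℕ => if y = 0 then (((i + s).choose s : F) * (-1) ^ i) •
          (bin (k : ℤ_[p]) (i + s) : F) • t.deriv v (D (k - (i + s : ℕ))) else 0)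
          xy.1 xy.2 sv.1 sv.2 := by
    intro iu hiu
    have h2 := mem_antidiagonal.1 hiu
    rw [hD' _ (by omega), Finset.smul_sum]
    symm
    rw [Finset.sum_eq_single (iu.1, 0)]
    · refine Finset.sum_congr rfl fun sv _ => ?_
      dsimp only
      have h3 := bin_mul_bin (F := F) (k : ℤ_[p]) iu.1 sv.1
      rw [if_pos rfl, smul_smul, smul_smul]
      push_cast
      rw [sub_sub]
      congr 1
      rw [Nat.choose_symm_add] at h3
      linear_combination -(-1) ^ iu.1 * h3
    · rintro ⟨a, c⟩ hac hne
      refine Finset.sum_eq_zero fun sv _ => if_neg ?_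
      rintro rfl
      rw [mem_antidiagonal] at hac
      exact hne (Prod.ext hac rfl)
    · intro h
      exact absurd (mem_antidiagonal.2 (by simp)) h
  rw [Finset.sum_congr rfl h1, sum_antidiagonal_four j (fun i y s v : ℕ =>
    if y = 0 then (((i + s).choose s : F) * (-1) ^ i) •
      (bin (k : ℤ_[p]) (i + s) : F) • t.deriv v (D (k - (i + s : ℕ))) else 0)]
  have h4 : ∀ ac ∈ antidiagonal j, ∑ xz ∈ antidiagonal ac.1, ∑ yv ∈ antidiagonal ac.2,
      (if yv.1 = 0 then (((xz.1 + xz.2).choose xz.2 : F) * (-1) ^ xz.1) •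
        (bin (k : ℤ_[p]) (xz.1 + xz.2) : F) • t.deriv yv.2 (D (k - (xz.1 + xz.2 : ℕ))) else 0)
      = if ac.1 = 0 then t.deriv ac.2 (D k) else 0 := by
    intro ac _
    have h5 : ∀ xz ∈ antidiagonal ac.1, ∑ yv ∈ antidiagonal ac.2,
      (if yv.1 = 0 then (((xz.1 + xz.2).choose xz.2 : F) * (-1) ^ xz.1) •
        (bin (k : ℤ_[p]) (xz.1 + xz.2) : F) • t.deriv yv.2 (D (k - (xz.1 + xz.2 : ℕ))) else 0)
        = ((ac.1.choose xz.swap.1 : F) * (-1) ^ xz.swap.2) •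
          (bin (k : ℤ_[p]) ac.1 : F) • t.deriv ac.2 (D (k - ac.1)) := by
      intro xz hxz
      rw [Finset.sum_eq_single (0, ac.2), if_pos rfl, mem_antidiagonal.1 hxz]
      · rfl
      · rintro ⟨a, c⟩ hac hne
        refine if_neg ?_
        rintro rfl
        rw [mem_antidiagonal] at hac
        exact hne (Prod.ext rfl (by simpa using hac))
      · intro h
        exact absurd (mem_antidiagonal.2 (by simp)) h
    rw [Finset.sum_congr rfl h5, Finset.Nat.sum_antidiagonal_swap
      (f := fun xz : ℕ × ℕ => ((ac.1.choose xz.1 : F) * (-1) ^ xz.2) •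
          (bin (k : ℤ_[p]) ac.1 : F) • t.deriv ac.2 (D (k - ac.1))), ← Finset.sum_smul,
      sum_antidiagonal_choose_neg_one]
    split_ifs with h
    · simp [h]
    · simp
  rw [Finset.sum_congr rfl h4, Finset.sum_eq_single (0, j)]
  · simp
  · rintro ⟨a, c⟩ hac hne
    refine if_neg ?_
    rintro rfl
    rw [mem_antidiagonal] at hac
    exact hne (Prod.ext rfl (by simpa using hac))
  · intro h
    exact absurd (mem_antidiagonal.2 (by simp)) h

end TwistDatum
end Derivative
end SuperVA

namespace SuperVA

/-! ### The identity field and uniqueness of products -/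

open Finset.HasAntidiagonal (antidiagonal mem_antidiagonal)

section Unit

variable {p : ℕ} [Fact p.Prime] {F : Type*} [Field F] [CharP F p]
  {W : Type*} [AddCommGroup W] [Module F W]

namespace TwistDatum

variable {t : TwistDatum p F} {c ε : F} {A C : ℤ → Module.End F W}
  {D : ℤ → ℤ → Module.End F W}

variable (t W) in
/-- The identity field. -/
def unit : ℤ → Module.End F W := fun n => if n = -t.T then 1 else 0

theorem unit_apply_of_ne {n : ℤ} (h : n ≠ -t.T) : t.unit W n = 0 := if_neg h

theorem unit_isField : IsField fun n => t.unit W n := fun w =>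
  ⟨0, fun n hn => by
    have := t.T_pos
    change t.unit W n w = 0
    rw [unit_apply_of_ne (by omega)]; rfl⟩

theorem unit_T_mul (k : ℤ) : t.unit W (t.T * k) = if k = -1 then 1 else 0 := by
  have h : (t.T : ℤ) * k = -t.T ↔ k = -1 := by
    have := t.T_pos
    constructor
    · intro h
      have h2 : (t.T : ℤ) * (k + 1) = 0 := by linear_combination h
      rcases mul_eq_zero.1 h2 with h3 | h3 <;> omega
    · rintro rfl; ring
  simp only [unit, h]

theorem unit_apply_of_cls {n : ℤ} (h : t.cls n ≠ 1) : t.unit W n = 0 := by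
  refine unit_apply_of_ne ?_
  rintro rfl
  exact h (by simpa using t.cls_T_mul (-1))

/-- For `l ≥ 0` the factor `(x₁ - x₂)^l` is a polynomial, so its two expansions agree: the
substitution `i ↦ l - i` exchanges the two sums. -/
theorem br_eq_zero_of_comm (h : ∀ M N w, t.cls M = c → A M (C N w) = ε • C N (A M w))
    {l : ℤ} (hl : 0 ≤ l) (m n : ℤ) (w : W) (hm : t.cls m = c) :
    t.br ε A (fun n => C n) l m n w = 0 := by
  obtain ⟨k, rfl⟩ := Int.eq_ofNat_of_zero_le hl
  rw [br, sub_eq_zero, altSum, altSum,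
    finsum_eq_range (k + 1) fun i hi => by
      rw [Int.cast_natCast, bin_natCast, Nat.choose_eq_zero_of_lt (by omega)]; simp,
    finsum_eq_range (k + 1) fun i hi => by
      rw [Int.cast_natCast, bin_natCast, Nat.choose_eq_zero_of_lt (by omega)]; simp,
    ← Finset.sum_range_reflect, Finset.smul_sum]
  refine Finset.sum_congr rfl fun i hi => ?_
  have hi' : i ≤ k := by have := Finset.mem_range.1 hi; omega
  rw [show k + 1 - 1 - i = k - i by omega, h _ _ _ (by rw [cls_add_T_mul, hm]), smul_smul,
    smul_smul, Int.cast_natCast, bin_natCast, bin_natCast, Nat.choose_symm hi', zpow_natCast,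
    Nat.cast_sub hi', sub_sub_cancel]
  congr 1
  have h1 : ((-1 : F)) ^ k = (-1) ^ (k - i) * (-1) ^ i := by rw [← pow_add]; congr 1; omega
  have h2 : ((-1 : F)) ^ i * (-1) ^ i = 1 := by rw [← mul_pow]; simp
  rw [h1]
  linear_combination (-(-1) ^ (k - i) * (k.choose i : F) * ε) * h2

/-- The slice `m = 0` is enough. There the coefficients `(0 choose i)` reduce the right side to one
term, and in the bracket only `l = -1` survives. -/
theorem Jac.one_left (hC : IsField fun n => C n) :
    t.Jac 1 1 (t.unit W) C (fun l => if l = -1 then C else 0) := by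
  refine Jac.of_fst unit_isField hC 0 (fun l hl => if_neg (by omega)) ?_
    (fun l hl m n w hm => br_eq_zero_of_comm (fun M N w _ => ?_) hl m n w hm) 0 (by simp) ?_
  · intro l
    split_ifs
    · exact hC
    · exact fun w => ⟨0, fun _ _ => rfl⟩
  · unfold unit
    split_ifs <;> simp
  · intro l n w
    have h1 : ∀ i : ℕ, (0 : ℤ) + t.T * i = t.T * i := fun i => zero_add _
    have h2 : altSum p F l (fun i => C (n + t.T * (l - i)) (t.unit W (0 + t.T * i) w)) = 0 :=
      altSum_eq_zero _ _ fun i => by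
        rw [h1, unit_T_mul, if_neg (by omega)]; simp
    have h3 : t.rhs (fun l n => (if l = -1 then C else 0) n w) l 0 n
        = (if l = -1 then C else 0) n w := by
      rw [rhs, finsum_eq_single _ 0]
      · simp
      · intro i hi
        rw [frac_zero, bin_zero_left, if_neg hi, zero_smul]
    rw [br, h2, h3, smul_zero, sub_zero, altSum]
    by_cases hl : l = -1
    · subst hl
      rw [finsum_eq_single _ 0]
      · rw [if_pos rfl, zero_add, unit_T_mul]
        simp
      · intro i hi
        rw [zero_add, unit_T_mul, if_neg (by omega)]
        simp
    · rw [if_neg hl]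
      refine (finsum_congr fun i => ?_).trans finsum_zero
      rw [zero_add, unit_T_mul]
      -- If `i = l + 1` and `l ≠ -1`, then `l ≥ 0` and `(l choose l + 1) = 0`.
      by_cases h : l - (i : ℤ) = -1
      · obtain ⟨k, rfl⟩ := Int.eq_ofNat_of_zero_le (show 0 ≤ l by omega)
        rw [Int.cast_natCast, bin_natCast, Nat.choose_eq_zero_of_lt (by omega)]
        simp
      · rw [if_neg h]; simp

/-- The creation property for fields: `B_{-j-1} 1` is the `j`-th divided derivative of `B`. The
slice used is `n = 0`, where the first half of the bracket vanishes. For `n` outside `Tℤ` both sides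
vanish, the right one by the support condition on `B`. -/
theorem Jac.one_right {B : ℤ → Module.End F W} (hB : IsField fun n => B n)
    (hs : ∀ n, t.cls n ≠ c → B n = 0) :
    t.Jac c 1 B (t.unit W) (fun l => if l < 0 then t.deriv (-l - 1).toNat B else 0) := by
  refine Jac.of_snd hB unit_isField 0 (fun l hl => if_neg (by omega)) ?_
    (fun l hl m n w hm => br_eq_zero_of_comm (fun M N w _ => ?_) hl m n w hm) ?_
  · intro l
    split_ifs
    · exact deriv_isField _ hB
    · exact fun w => ⟨0, fun _ _ => rfl⟩
  · unfold unit
    split_ifs <;> simp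
  · intro n
    by_cases hn : t.cls n = 1
    · obtain ⟨k, hk⟩ := t.exists_of_cls_eq (hn.trans t.cls_zero.symm)
      refine ⟨-k, fun l m w hm => ?_⟩
      rw [show n + t.T * -k = 0 by rw [hk]; ring]
      have h2 : altSum p F l (fun i => B (m + t.T * (l - i)) (t.unit W (0 + t.T * i) w)) = 0 :=
        altSum_eq_zero _ _ fun i => by
          rw [zero_add, unit_T_mul, if_neg (by omega)]; simp
      rw [br, h2, zero_sub, altSum]
      by_cases hl : 0 ≤ l
      · rw [finsum_eq_zero_of_forall_eq_zero, smul_zero, neg_zero]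
        · symm
          refine finsum_eq_zero_of_forall_eq_zero fun i => ?_
          dsimp only
          rw [if_neg (by omega)]
          simp
        · intro i
          rw [zero_add, unit_T_mul]
          by_cases h : l - (i : ℤ) = -1
          · obtain ⟨k, rfl⟩ := Int.eq_ofNat_of_zero_le hl
            rw [Int.cast_natCast, bin_natCast, Nat.choose_eq_zero_of_lt (by omega)]
            simp
          · rw [if_neg h]; simp
      · obtain ⟨N, rfl⟩ : ∃ N : ℕ, l = -N - 1 := ⟨(-l - 1).toNat, by omega⟩
        have h3 : t.rhs (fun l n => (if l < 0 then t.deriv (-l - 1).toNat B else 0) n w)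
            (-N - 1) m 0 = if N = 0 then B m w else 0 := by
          rw [t.rhs_eq_range _ _ _ _ (N + 1) fun i hi => by
            funext n; rw [if_neg (by omega)]; rfl]
          rw [← Finset.Nat.sum_antidiagonal_eq_sum_range_succ_mk (n := N) (f := fun ij : ℕ × ℕ =>
            (bin (t.frac m) ij.1 : F) • (if (-N - 1 + ij.1 : ℤ) < 0 then
              t.deriv (-(-N - 1 + ij.1 : ℤ) - 1).toNat B else 0) (m + 0 - t.T * ij.1) w)]
          -- All terms are multiples of the same vector, with the coefficients of `(1 - 1)^N`, so
          -- only `N = 0` survives.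
          have h4 : ∀ ij ∈ antidiagonal N, (bin (t.frac m) ij.1 : F) •
              (if (-N - 1 + ij.1 : ℤ) < 0 then
              t.deriv (-(-N - 1 + ij.1 : ℤ) - 1).toNat B else 0) (m + 0 - t.T * ij.1) w
              = ((N.choose ij.1 : F) * (-1) ^ ij.2) • (bin (t.frac m) N : F) •
                B (m - t.T * N) w := by
            intro ij hij
            have h5 := mem_antidiagonal.1 hij
            have h6 := bin_mul_bin (F := F) (t.frac m) ij.1 ij.2
            rw [if_pos (by omega), show (-(-N - 1 + ij.1 : ℤ) - 1).toNat = ij.2 by omega, deriv,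
              LinearMap.smul_apply, frac_sub, add_zero, frac_T_mul, smul_smul, smul_smul,
              show m - (t.T : ℤ) * ij.1 - t.T * ij.2 = m - t.T * N by
                rw [← h5]; push_cast; ring]
            congr 1
            rw [h5] at h6
            push_cast
            linear_combination (-1) ^ ij.2 * h6
          rw [Finset.sum_congr rfl h4, ← Finset.sum_smul, sum_antidiagonal_choose_neg_one]
          split_ifs with h
          · simp [h]
          · simp
        rw [h3]
        by_cases hN : N = 0
        · subst hN
          rw [finsum_eq_single _ 0]
          · rw [zero_add, unit_T_mul]
            simp
          · intro i hi
            rw [zero_add, unit_T_mul, if_neg (by omega)]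
            simp
        · rw [if_neg hN, finsum_eq_zero_of_forall_eq_zero, smul_zero, neg_zero]
          intro i
          rw [zero_add, unit_T_mul, if_neg (by omega)]
          simp
    · refine ⟨0, fun l m w hm => ?_⟩
      rw [mul_zero, add_zero, br]
      have h1 : ∀ k, t.unit W (n + t.T * k) = 0 := fun k =>
        unit_apply_of_cls (by rwa [cls_add_T_mul])
      rw [altSum_eq_zero _ _ fun i => by rw [h1]; simp,
        altSum_eq_zero _ _ fun i => by rw [h1]; simp, smul_zero, sub_zero]
      symm
      refine finsum_eq_zero_of_forall_eq_zero fun i => ?_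
      dsimp only
      -- The exponent `m + n` is not in the class of `m`, since `cls n ≠ 1`, so `B` vanishes there.
      split_ifs
      · rw [deriv, hs]
        · simp
        · rw [cls_sub_T_mul, cls_sub_T_mul, cls_add, hm]
          intro h
          exact hn (mul_left_cancel₀ (hm ▸ Units.ne_zero _) (h.trans (mul_one c).symm))
      · simp

/-- Compatibility of the products with the rotation of the variable. -/
theorem Jac.rotate (r : ℤ) (h : t.Jac (t.cls r) ε A C D) :
    t.Jac (t.cls r) ε A (fun n => t.cls n • C n) (fun l n => t.cls (n - r) • D l n) where
  bound := by
    obtain ⟨N, hN⟩ := h.bound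
    exact ⟨N, fun l hl => by funext n; rw [hN l hl]; simp⟩
  field l w := by
    obtain ⟨N, hN⟩ := h.field l w
    refine ⟨N, fun n hn => ?_⟩
    have := hN n hn
    simp only at this
    simp [this]
  eq l m n w hm := by
    have h1 : t.br ε A (fun n => t.cls n • C n) l m n w
        = t.cls n • t.br ε A (fun n => C n) l m n w := by
      simp only [br, map_smul, Pi.smul_apply, cls_add_T_mul, altSum_smul]
      module
    refine h1.trans ?_
    rw [h.eq l m n w hm, rhs, smul_finsum, rhs]
    refine finsum_congr fun i => ?_
    have h2 : t.cls (m + n - t.T * i - r) = t.cls n := by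
      rw [show m + n - (t.T : ℤ) * i - r = m - r + n - t.T * i by ring, cls_sub_T_mul, cls_add,
        sub_eq_add_neg, cls_add, hm, ← cls_add]
      simp
    rw [h2, LinearMap.smul_apply, smul_comm]

/-- Products are determined by the fields, so a linear map intertwining the fields intertwines the
products: the difference is annihilated by the unipotent operator at one `m`. -/
theorem Jac.intertwine {W' : Type*} [AddCommGroup W'] [Module F W'] (g : W →ₗ[F] W')
    {A' C' : ℤ → Module.End F W'} {D' : ℤ → ℤ → Module.End F W'} (hc : ∃ m, t.cls m = c)
    (hA : IsField fun n => A n) (hC : IsField fun n => C n)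
    (h : t.Jac c ε A C D) (h' : t.Jac c ε A' C' D') (hgA : ∀ n w, g (A n w) = A' n (g w))
    (hgC : ∀ n w, g (C n w) = C' n (g w)) (l n : ℤ) (w : W) : g (D l n w) = D' l n (g w) := by
  obtain ⟨m, hm⟩ := hc
  obtain ⟨N, hN⟩ := h.bound
  obtain ⟨N', hN'⟩ := h'.bound
  have h1 := t.eq_zero_of_rhs (D := fun l n => g (D l n w) - D' l n (g w))
    ⟨max N N', fun l hl => by
      funext n
      rw [hN _ (le_of_max_le_left hl), hN' _ (le_of_max_le_right hl)]
      simp⟩ m l fun l _ n => by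
      have h2 := h.eq l m n w hm
      have h3 := h'.eq l m n (g w) hm
      rw [t.rhs_sub _ _ ⟨N, fun l hl => by funext n; rw [hN l hl]; simp⟩
        ⟨N', fun l hl => by funext n; rw [hN' l hl]; rfl⟩, ← h3, sub_eq_zero]
      have h4 : t.rhs (fun l n => g (D l n w)) l m n = g (t.rhs (fun l n => D l n w) l m n) := by
        rw [t.rhs_eq_range _ _ _ _ (N - l).toNat fun i hi => by
            funext n; rw [hN _ (by omega)]; simp,
          t.rhs_eq_range _ _ _ _ (N - l).toNat fun i hi => by
            funext n; rw [hN _ (by omega)]; rfl, map_sum]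
        simp only [map_smul]
      obtain ⟨M, hM⟩ := t.exists_bound hC n w
      obtain ⟨M', hM'⟩ := t.exists_bound hA m w
      rw [h4, ← h2, br, br, map_sub, map_smul,
        map_altSum g _ _ M fun i hi => by rw [hM i hi, map_zero],
        map_altSum g _ _ M' fun i hi => by rw [hM' i hi, map_zero]]
      simp only [hgA, hgC]
  exact sub_eq_zero.1 (congrFun (h1 l le_rfl) n)

end TwistDatum
end Unit
end SuperVA

namespace SuperVA

/-! ### Eigenspaces and the vacuum module -/

namespace TwistDatum

section Eigen

variable {p : ℕ} [Fact p.Prime] {F : Type*} [Field F] [CharP F p] (t : TwistDatum p F)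
  {V : Type*} [AddCommGroup V] [Module F V]

theorem T_ne_zero : (t.T : F) ≠ 0 := fun h => by
  have := congrArg (resHom p F) t.T_mul_θ
  rw [map_mul, map_natCast, h, zero_mul, map_one] at this
  exact zero_ne_one this

theorem cls_mul (r j : ℤ) : t.cls (r * j) = t.cls r ^ j := by
  simp [cls, zpow_mul]

theorem cls_pow_T (r : ℤ) : t.cls r ^ t.T = 1 := by
  have := t.cls_mul r t.T
  rw [mul_comm, cls_T_mul, zpow_natCast] at this
  exact this.symm

/-- The projection onto the eigenspace of `g` with eigenvalue `ηʳ`. -/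
noncomputable def eigenproj (g : V →ₗ[F] V) (r : ℤ) : V →ₗ[F] V :=
  (t.T : F)⁻¹ • ∑ j ∈ Finset.range t.T, (t.cls (-r)) ^ j • g ^ j

theorem eigenproj_apply (g : V →ₗ[F] V) (r : ℤ) (v : V) : t.eigenproj g r v
    = (t.T : F)⁻¹ • ∑ j ∈ Finset.range t.T, (t.cls (-r)) ^ j • (g ^ j) v := by
  simp [eigenproj, LinearMap.sum_apply]

theorem map_eigenproj {g : V →ₗ[F] V} (hg : g ^ t.T = 1) (r : ℤ) (v : V) :
    g (t.eigenproj g r v) = t.cls r • t.eigenproj g r v := by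
  have h1 : t.cls r * t.cls (-r) = 1 := by rw [← cls_add]; simp
  rw [eigenproj_apply, map_smul, map_sum, smul_comm (t.cls r)]
  congr 1
  have h2 : ∀ j : ℕ, g (t.cls (-r) ^ j • (g ^ j) v)
      = t.cls r • t.cls (-r) ^ (j + 1) • (g ^ (j + 1)) v := by
    intro j
    rw [map_smul, pow_succ' g, Module.End.mul_apply, smul_smul, pow_succ', ← mul_assoc, h1,
      one_mul]
  simp only [h2]
  rw [Finset.smul_sum]
  -- The sum over `0 ≤ j ≤ T` split off at either end; the terms `j = 0` and `j = T` agree because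
  -- `g ^ T = 1`.
  have h3 := Finset.sum_range_succ (fun j => t.cls r • t.cls (-r) ^ j • (g ^ j) v) t.T
  rw [Finset.sum_range_succ'] at h3
  rw [hg, cls_pow_T, pow_zero, pow_zero] at h3
  exact add_right_cancel h3

/-- Orthogonality: the coefficient of `gʲ` is `∑ η^(-rj)` over `r`, a vanishing geometric sum unless
`j = 0`, and `T` is invertible in `F`. -/
theorem sum_eigenproj (g : V →ₗ[F] V) (v : V) :
    ∑ r ∈ Finset.range t.T, t.eigenproj g r v = v := by
  simp only [eigenproj_apply]
  rw [← Finset.smul_sum, Finset.sum_comm, Finset.sum_eq_single 0]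
  · simp only [pow_zero, one_smul, Module.End.one_apply, Finset.sum_const, Finset.card_range]
    rw [← Nat.cast_smul_eq_nsmul F, smul_smul, inv_mul_cancel₀ t.T_ne_zero, one_smul]
  · intro j hj hj0
    rw [← Finset.sum_smul]
    have h1 : t.cls (-j) ≠ 1 := fun h => by
      obtain ⟨k, hk⟩ := t.exists_of_cls_eq (h.trans t.cls_zero.symm)
      have h2 := Finset.mem_range.1 hj
      have h3 : (t.T : ℤ) ∣ j := ⟨-k, by linear_combination -hk⟩
      exact hj0 (Nat.eq_zero_of_dvd_of_lt (by exact_mod_cast h3) h2)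
    have h2 : ∑ r ∈ Finset.range t.T, t.cls (-(r : ℤ)) ^ j = 0 := by
      have h3 := mul_geom_sum (t.cls (-j)) t.T
      rw [cls_pow_T, sub_self] at h3
      rw [← (mul_eq_zero.1 h3).resolve_left (sub_ne_zero.2 h1)]
      refine Finset.sum_congr rfl fun r _ => ?_
      rw [← zpow_natCast, ← zpow_natCast, ← cls_mul, ← cls_mul]
      congr 1; ring
    rw [h2, zero_smul]
  · intro h
    exact absurd (Finset.mem_range.2 t.T_pos) h

open Classical in
theorem eigenproj_eigen {g : V →ₗ[F] V} {r : ℤ} {v : V} (h : g v = t.cls r • v) (s : ℤ) :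
    t.eigenproj g s v = if t.cls s = t.cls r then v else 0 := by
  have h1 : ∀ j : ℕ, (g ^ j) v = t.cls r ^ j • v := by
    intro j
    induction j with
    | zero => simp
    | succ j ih => rw [pow_succ', Module.End.mul_apply, ih, map_smul, h, smul_smul, pow_succ]
  simp only [eigenproj_apply, h1, smul_smul, ← mul_pow, ← cls_add]
  rw [← Finset.sum_smul, smul_smul]
  split_ifs with hs
  · rw [cls_add, ← hs, ← cls_add]
    simp [inv_mul_cancel₀ t.T_ne_zero]
  · have h3 := mul_geom_sum (t.cls (-s + r)) t.T
    rw [cls_pow_T, sub_self] at h3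
    rw [(mul_eq_zero.1 h3).resolve_left (sub_ne_zero.2 fun h => hs ?_), mul_zero, zero_smul]
    calc t.cls s = t.cls s * t.cls (-s + r) := by rw [h, mul_one]
      _ = t.cls r := by rw [← cls_add]; congr 1; ring

theorem eigenproj_mem {g : V →ₗ[F] V} {N : Submodule F V} (hN : ∀ v ∈ N, g v ∈ N) (r : ℤ)
    {v : V} (hv : v ∈ N) : t.eigenproj g r v ∈ N := by
  rw [eigenproj_apply]
  refine N.smul_mem _ (N.sum_mem fun j hj => N.smul_mem _ ?_)
  clear hj
  induction j with
  | zero => simpa using hv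
  | succ j ih => rw [pow_succ', Module.End.mul_apply]; exact hN _ ih

variable (p F) in
/-- The trivial twist datum. -/
noncomputable def trivial : TwistDatum p F where
  T := 1
  η := 1
  θ := 1
  T_mul_θ := by simp
  primitive := IsPrimitiveRoot.one

@[simp] theorem trivial_cls (n : ℤ) : (trivial p F).cls n = 1 := by simp [cls, trivial]

@[simp] theorem trivial_frac (n : ℤ) : (trivial p F).frac n = n := by simp [frac, trivial]

@[simp] theorem trivial_T : (trivial p F).T = 1 := rfl

end Eigen
end TwistDatum

/-! ### Universal property of the enveloping algebra. -/

namespace LieSuperalgebra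

variable {F : Type*} {L : Type*} [Field F] [AddCommGroup L] [Module F L] (A : LieSuperalgebra F L)

theorem uea_induction {P : A.UEA → Prop} (h0 : ∀ c, P (algebraMap F A.UEA c))
    (h1 : ∀ x, P (A.ι x)) (h2 : ∀ u v, P u → P v → P (u * v)) (h3 : ∀ u v, P u → P v → P (u + v))
    (u : A.UEA) : P u := by
  obtain ⟨u, rfl⟩ := RingQuot.mkAlgHom_surjective F (UEARel A) u
  induction u using TensorAlgebra.induction with
  | algebraMap c => rw [AlgHom.commutes]; exact h0 c
  | ι x => exact h1 x
  | mul a b ha hb => rw [map_mul]; exact h2 _ _ ha hb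
  | add a b ha hb => rw [map_add]; exact h3 _ _ ha hb

/-- The algebra homomorphism from the enveloping algebra attached to a module. -/
noncomputable def ueaLift {M : Type*} [AddCommGroup M] [Module F M] (ρ : L →ₗ[F] Module.End F M)
    (h : A.IsModule ρ) : A.UEA →ₐ[F] Module.End F M :=
  RingQuot.liftAlgHom F ⟨TensorAlgebra.lift F ρ, by
    intro a b hab
    induction hab with
    | super_comm α β x y hx hy =>
      simp only [map_mul, map_add, map_smul, TensorAlgebra.lift_ι_apply, h α β x y hx hy]
      abel⟩

theorem ueaLift_ι {M : Type*} [AddCommGroup M] [Module F M] (ρ : L →ₗ[F] Module.End F M)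
    (h : A.IsModule ρ) (x : L) : A.ueaLift ρ h (A.ι x) = ρ x := by
  change RingQuot.liftAlgHom F _ (RingQuot.mkAlgHom F (UEARel A) (TensorAlgebra.ι F x)) = _
  rw [RingQuot.liftAlgHom_mkAlgHom_apply, TensorAlgebra.lift_ι_apply]

end LieSuperalgebra

/-! ### Modes and parity on the vacuum module. -/

namespace AffineDatum

variable {F : Type*} {𝔤 : Type*} [Field F] [AddCommGroup 𝔤] [Module F 𝔤] (D : AffineDatum F 𝔤)

theorem exists_parts (a : 𝔤) : ∃ a₀ ∈ D.part 0, ∃ a₁ ∈ D.part 1, a₀ + a₁ = a :=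
  ⟨_, Submodule.projection_apply_mem D.isCompl a, _,
    Submodule.projection_apply_mem D.isCompl.symm a, D.proj_add a⟩

theorem central_comm (u : D.affine.UEA) :
    D.affine.ι (central F 𝔤) * u = u * D.affine.ι (central F 𝔤) := by
  induction u using D.affine.uea_induction with
  | h0 c => exact (Algebra.commutes c _).symm
  | h1 x =>
    obtain ⟨y, hy, z, hz, rfl⟩ := Submodule.mem_sup.1
      ((codisjoint_iff.1 D.affine.isCompl.codisjoint).symm ▸ Submodule.mem_top :
        x ∈ D.affine.part 0 ⊔ D.affine.part 1)
    have key : ∀ α y, y ∈ D.affine.part α →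
        D.affine.ι (central F 𝔤) * D.affine.ι y = D.affine.ι y * D.affine.ι (central F 𝔤) := by
      intro α y hy
      rw [D.affine.ι_mul_ι (D.central_mem) hy,
        show D.affine.bracket (central F 𝔤) y = 0 from D.loopBracket_central_left 1 y, map_zero,
        add_zero]
      simp [sgn]
    rw [map_add, mul_add, add_mul, key _ _ hy, key _ _ hz]
  | h2 u v hu hv => rw [← mul_assoc, hu, mul_assoc, hv, mul_assoc]
  | h3 u v hu hv => rw [mul_add, add_mul, hu, hv]

variable (ℓ : F)

theorem smul_vac (u : D.affine.UEA) : u • D.vac ℓ = Submodule.Quotient.mk u := by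
  rw [vac, ← Submodule.Quotient.mk_smul, smul_eq_mul, mul_one]

theorem exists_smul_vac (v : D.Vac ℓ) : ∃ u : D.affine.UEA, u • D.vac ℓ = v := by
  obtain ⟨u, rfl⟩ := Submodule.Quotient.mk_surjective _ v
  exact ⟨u, D.smul_vac ℓ u⟩

theorem central_smul (v : D.Vac ℓ) : D.affine.ι (central F 𝔤) • v = ℓ • v := by
  obtain ⟨u, rfl⟩ := D.exists_smul_vac ℓ v
  rw [← mul_smul, central_comm, mul_smul]
  have h : D.affine.ι (central F 𝔤) • D.vac ℓ = ℓ • D.vac ℓ := by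
    rw [← algebraMap_smul D.affine.UEA ℓ (D.vac ℓ), smul_vac, smul_vac, Submodule.Quotient.eq]
    exact Submodule.subset_span (Or.inr rfl)
  rw [h, smul_comm]

/-- The operators `a ⊗ tⁿ` on the vacuum module. -/
noncomputable def vacMode : 𝔤 →ₗ[F] (ℤ → Module.End F (D.Vac ℓ)) where
  toFun a n := Algebra.lsmul F F (D.Vac ℓ) (D.affine.ι (elt F n a))
  map_add' a b := by
    funext n
    rw [elt_add, map_add, map_add]
    rfl
  map_smul' c a := by
    funext n
    rw [elt_smul, map_smul, map_smul]
    rfl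

theorem vacMode_apply (a : 𝔤) (n : ℤ) (v : D.Vac ℓ) :
    D.vacMode ℓ a n v = D.affine.ι (elt F n a) • v := rfl

theorem vacMode_comm {α β : ZMod 2} {a b : 𝔤} (ha : a ∈ D.part α) (hb : b ∈ D.part β) (m n : ℤ)
    (v : D.Vac ℓ) : D.vacMode ℓ a m (D.vacMode ℓ b n v)
      = sgn F α β • D.vacMode ℓ b n (D.vacMode ℓ a m v) + D.vacMode ℓ (D.bracket a b) (m + n) v
        + (ℓ * D.cocycle 1 m n a b) • v := by
  have h := D.affine.ι_mul_ι (D.elt_mem m ha) (D.elt_mem n hb)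
  have h2 : D.affine.bracket (elt F m a) (elt F n b) = _ := D.loopBracket_elt 1 m n a b
  rw [h2, map_add, map_smul] at h
  simp only [vacMode_apply]
  rw [← mul_smul, h, add_smul, add_smul, smul_assoc, mul_smul, smul_assoc, central_smul,
    mul_comm ℓ, mul_smul (D.cocycle 1 m n a b) ℓ, add_assoc]

theorem vacMode_vac (a : 𝔤) {n : ℤ} (hn : 0 ≤ n) : D.vacMode ℓ a n (D.vac ℓ) = 0 := by
  obtain ⟨n, rfl⟩ := Int.eq_ofNat_of_zero_le hn
  rw [vacMode_apply, smul_vac, Submodule.Quotient.mk_eq_zero]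
  exact Submodule.subset_span (Or.inl ⟨n, a, rfl⟩)

theorem vac_mem : D.vac ℓ ∈ D.vacPart ℓ 0 :=
  ⟨1, Submodule.subset_span ⟨[], by simp, by simp, by simp⟩, rfl⟩

theorem ι_smul_mem {α β : ZMod 2} {x : Loop F 𝔤} (hx : x ∈ D.affine.part α) {v : D.Vac ℓ}
    (hv : v ∈ D.vacPart ℓ β) : D.affine.ι x • v ∈ D.vacPart ℓ (α + β) := by
  obtain ⟨u, hu, rfl⟩ := hv
  refine ⟨D.affine.ι x * u, ?_, rfl⟩
  induction hu using Submodule.span_induction with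
  | mem u h =>
    obtain ⟨l, hl, hs, rfl⟩ := h
    refine Submodule.subset_span ⟨(α, x) :: l, ?_, by simp [hs], by simp⟩
    rintro y hy
    rcases List.mem_cons.1 hy with rfl | hy
    · exact hx
    · exact hl y hy
  | zero => rw [mul_zero]; exact Submodule.zero_mem _
  | add u v _ _ hu hv => rw [mul_add]; exact Submodule.add_mem _ hu hv
  | smul c u _ hu => rw [mul_smul_comm]; exact Submodule.smul_mem _ _ hu

theorem vacMode_mem {α β : ZMod 2} {a : 𝔤} (ha : a ∈ D.part α) (n : ℤ) {v : D.Vac ℓ}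
    (hv : v ∈ D.vacPart ℓ β) : D.vacMode ℓ a n v ∈ D.vacPart ℓ (α + β) :=
  D.ι_smul_mem ℓ (D.elt_mem n ha) hv

theorem state_mem {α : ZMod 2} {a : 𝔤} (ha : a ∈ D.part α) :
    D.state ℓ a ∈ D.vacPart ℓ α := by
  have := D.vacMode_mem ℓ ha (-1) (D.vac_mem ℓ)
  rwa [add_zero] at this

/-- The sum of the two parts contains `𝟏` and is stable under the enveloping algebra. Independence
of the parts is not available here, no basis being known; it comes later, in `vacPart_isCompl`. -/
theorem vacPart_sup (v : D.Vac ℓ) : ∃ v₀ ∈ D.vacPart ℓ 0, ∃ v₁ ∈ D.vacPart ℓ 1, v₀ + v₁ = v := by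
  rw [← Submodule.mem_sup]
  have h00 : (0 : ZMod 2) + 0 = 0 := rfl
  have h01 : (0 : ZMod 2) + 1 = 1 := rfl
  have h10 : (1 : ZMod 2) + 0 = 1 := rfl
  have h11 : (1 : ZMod 2) + 1 = 0 := rfl
  have key : ∀ u : D.affine.UEA, ∀ v ∈ D.vacPart ℓ 0 ⊔ D.vacPart ℓ 1,
      u • v ∈ D.vacPart ℓ 0 ⊔ D.vacPart ℓ 1 := by
    intro u
    induction u using D.affine.uea_induction with
    | h0 c => intro v hv; rw [algebraMap_smul]; exact Submodule.smul_mem _ _ hv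
    | h1 x =>
      intro v hv
      obtain ⟨y, hy, z, hz, rfl⟩ := Submodule.mem_sup.1
        ((codisjoint_iff.1 D.affine.isCompl.codisjoint).symm ▸ Submodule.mem_top :
          x ∈ D.affine.part 0 ⊔ D.affine.part 1)
      obtain ⟨v, hv', w, hw, rfl⟩ := Submodule.mem_sup.1 hv
      rw [map_add, add_smul, smul_add, smul_add]
      exact Submodule.add_mem _
        (Submodule.add_mem _ (Submodule.mem_sup_left (h00 ▸ D.ι_smul_mem ℓ hy hv'))
          (Submodule.mem_sup_right (h01 ▸ D.ι_smul_mem ℓ hy hw)))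
        (Submodule.add_mem _ (Submodule.mem_sup_right (h10 ▸ D.ι_smul_mem ℓ hz hv'))
          (Submodule.mem_sup_left (h11 ▸ D.ι_smul_mem ℓ hz hw)))
    | h2 u v hu hv => intro w hw; rw [mul_smul]; exact hu _ (hv _ hw)
    | h3 u v hu hv => intro w hw; rw [add_smul]; exact Submodule.add_mem _ (hu _ hw) (hv _ hw)
  obtain ⟨u, rfl⟩ := D.exists_smul_vac ℓ v
  exact key u _ (Submodule.mem_sup_left (D.vac_mem ℓ))

/-- Induction on vectors of the vacuum module of a given parity. -/
theorem vacPart_induction {Q : 𝔤 → Prop}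
    (hQ : ∀ α, ∀ a ∈ D.part α, a ∈ Submodule.span F {b | b ∈ D.part α ∧ Q b})
    {P : ZMod 2 → D.Vac ℓ → Prop} (vac : P 0 (D.vac ℓ)) (zero : ∀ β, P β 0)
    (add : ∀ β v w, P β v → P β w → P β (v + w)) (smul : ∀ β (c : F) v, P β v → P β (c • v))
    (mode : ∀ α β a n v, a ∈ D.part α → Q a → v ∈ D.vacPart ℓ β → P β v →
      P (α + β) (D.vacMode ℓ a n v)) {β : ZMod 2} {v : D.Vac ℓ} (hv : v ∈ D.vacPart ℓ β) :
    P β v := by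
  have hmode : ∀ α β, ∀ a ∈ D.part α, ∀ n, ∀ v ∈ D.vacPart ℓ β, P β v →
      P (α + β) (D.vacMode ℓ a n v) := by
    intro α β a ha n v hv h
    refine Submodule.span_induction (p := fun a _ => P (α + β) (D.vacMode ℓ a n v))
      (fun a ha => mode _ _ _ _ _ ha.1 ha.2 hv h) ?_ ?_ ?_ (hQ α a ha)
    · rw [map_zero]; exact zero _
    · intro a b _ _ ha hb
      rw [map_add]; exact add _ _ _ ha hb
    · intro c a _ ha
      rw [map_smul]; exact smul _ _ _ ha
  have hι : ∀ α β, ∀ x ∈ D.affine.part α, ∀ v ∈ D.vacPart ℓ β, P β v →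
      P (α + β) (D.affine.ι x • v) := by
    intro α β x hx v hv h
    refine Submodule.span_induction (p := fun x _ => P (α + β) (D.affine.ι x • v))
      ?_ ?_ ?_ ?_ (D.loopPart_le α hx)
    · rintro x (⟨n, a, ha, rfl⟩ | ⟨rfl, rfl⟩)
      · exact hmode α β a ha n v hv h
      · rw [central_smul, zero_add]
        exact smul _ _ _ h
    · rw [map_zero, zero_smul]; exact zero _
    · intro a b _ _ ha hb
      rw [map_add, add_smul]; exact add _ _ _ ha hb
    · intro c a _ ha
      rw [map_smul, smul_assoc]; exact smul _ _ _ ha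
  obtain ⟨u, hu, rfl⟩ := hv
  refine Submodule.span_induction (p := fun u _ => P β (Submodule.Quotient.mk u)) ?_ ?_ ?_ ?_ hu
  · rintro u ⟨l, hl, rfl, rfl⟩
    rw [← smul_vac]
    -- Membership in the graded part is carried along, because the induction step for a generator
    -- asks for it.
    suffices h : (l.map fun x => D.affine.ι x.2).prod • D.vac ℓ
        ∈ D.vacPart ℓ (l.map Prod.fst).sum ∧ P (l.map Prod.fst).sum
          ((l.map fun x => D.affine.ι x.2).prod • D.vac ℓ) from h.2
    clear hu
    induction l with
    | nil => simpa using ⟨D.vac_mem ℓ, vac⟩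
    | cons x l ih =>
      obtain ⟨h1, h2⟩ := ih fun y hy => hl y (List.mem_cons_of_mem _ hy)
      have h3 := hl x List.mem_cons_self
      simp only [List.map_cons, List.sum_cons, List.prod_cons, mul_smul]
      exact ⟨D.ι_smul_mem ℓ h3 h1, hι _ _ _ h3 _ h1 h2⟩
  · exact zero _
  · intro u v _ _ hu hv
    exact add _ _ _ hu hv
  · intro c u _ hu
    exact smul _ c _ hu

end AffineDatum
end SuperVA

namespace SuperVA

/-! ### Representations and the Jacobi identity on the vacuum module -/

open Finset.HasAntidiagonal (antidiagonal mem_antidiagonal)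

section Sign

variable (F : Type*) [Field F] (α β γ : ZMod 2)

@[simp] theorem sgn_zero_left : sgn F 0 β = 1 := by simp [sgn]

@[simp] theorem sgn_zero_right : sgn F α 0 = 1 := by simp [sgn]

theorem sgn_comm : sgn F α β = sgn F β α := by rw [sgn, sgn, mul_comm]

theorem sgn_mul_self : sgn F α β * sgn F α β = 1 := by
  rw [sgn, ← mul_pow, neg_one_mul, neg_neg, one_pow]

theorem sgn_add_right : sgn F α (β + γ) = sgn F α β * sgn F α γ := by
  rcases AffineDatum.zmod_two α with rfl | rfl <;> rcases AffineDatum.zmod_two β with rfl | rfl <;>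
    rcases AffineDatum.zmod_two γ with rfl | rfl <;>
    simp [AffineDatum.sgn_11, show (1 : ZMod 2) + 1 = 0 from rfl]

theorem sgn_add_left : sgn F (α + β) γ = sgn F α γ * sgn F β γ := by
  rw [sgn_comm, sgn_add_right, sgn_comm F γ, sgn_comm F γ]

end Sign

namespace TwistDatum

variable {p : ℕ} [Fact p.Prime] {F : Type*} [Field F] [CharP F p] (t : TwistDatum p F)
  {W : Type*} [AddCommGroup W] [Module F W]

theorem altSum_zero_left (f : ℕ → W) : altSum p F 0 f = f 0 := by
  rw [altSum, finsum_eq_single _ 0]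
  · simp
  · intro i hi
    rw [Int.cast_zero, bin_zero_left, if_neg hi]
    simp

theorem br_zero_fst (ε : F) (A : ℤ → Module.End F W) (C : ℤ → W → W) (m n : ℤ) (w : W) :
    t.br ε A C 0 m n w = A m (C n w) - ε • C n (A m w) := by
  rw [br, altSum_zero_left, altSum_zero_left]
  simp

theorem rhs_zero_snd (D : ℤ → ℤ → W) (l n : ℤ) : t.rhs D l 0 n = D l n := by
  rw [rhs, finsum_eq_single _ 0]
  · simp
  · intro i hi
    rw [frac_zero, bin_zero_left, if_neg hi, zero_smul]

end TwistDatum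

/-! ### Generating fields and the maps they induce on the vacuum module. -/

namespace AffineDatum

variable {p : ℕ} [Fact p.Prime] {F : Type*} [Field F] [CharP F p] {t : TwistDatum p F}
  {𝔤 : Type*} [AddCommGroup 𝔤] [Module F 𝔤] {D : AffineDatum F 𝔤} {τ : D.Aut} {ℓ : F}
  {W : Type*} [AddCommGroup W] [Module F W]

variable (D) in
/-- The identity automorphism. -/
def Aut.refl : D.Aut where
  toEquiv := LinearEquiv.refl F 𝔤
  map_part _ _ h := h
  map_bracket _ _ := rfl
  map_form _ _ := rfl

theorem Aut.onVac_smul_vac (u : D.affine.UEA) :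
    τ.onVac ℓ (u • D.vac ℓ) = τ.affineUEA u • D.vac ℓ := by
  rw [smul_vac, smul_vac]
  rfl

theorem Aut.onVac_smul (u : D.affine.UEA) (v : D.Vac ℓ) :
    τ.onVac ℓ (u • v) = τ.affineUEA u • τ.onVac ℓ v := by
  obtain ⟨u', rfl⟩ := D.exists_smul_vac ℓ v
  rw [← mul_smul, onVac_smul_vac, onVac_smul_vac, map_mul, mul_smul]

@[simp] theorem Aut.onVac_vac : τ.onVac ℓ (D.vac ℓ) = D.vac ℓ := by
  have := τ.onVac_smul_vac (ℓ := ℓ) 1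
  rwa [map_one, one_smul] at this

theorem Aut.onVac_mode (a : 𝔤) (n : ℤ) (v : D.Vac ℓ) :
    τ.onVac ℓ (D.vacMode ℓ a n v) = D.vacMode ℓ (τ.toEquiv a) n (τ.onVac ℓ v) := by
  rw [vacMode_apply, onVac_smul, vacMode_apply, Aut.affineUEA, LieSuperalgebra.ueaMap_ι,
    affineMap_elt]

theorem Aut.toLinearMap_pow (hτ : τ.toEquiv ^ t.T = 1) : τ.toEquiv.toLinearMap ^ t.T = 1 := by
  have := congrArg (fun e : 𝔤 ≃ₗ[F] 𝔤 => e.toLinearMap) hτ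
  refine Eq.trans ?_ this
  exact (map_pow (LinearEquiv.automorphismGroup.toLinearMapMonoidHom (R := F) (M := 𝔤))
    τ.toEquiv t.T).symm

/-- The eigenprojections are polynomials in `τ`, hence preserve parity. This lets inductions over
the vacuum module use only homogeneous eigenvectors. -/
theorem Aut.mem_span_eigen (hτ : τ.toEquiv ^ t.T = 1) (α : ZMod 2) (a : 𝔤) (ha : a ∈ D.part α) :
    a ∈ Submodule.span F {b | b ∈ D.part α ∧ ∃ r : ℤ, τ.toEquiv b = t.cls r • b} := by
  rw [← t.sum_eigenproj τ.toEquiv.toLinearMap a]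
  exact Submodule.sum_mem _ fun r _ => Submodule.subset_span
    ⟨t.eigenproj_mem (τ.map_part α) r ha, r, t.map_eigenproj (τ.toLinearMap_pow hτ) r a⟩

theorem vac_ext {f g : D.Vac ℓ →ₗ[F] W} (h : ∀ α, ∀ v ∈ D.vacPart ℓ α, f v = g v) : f = g := by
  refine LinearMap.ext fun v => ?_
  obtain ⟨v₀, h0, v₁, h1, rfl⟩ := D.vacPart_sup ℓ v
  rw [map_add, map_add, h 0 _ h0, h 1 _ h1]

theorem Aut.onVac_mem {β : ZMod 2} {v : D.Vac ℓ} (hv : v ∈ D.vacPart ℓ β) :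
    τ.onVac ℓ v ∈ D.vacPart ℓ β := by
  refine D.vacPart_induction ℓ (Q := fun _ => True)
    (P := fun β v => τ.onVac ℓ v ∈ D.vacPart ℓ β)
    (fun α a ha => Submodule.subset_span ⟨ha, trivial⟩) ?_ ?_ ?_ ?_ ?_ hv
  · rw [onVac_vac]; exact D.vac_mem ℓ
  · intro β; rw [map_zero]; exact Submodule.zero_mem _
  · intro β v w hv hw; rw [map_add]; exact Submodule.add_mem _ hv hw
  · intro β c v hv; rw [map_smul]; exact Submodule.smul_mem _ _ hv
  · intro α β a n v ha _ _ hv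
    rw [onVac_mode]
    exact D.vacMode_mem ℓ (τ.map_part α a ha) n hv

/-- The fields `∑ A a n z^{-n/T-1}` generate a locally truncated representation of level `ℓ` of the
twisted affine Lie superalgebra. -/
structure IsAffineRep (t : TwistDatum p F) (τ : D.Aut) (ℓ : F)
    (A : 𝔤 →ₗ[F] (ℤ → Module.End F W)) : Prop where
  field : ∀ a, IsField fun n => A a n
  support : ∀ (r : ℤ) (a : 𝔤), τ.toEquiv a = t.cls r • a → ∀ n, t.cls n ≠ t.cls r → A a n = 0
  comm : ∀ {α β : ZMod 2} {r s : ℤ} {a b : 𝔤}, a ∈ D.part α → b ∈ D.part β →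
    τ.toEquiv a = t.cls r • a → τ.toEquiv b = t.cls s • b → ∀ m n : ℤ, t.cls m = t.cls r →
    t.cls n = t.cls s → ∀ w, A a m (A b n w) - sgn F α β • A b n (A a m w)
      = A (D.bracket a b) (m + n) w + (ℓ * D.cocycle t.T m n a b) • w

/-- The map `Y` from the vacuum module to fields satisfies the twisted Jacobi identity whenever the
left entry is a generator. -/
structure IsVacRep (t : TwistDatum p F) (τ : D.Aut) (ℓ : F)
    (A : 𝔤 →ₗ[F] (ℤ → Module.End F W)) (Y : D.Vac ℓ →ₗ[F] (ℤ → Module.End F W)) : Prop where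
  field : ∀ v, IsField fun n => Y v n
  vacuum : Y (D.vac ℓ) = t.unit W
  jac : ∀ {r : ℤ} {α β : ZMod 2} {a : 𝔤} {v : D.Vac ℓ}, a ∈ D.part α →
    τ.toEquiv a = t.cls r • a → v ∈ D.vacPart ℓ β →
    t.Jac (t.cls r) (sgn F α β) (A a) (Y v) (fun l => Y (D.vacMode ℓ a l v))

variable {A : 𝔤 →ₗ[F] (ℤ → Module.End F W)} {Y Y' : D.Vac ℓ →ₗ[F] (ℤ → Module.End F W)}

/-- `V` is generated from `𝟏`, and `Y(a_n v)` is a product of `A a` with `Y v`, hence determined by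
`Y v`. -/
theorem IsVacRep.unique (hτ : τ.toEquiv ^ t.T = 1) (hY : IsVacRep t τ ℓ A Y)
    (hY' : IsVacRep t τ ℓ A Y') : Y = Y' := by
  refine vac_ext fun β v hv => ?_
  refine D.vacPart_induction ℓ (τ.mem_span_eigen hτ) (P := fun _ v => Y v = Y' v)
    ?_ ?_ ?_ ?_ ?_ hv
  · rw [hY.vacuum, hY'.vacuum]
  · intro β; rw [map_zero, map_zero]
  · intro β v w hv hw; rw [map_add, map_add, hv, hw]
  · intro β c v hv; rw [map_smul, map_smul, hv]
  · rintro α β a n v ha ⟨r, hr⟩ hv h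
    have h1 := hY.jac ha hr hv
    have h2 := hY'.jac ha hr hv
    rw [← h] at h2
    exact congrFun (h1.unique ⟨r, rfl⟩ h2) n

/-- Rotating the variable multiplies the coefficient at `n/T` by `ηⁿ` and is compatible with
products (`Jac.rotate`), so the relation spreads from the vacuum. It yields the exponents allowed
for an eigenvector of `τ`. -/
theorem IsVacRep.rotate (hτ : τ.toEquiv ^ t.T = 1) (hY : IsVacRep t τ ℓ A Y) (v : D.Vac ℓ)
    (n : ℤ) : Y (τ.onVac ℓ v) n = t.cls n • Y v n := by
  suffices h : ∀ β, ∀ v ∈ D.vacPart ℓ β, ∀ n, Y (τ.onVac ℓ v) n = t.cls n • Y v n by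
    obtain ⟨v₀, h0, v₁, h1, rfl⟩ := D.vacPart_sup ℓ v
    simp only [map_add, Pi.add_apply, h 0 _ h0, h 1 _ h1, smul_add]
  intro β v hv
  refine D.vacPart_induction ℓ (τ.mem_span_eigen hτ)
    (P := fun _ v => ∀ n, Y (τ.onVac ℓ v) n = t.cls n • Y v n) ?_ ?_ ?_ ?_ ?_ hv
  · intro n
    rw [Aut.onVac_vac, hY.vacuum]
    by_cases h : t.cls n = 1
    · rw [h, one_smul]
    · rw [TwistDatum.unit_apply_of_cls h, smul_zero]
  · intro β n; simp
  · intro β v w hv hw n; simp only [map_add, Pi.add_apply, hv, hw, smul_add]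
  · intro β c v hv n; simp only [map_smul, Pi.smul_apply, hv, smul_comm c]
  · rintro α β a l v ha ⟨r, hr⟩ hv h n
    have h1 := (hY.jac ha hr hv).rotate r
    have h2 := hY.jac ha hr (τ.onVac_mem hv)
    rw [show Y (τ.onVac ℓ v) = fun n => t.cls n • Y v n from funext h] at h2
    have h3 := congrFun (congrFun (h2.unique ⟨r, rfl⟩ h1) l) n
    rw [Aut.onVac_mode, hr, map_smul]
    simp only [Pi.smul_apply, LinearMap.smul_apply, map_smul]
    rw [h3, smul_smul, ← t.cls_add]
    congr 2; ring

theorem IsVacRep.eq_zero_of_cls (hτ : τ.toEquiv ^ t.T = 1) (hY : IsVacRep t τ ℓ A Y)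
    {v : D.Vac ℓ} {r n : ℤ} (hv : τ.onVac ℓ v = t.cls r • v) (hn : t.cls n ≠ t.cls r) :
    Y v n = 0 := by
  have h := hY.rotate hτ v n
  rw [hv, map_smul, Pi.smul_apply, eq_comm, ← sub_eq_zero, ← sub_smul] at h
  exact (smul_eq_zero.1 h).resolve_left (sub_ne_zero.2 hn)

/-- By `Jac.one_right` the product of `A a` with the identity field at index `-1` is the zeroth
derivative, that is, `A a` itself. -/
theorem IsVacRep.state (hτ : τ.toEquiv ^ t.T = 1) (hA : IsAffineRep t τ ℓ A)
    (hY : IsVacRep t τ ℓ A Y) (a : 𝔤) : Y (D.vacMode ℓ a (-1) (D.vac ℓ)) = A a := by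
  suffices h : ∀ α, ∀ a ∈ D.part α, Y (D.vacMode ℓ a (-1) (D.vac ℓ)) = A a by
    obtain ⟨a₀, h0, a₁, h1, rfl⟩ := D.exists_parts a
    simp only [map_add, Pi.add_apply, LinearMap.add_apply, h 0 _ h0, h 1 _ h1]
  intro α a ha
  have hs := τ.mem_span_eigen hτ α a ha
  clear ha
  induction hs using Submodule.span_induction with
  | mem a h =>
    obtain ⟨ha, r, hr⟩ := h
    have h1 := hY.jac ha hr (D.vac_mem ℓ)
    rw [hY.vacuum, sgn_zero_right] at h1
    have h2 := TwistDatum.Jac.one_right (hA.field a) (hA.support r a hr)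
    have h3 := congrFun (h1.unique ⟨r, rfl⟩ h2) (-1)
    simpa using h3
  | zero => simp
  | add a b _ _ ha hb => simp only [map_add, Pi.add_apply, LinearMap.add_apply, *]
  | smul c a _ ha => simp only [map_smul, Pi.smul_apply, LinearMap.smul_apply, *]

theorem vacMode_isField (a : 𝔤) : IsField fun n => D.vacMode ℓ a n := by
  suffices h : ∀ β, ∀ v ∈ D.vacPart ℓ β, ∀ α, ∀ a ∈ D.part α,
      ∃ N : ℤ, ∀ n ≥ N, D.vacMode ℓ a n v = 0 by
    intro v
    have key : ∀ β, ∀ v ∈ D.vacPart ℓ β, ∃ N : ℤ, ∀ n ≥ N, D.vacMode ℓ a n v = 0 := by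
      intro β v hv
      obtain ⟨a₀, h0, a₁, h1, rfl⟩ := D.exists_parts a
      obtain ⟨N, hN⟩ := h β v hv 0 a₀ h0
      obtain ⟨M, hM⟩ := h β v hv 1 a₁ h1
      exact ⟨max N M, fun n hn => by
        rw [map_add, Pi.add_apply, LinearMap.add_apply, hN _ (le_of_max_le_left hn),
          hM _ (le_of_max_le_right hn), add_zero]⟩
    obtain ⟨v₀, h0, v₁, h1, rfl⟩ := D.vacPart_sup ℓ v
    obtain ⟨N, hN⟩ := key 0 v₀ h0
    obtain ⟨M, hM⟩ := key 1 v₁ h1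
    exact ⟨max N M, fun n hn => by
      simp only [map_add, hN _ (le_of_max_le_left hn),
        hM _ (le_of_max_le_right hn), add_zero]⟩
  intro β v hv
  refine D.vacPart_induction ℓ (Q := fun _ => True)
    (P := fun _ v => ∀ α, ∀ a ∈ D.part α, ∃ N : ℤ, ∀ n ≥ N, D.vacMode ℓ a n v = 0)
    (fun α a ha => Submodule.subset_span ⟨ha, trivial⟩) ?_ ?_ ?_ ?_ ?_ hv
  · exact fun α a _ => ⟨0, fun n hn => D.vacMode_vac ℓ a hn⟩
  · exact fun β α a _ => ⟨0, fun n hn => map_zero _⟩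
  · intro β v w hv hw α a ha
    obtain ⟨N, hN⟩ := hv α a ha
    obtain ⟨M, hM⟩ := hw α a ha
    exact ⟨max N M, fun n hn => by
      rw [map_add, hN _ (le_of_max_le_left hn), hM _ (le_of_max_le_right hn), add_zero]⟩
  · intro β c v hv α a ha
    obtain ⟨N, hN⟩ := hv α a ha
    exact ⟨N, fun n hn => by rw [map_smul, hN _ hn, smul_zero]⟩
  · intro γ β b k v hb _ _ hv α a ha
    obtain ⟨N, hN⟩ := hv α a ha
    obtain ⟨M, hM⟩ := hv _ _ (D.bracket_mem ha hb)
    -- The mode of the bracket has index `n + k`, whence `M - k`; the term `|k| + 2` avoids both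
    -- central contributions, at `n + k = 0` and at `n + k + 1 = 0`.
    refine ⟨max N (max (M - k) (|k| + 2)), fun n hn => ?_⟩
    have h1 := le_of_max_le_right (le_of_max_le_right hn)
    have h2 := le_of_max_le_left (le_of_max_le_right hn)
    have h3 := neg_abs_le k
    rw [D.vacMode_comm ℓ ha hb, hN _ (le_of_max_le_left hn), hM _ (by omega), cocycle_apply,
      if_neg (by omega), if_neg (by push_cast; omega)]
    simp

theorem isAffineRep_vacMode :
    IsAffineRep (TwistDatum.trivial p F) (Aut.refl D) ℓ (D.vacMode ℓ) where
  field := vacMode_isField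
  support _ _ _ n hn := absurd (by simp) hn
  comm ha hb _ _ m n _ _ w := by
    rw [D.vacMode_comm ℓ ha hb, TwistDatum.trivial_T]
    abel

end AffineDatum
end SuperVA

namespace SuperVA

/-! ### Maps from the vacuum module to its own fields -/

open Finset.HasAntidiagonal (antidiagonal mem_antidiagonal)

namespace AffineDatum

variable {p : ℕ} [Fact p.Prime] {F : Type*} [Field F] [CharP F p] {t : TwistDatum p F}
  {𝔤 : Type*} [AddCommGroup 𝔤] [Module F 𝔤] {D : AffineDatum F 𝔤} {τ : D.Aut} {ℓ : F}
  {W : Type*} [AddCommGroup W] [Module F W]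
  {A : 𝔤 →ₗ[F] (ℤ → Module.End F W)} {Y : D.Vac ℓ →ₗ[F] (ℤ → Module.End F W)}
  {Z : D.Vac ℓ →ₗ[F] (ℤ → Module.End F (D.Vac ℓ))}

/-- The map from the vacuum module to fields on itself given by its module structure. -/
abbrev IsRegular (Z : D.Vac ℓ →ₗ[F] (ℤ → Module.End F (D.Vac ℓ))) (p : ℕ) [Fact p.Prime]
    [CharP F p] : Prop :=
  IsVacRep (TwistDatum.trivial p F) (Aut.refl D) ℓ (D.vacMode ℓ) Z

theorem IsRegular.jac (hZ : IsRegular Z p) {α β : ZMod 2} {a : 𝔤} {v : D.Vac ℓ}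
    (ha : a ∈ D.part α) (hv : v ∈ D.vacPart ℓ β) : (TwistDatum.trivial p F).Jac 1 (sgn F α β)
      (D.vacMode ℓ a) (Z v) (fun l => Z (D.vacMode ℓ a l v)) := by
  have := IsVacRep.jac hZ (r := 0) ha (by simp [Aut.refl]) hv
  simpa using this

/-- Induction on `u`: the automorphism permutes the generating modes, and `Jac.intertwine` passes
this on to products. -/
theorem IsRegular.map (hZ : IsRegular Z p) (σ : D.Aut) (u v : D.Vac ℓ) (n : ℤ) :
    σ.onVac ℓ (Z u n v) = Z (σ.onVac ℓ u) n (σ.onVac ℓ v) := by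
  suffices h : ∀ β, ∀ u ∈ D.vacPart ℓ β, ∀ n v,
      σ.onVac ℓ (Z u n v) = Z (σ.onVac ℓ u) n (σ.onVac ℓ v) by
    obtain ⟨u₀, h0, u₁, h1, rfl⟩ := D.vacPart_sup ℓ u
    simp only [map_add, Pi.add_apply, LinearMap.add_apply, h 0 _ h0, h 1 _ h1]
  intro β u hu
  refine D.vacPart_induction ℓ (Q := fun _ => True)
    (P := fun _ u => ∀ n v, σ.onVac ℓ (Z u n v) = Z (σ.onVac ℓ u) n (σ.onVac ℓ v))
    (fun α a ha => Submodule.subset_span ⟨ha, trivial⟩) ?_ ?_ ?_ ?_ ?_ hu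
  · intro n v
    rw [Aut.onVac_vac, hZ.vacuum, TwistDatum.unit]
    split_ifs <;> simp
  · intro β n v; simp
  · intro β v w hv hw n x
    simp only [map_add, Pi.add_apply, LinearMap.add_apply, hv, hw]
  · intro β c v hv n x
    simp only [map_smul, Pi.smul_apply, LinearMap.smul_apply, hv]
  · intro α β a l u ha _ hu h n v
    rw [Aut.onVac_mode]
    exact (hZ.jac ha hu).intertwine (σ.onVac ℓ) ⟨0, by simp⟩ (vacMode_isField a) (hZ.field u)
      (hZ.jac (σ.map_part α a ha) (σ.onVac_mem hu)) (fun n w => σ.onVac_mode a n w) h l n v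

/-- The parity involution. -/
noncomputable def parityAut (D : AffineDatum F 𝔤) : D.Aut where
  toEquiv := LinearEquiv.ofInvolutive (D.proj0 - D.proj1) fun x => by
    obtain ⟨x₀, h0, x₁, h1, rfl⟩ := D.exists_parts x
    simp [D.proj_even h0, D.proj_odd h1]
  map_part α x hx := by
    change D.proj0 x - D.proj1 x ∈ _
    rcases zmod_two α with rfl | rfl
    · rw [(D.proj_even hx).1, (D.proj_even hx).2, sub_zero]; exact hx
    · rw [(D.proj_odd hx).1, (D.proj_odd hx).2, zero_sub]; exact Submodule.neg_mem _ hx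
  map_bracket x y := by
    change D.proj0 (D.bracket x y) - D.proj1 (D.bracket x y)
      = D.bracket (D.proj0 x - D.proj1 x) (D.proj0 y - D.proj1 y)
    obtain ⟨x₀, h0, x₁, h1, rfl⟩ := D.exists_parts x
    obtain ⟨y₀, k0, y₁, k1, rfl⟩ := D.exists_parts y
    have e1 := D.bracket_mem h0 k0
    have e2 := D.bracket_mem h0 k1
    have e3 := D.bracket_mem h1 k0
    rw [zero_add] at e1 e2
    rw [add_zero] at e3
    simp only [map_add, LinearMap.add_apply, D.odd_bracket h1 k1, D.proj_even h0, D.proj_odd h1,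
      D.proj_even k0, D.proj_odd k1, D.proj_even e1, D.proj_odd e2, D.proj_odd e3, map_sub,
      LinearMap.sub_apply, add_zero, zero_add]
    abel
  map_form x y := by
    change D.form (D.proj0 x - D.proj1 x) (D.proj0 y - D.proj1 y) = _
    obtain ⟨x₀, h0, x₁, h1, rfl⟩ := D.exists_parts x
    obtain ⟨y₀, k0, y₁, k1, rfl⟩ := D.exists_parts y
    simp only [map_add, LinearMap.add_apply, D.proj_even h0, D.proj_odd h1,
      D.proj_even k0, D.proj_odd k1, map_sub, LinearMap.sub_apply, add_zero, zero_add,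
      D.form_even_odd h0 k1, D.form_symm x₁, D.form_even_odd k0 h1]
    ring

theorem parityAut_apply {α : ZMod 2} {a : 𝔤} (ha : a ∈ D.part α) :
    D.parityAut.toEquiv a = ((-1 : F) ^ α.val) • a := by
  change D.proj0 a - D.proj1 a = _
  rcases zmod_two α with rfl | rfl
  · simp [D.proj_even ha]
  · simp [D.proj_odd ha, ZMod.val_one]

theorem neg_one_pow_val_add (α β : ZMod 2) :
    (-1 : F) ^ (α + β).val = (-1) ^ α.val * (-1) ^ β.val := by
  rcases zmod_two α with rfl | rfl <;> rcases zmod_two β with rfl | rfl <;>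
    simp [ZMod.val_one, show (1 : ZMod 2) + 1 = 0 from rfl]

theorem parityAut_onVac {β : ZMod 2} {v : D.Vac ℓ} (hv : v ∈ D.vacPart ℓ β) :
    D.parityAut.onVac ℓ v = ((-1 : F) ^ β.val) • v := by
  refine D.vacPart_induction ℓ (Q := fun _ => True)
    (P := fun β v => D.parityAut.onVac ℓ v = ((-1 : F) ^ β.val) • v)
    (fun α a ha => Submodule.subset_span ⟨ha, trivial⟩) ?_ ?_ ?_ ?_ ?_ hv
  · simp
  · simp
  · intro β v w hv hw; rw [map_add, hv, hw, smul_add]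
  · intro β c v hv; rw [map_smul, hv, smul_comm]
  · intro α β a n v ha _ _ hv
    rw [Aut.onVac_mode, hv, parityAut_apply ha, neg_one_pow_val_add]
    simp [smul_smul, mul_comm]

theorem two_ne_zero_of_lt (hp : 2 < p) : (2 : F) ≠ 0 := by
  intro h
  have h1 : ((2 : ℕ) : F) = 0 := by exact_mod_cast h
  exact absurd (Nat.le_of_dvd (by norm_num) ((CharP.cast_eq_zero_iff F p 2).1 h1)) (by omega)

/-- As `2 ≠ 0` in `F`, the parts are exactly the `±1`-eigenspaces of the parity involution, whose
existence needs no knowledge of the size of `V`. -/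
theorem mem_vacPart_iff (hp : 2 < p) {β : ZMod 2} {v : D.Vac ℓ} :
    v ∈ D.vacPart ℓ β ↔ D.parityAut.onVac ℓ v = ((-1 : F) ^ β.val) • v := by
  refine ⟨parityAut_onVac, fun h => ?_⟩
  obtain ⟨v₀, h0, v₁, h1, rfl⟩ := D.vacPart_sup ℓ v
  rw [map_add, parityAut_onVac h0, parityAut_onVac h1] at h
  rcases zmod_two β with rfl | rfl
  · simp only [ZMod.val_zero, ZMod.val_one, pow_zero, pow_one, one_smul, neg_smul] at h
    have h2 : (2 : F) • v₁ = 0 := by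
      rw [two_smul]
      linear_combination (norm := module) (-1 : F) • h
    rw [(smul_eq_zero.1 h2).resolve_left (two_ne_zero_of_lt hp), add_zero]
    exact h0
  · simp only [ZMod.val_zero, ZMod.val_one, pow_zero, pow_one, one_smul, neg_smul] at h
    have h2 : (2 : F) • v₀ = 0 := by
      rw [two_smul]
      linear_combination (norm := module) (1 : F) • h
    rw [(smul_eq_zero.1 h2).resolve_left (two_ne_zero_of_lt hp), zero_add]
    exact h1

theorem vacPart_isCompl (hp : 2 < p) : IsCompl (D.vacPart ℓ 0) (D.vacPart ℓ 1) := by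
  constructor
  · rw [Submodule.disjoint_def]
    intro v h0 h1
    have h := (parityAut_onVac h0).symm.trans (parityAut_onVac h1)
    simp only [ZMod.val_zero, ZMod.val_one, pow_zero, pow_one, one_smul, neg_smul] at h
    have h2 : (2 : F) • v = 0 := by
      rw [two_smul]
      linear_combination (norm := module) (1 : F) • h
    exact (smul_eq_zero.1 h2).resolve_left (two_ne_zero_of_lt hp)
  · rw [codisjoint_iff, eq_top_iff]
    rintro v -
    exact Submodule.mem_sup.2 (D.vacPart_sup ℓ v)

/-- The parity involution acts compatibly with all `u_n v`, so parities add. -/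
theorem IsRegular.mem (hp : 2 < p) (hZ : IsRegular Z p) {α β : ZMod 2} {u v : D.Vac ℓ}
    (hu : u ∈ D.vacPart ℓ α) (hv : v ∈ D.vacPart ℓ β) (n : ℤ) :
    Z u n v ∈ D.vacPart ℓ (α + β) := by
  rw [mem_vacPart_iff hp, hZ.map, parityAut_onVac hu, parityAut_onVac hv, neg_one_pow_val_add]
  simp [smul_smul, mul_comm]

/-- In the slice `m = 0`, applied to `𝟏`, the second half of the bracket vanishes because `a_i 𝟏 =
0` for `i ≥ 0`, and the right side keeps only its first term. -/
theorem IsRegular.mode_vac (hZ : IsRegular Z p) {α β : ZMod 2} {a : 𝔤} {u : D.Vac ℓ}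
    (ha : a ∈ D.part α) (hu : u ∈ D.vacPart ℓ β) (k n : ℤ) :
    Z (D.vacMode ℓ a k u) n (D.vac ℓ)
      = altSum p F k (fun i => D.vacMode ℓ a (k - i) (Z u (n + i) (D.vac ℓ))) := by
  have h := (hZ.jac ha hu).eq k 0 n (D.vac ℓ) (by simp)
  rw [TwistDatum.rhs_zero_snd, TwistDatum.br, altSum_eq_zero k (fun i => Z u _ _) fun i => by
    rw [D.vacMode_vac ℓ a (by simp), map_zero], smul_zero, sub_zero] at h
  simpa using h.symm

theorem IsRegular.creation (hZ : IsRegular Z p) (v : D.Vac ℓ) :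
    Z v (-1) (D.vac ℓ) = v ∧ ∀ n : ℤ, 0 ≤ n → Z v n (D.vac ℓ) = 0 := by
  suffices h : ∀ β, ∀ v ∈ D.vacPart ℓ β,
      Z v (-1) (D.vac ℓ) = v ∧ ∀ n : ℤ, 0 ≤ n → Z v n (D.vac ℓ) = 0 by
    obtain ⟨v₀, h0, v₁, h1, rfl⟩ := D.vacPart_sup ℓ v
    obtain ⟨e0, f0⟩ := h 0 _ h0
    obtain ⟨e1, f1⟩ := h 1 _ h1
    simp only [map_add, Pi.add_apply, LinearMap.add_apply, e0, e1, true_and]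
    intro n hn
    rw [f0 n hn, f1 n hn, add_zero]
  intro β v hv
  refine D.vacPart_induction ℓ (Q := fun _ => True)
    (P := fun _ v => Z v (-1) (D.vac ℓ) = v ∧ ∀ n : ℤ, 0 ≤ n → Z v n (D.vac ℓ) = 0)
    (fun α a ha => Submodule.subset_span ⟨ha, trivial⟩) ?_ ?_ ?_ ?_ ?_ hv
  · rw [hZ.vacuum]
    refine ⟨by simp [TwistDatum.unit], fun n hn => ?_⟩
    rw [TwistDatum.unit_apply_of_ne (by simp; omega)]
    rfl
  · intro β; simp
  · rintro β v w ⟨e0, f0⟩ ⟨e1, f1⟩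
    simp only [map_add, Pi.add_apply, LinearMap.add_apply, e0, e1, true_and]
    intro n hn
    rw [f0 n hn, f1 n hn, add_zero]
  · rintro β c v ⟨e, f⟩
    simp only [map_smul, Pi.smul_apply, LinearMap.smul_apply, e, true_and]
    intro n hn
    rw [f n hn, smul_zero]
  · rintro α β a k v ha _ hv ⟨e, f⟩
    constructor
    · rw [hZ.mode_vac ha hv, altSum, finsum_eq_single _ 0]
      · simp [e]
      · intro i hi
        rw [f _ (by omega)]
        simp
    · intro n hn
      rw [hZ.mode_vac ha hv]
      exact altSum_eq_zero _ _ fun i => by rw [f _ (by omega), map_zero]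

/-- The vectors `v_{-j-1} 𝟏` play the role of divided powers of the translation operator. In the
step from `v` to `a_k v`, `mode_vac` expands the vector, and `deriv_product` expands the derivative
of the product, with the same coefficients. -/
theorem IsVacRep.deriv (hτ : τ.toEquiv ^ t.T = 1) (hA : IsAffineRep t τ ℓ A)
    (hY : IsVacRep t τ ℓ A Y) (hp : 2 < p) (hZ : IsRegular Z p) (v : D.Vac ℓ) (j : ℕ) :
    Y (Z v (-j - 1) (D.vac ℓ)) = t.deriv j (Y v) := by
  suffices h : ∀ β, ∀ v ∈ D.vacPart ℓ β, ∀ j : ℕ,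
      Y (Z v (-j - 1) (D.vac ℓ)) = t.deriv j (Y v) by
    obtain ⟨v₀, h0, v₁, h1, rfl⟩ := D.vacPart_sup ℓ v
    simp only [map_add, Pi.add_apply, LinearMap.add_apply, h 0 _ h0, h 1 _ h1]
    funext n
    simp [TwistDatum.deriv]
  intro β v hv
  refine D.vacPart_induction ℓ (τ.mem_span_eigen hτ)
    (P := fun _ v => ∀ j : ℕ, Y (Z v (-j - 1) (D.vac ℓ)) = t.deriv j (Y v)) ?_ ?_ ?_ ?_ ?_ hv
  · intro j
    rw [hZ.vacuum, hY.vacuum]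
    rcases j with _ | j
    · simp [TwistDatum.unit, hY.vacuum]
    · rw [TwistDatum.unit_apply_of_ne (by simp; omega)]
      simp only [LinearMap.zero_apply, map_zero]
      funext n
      rw [TwistDatum.deriv]
      by_cases h : n - t.T * (j + 1 : ℕ) = -t.T
      · rw [show n = t.T * j by push_cast at h; linear_combination h]
        have : (bin (t.frac (t.T * (j : ℤ))) (j + 1) : F) = 0 := by
          rw [TwistDatum.frac_T_mul, Int.cast_natCast, bin_natCast,
            Nat.choose_eq_zero_of_lt (by omega), Nat.cast_zero]
        rw [this]
        simp
      · rw [TwistDatum.unit_apply_of_ne h, smul_zero]; rfl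
  · intro β j; funext n; simp [TwistDatum.deriv]
  · intro β v w hv hw j
    simp only [map_add, Pi.add_apply, LinearMap.add_apply, hv, hw]
    funext n
    simp [TwistDatum.deriv]
  · intro β c v hv j
    simp only [map_smul, Pi.smul_apply, LinearMap.smul_apply, hv]
    funext n
    simp [TwistDatum.deriv, smul_smul, mul_comm]
  · rintro α β a k v ha ⟨r, hr⟩ hv ih j
    have h1 : ∀ u : ℕ, (fun k => Y (D.vacMode ℓ a k (Z v (-u - 1) (D.vac ℓ))))
        = fun k : ℤ => ∑ sv ∈ antidiagonal u, (bin (k : ℤ_[p]) sv.1 : F) •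
          t.deriv sv.2 (Y (D.vacMode ℓ a (k - sv.1) v)) := by
      intro u
      have hm := hZ.mem hp hv (D.vac_mem ℓ) (-u - 1)
      rw [add_zero] at hm
      have h2 := hY.jac ha hr hm
      rw [ih u] at h2
      exact h2.unique ⟨r, rfl⟩ ((hY.jac ha hr hv).deriv_right (hA.field a) (hY.field v) u)
    have h3 := TwistDatum.deriv_product (t := t) (D := fun k => Y (D.vacMode ℓ a k v))
      (D' := fun u k => Y (D.vacMode ℓ a k (Z v (-u - 1) (D.vac ℓ)))) j
      (fun u _ k => congrFun (h1 u) k) k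
    rw [h3, hZ.mode_vac ha hv, altSum, finsum_eq_range (j + 1) fun i hi => by
      rw [(hZ.creation v).2 _ (by omega)]; simp, Finset.Nat.sum_antidiagonal_eq_sum_range_succ_mk,
      map_sum]
    refine Finset.sum_congr rfl fun i hi => ?_
    have hi' := Finset.mem_range.1 hi
    rw [map_smul]
    dsimp only
    rw [show (-j - 1 + i : ℤ) = -((j - i : ℕ) : ℤ) - 1 by omega]

end AffineDatum
end SuperVA

namespace SuperVA

/-! ### The Jacobi identity for arbitrary vectors -/

namespace AffineDatum

variable {p : ℕ} [Fact p.Prime] {F : Type*} [Field F] [CharP F p] {t : TwistDatum p F}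
  {𝔤 : Type*} [AddCommGroup 𝔤] [Module F 𝔤] {D : AffineDatum F 𝔤} {τ : D.Aut} {ℓ : F}
  {W : Type*} [AddCommGroup W] [Module F W]
  {A : 𝔤 →ₗ[F] (ℤ → Module.End F W)} {Y : D.Vac ℓ →ₗ[F] (ℤ → Module.End F W)}
  {Z : D.Vac ℓ →ₗ[F] (ℤ → Module.End F (D.Vac ℓ))}

/-- The commutator formula of a generator and an arbitrary field. -/
theorem IsVacRep.comm (hY : IsVacRep t τ ℓ A Y) {r : ℤ} {α β : ZMod 2} {a : 𝔤} {v : D.Vac ℓ}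
    (ha : a ∈ D.part α) (hr : τ.toEquiv a = t.cls r • a) (hv : v ∈ D.vacPart ℓ β) (Q : ℕ)
    (hQ : ∀ q ≥ Q, D.vacMode ℓ a (q : ℕ) v = 0) (m n : ℤ) (w : W) (hm : t.cls m = t.cls r) :
    A a m (Y v n w) - sgn F α β • Y v n (A a m w)
      = ∑ q ∈ Finset.range Q, (bin (t.frac m) q : F) •
        Y (D.vacMode ℓ a q v) (m + n - t.T * q) w := by
  have h := (hY.jac ha hr hv).eq 0 m n w hm
  rw [TwistDatum.br_zero_fst, t.rhs_eq_range _ _ _ _ Q fun i hi => by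
    funext n; rw [zero_add, hQ i hi, map_zero]; rfl] at h
  simpa using h

/-- The twisted Jacobi identity for arbitrary homogeneous vectors. -/
theorem IsVacRep.jac_of_eigen (hτ : τ.toEquiv ^ t.T = 1) (hA : IsAffineRep t τ ℓ A)
    (hY : IsVacRep t τ ℓ A Y) (hp : 2 < p) (hZ : IsRegular Z p) {r : ℤ} {α β : ZMod 2}
    {u v : D.Vac ℓ} (hu : τ.onVac ℓ u = t.cls r • u) (huα : u ∈ D.vacPart ℓ α)
    (hv : v ∈ D.vacPart ℓ β) :
    t.Jac (t.cls r) (sgn F α β) (Y u) (Y v) (fun l => Y (Z u l v)) := by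
  -- The induction is on the right entry, with `u` left arbitrary: the step for `a_k v` uses the
  -- hypothesis both for `u` and for the vectors `a_q u`.
  refine D.vacPart_induction ℓ (τ.mem_span_eigen hτ)
    (P := fun β v => ∀ (r : ℤ) (α : ZMod 2) (u : D.Vac ℓ), τ.onVac ℓ u = t.cls r • u →
      u ∈ D.vacPart ℓ α → t.Jac (t.cls r) (sgn F α β) (Y u) (Y v) (fun l => Y (Z u l v)))
    ?_ ?_ ?_ ?_ ?_ hv r α u hu huα
  · intro r α u hu _
    have h1 : (fun l => Y (Z u l (D.vac ℓ)))
        = fun l => if l < 0 then t.deriv (-l - 1).toNat (Y u) else 0 := by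
      funext l
      split_ifs with h
      · rw [← hY.deriv hτ hA hp hZ, show -((-l - 1).toNat : ℤ) - 1 = l by omega]
      · rw [(hZ.creation u).2 l (by omega), map_zero]
    rw [h1, sgn_zero_right, hY.vacuum]
    exact TwistDatum.Jac.one_right (hY.field u) fun n hn => hY.eq_zero_of_cls hτ hu hn
  · intro β r α u hu _
    simp only [map_zero]
    exact TwistDatum.Jac.zero_right'
  · intro β v w hv hw r α u hu hα
    simp only [map_add]
    exact (hv r α u hu hα).add_right (hY.field u) (hY.field v) (hY.field w) (hw r α u hu hα)
  · intro β c v hv r α u hu hα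
    simp only [map_smul]
    exact (hv r α u hu hα).smul_right c
  · rintro γ β a k v ha ⟨s, hs⟩ hv ih r α u hu hα
    obtain ⟨Q', hQ'⟩ := vacMode_isField a u
    have hQ : ∀ q ≥ Q'.toNat, D.vacMode ℓ a (q : ℕ) u = 0 := fun q hq => hQ' _ (by omega)
    -- The fields are those of `a`, `u` and `v`, and the `q`-th field in the commutator of `a` with
    -- `u` is `Y(a_q u)`. The products known so far are `Y(a_k (u_l v))` and `Y((a_q u)_l v)`.
    have h1 := TwistDatum.Jac.commute (t := t) (k := k) (sgn_mul_self F γ α) (hA.field a)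
      (hY.field u) (hY.field v) Q'.toNat (G := fun q => Y (D.vacMode ℓ a q u))
      (fun q _ => hY.field _)
      (fun m n w hm _ => hY.comm ha hs hα _ hQ m n w hm) ⟨s, rfl⟩ (hY.jac ha hs hv)
      (ih r α u hu hα) (M := fun l k => Y (D.vacMode ℓ a k (Z u l v)))
      (fun l => by
        rw [← sgn_add_right]
        exact hY.jac ha hs (hZ.mem hp hα hv l))
      (by
        obtain ⟨N, hN⟩ := hZ.field u v
        refine ⟨N, fun l hl => ?_⟩
        have := hN l hl
        dsimp only at this
        rw [this]
        funext k
        rw [map_zero, map_zero]; rfl)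
      (H := fun q l => Y (Z (D.vacMode ℓ a q u) l v))
      (fun q _ => by
        rw [← sgn_add_left, ← t.cls_add]
        refine ih _ _ _ ?_ (D.vacMode_mem ℓ ha _ hα)
        rw [Aut.onVac_mode, hs, hu, t.cls_add]
        simp [smul_smul, mul_comm])
    rw [sgn_comm F γ α, ← sgn_add_right] at h1
    convert h1 using 2 with l
    -- The commutator formula inside `V` itself, with integral exponents, identifies the outcome
    -- with `Y(u_l (a_k v))`.
    have h2 := IsVacRep.comm hZ (r := 0) ha (by simp [Aut.refl]) hα _ hQ k l v (by simp)
    simp only [TwistDatum.trivial_frac, TwistDatum.trivial_T, Nat.cast_one, one_mul] at h2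
    have h3 : Z u l (D.vacMode ℓ a k v) = sgn F γ α • (D.vacMode ℓ a k (Z u l v)
        - ∑ q ∈ Finset.range Q'.toNat, (bin (k : ℤ_[p]) q : F) •
          Z (D.vacMode ℓ a q u) (k + l - q) v) := by
      rw [← h2, sub_sub_cancel, smul_smul, sgn_mul_self, one_smul]
    rw [h3, sgn_comm F γ α]
    simp only [map_smul, map_sub, map_sum]

end AffineDatum
end SuperVA

namespace SuperVA

/-! ### Modules on generators and local fields -/

/-- The defining relation of a module may be checked on homogeneous generators. -/
theorem LieSuperalgebra.isModule_of_span {F : Type*} {L : Type*} [Field F] [AddCommGroup L]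
    [Module F L] (A : LieSuperalgebra F L) {M : Type*} [AddCommGroup M] [Module F M]
    (ρ : L →ₗ[F] Module.End F M) (S : ZMod 2 → Set L)
    (hS : ∀ α, A.part α ≤ Submodule.span F (S α))
    (h : ∀ α β, ∀ x ∈ S α, ∀ y ∈ S β,
      ρ (A.bracket x y) = ρ x * ρ y - sgn F α β • (ρ y * ρ x)) : A.IsModule ρ := by
  intro α β x y hx hy
  refine Submodule.span_induction₂ (p := fun x y _ _ =>
    ρ (A.bracket x y) = ρ x * ρ y - sgn F α β • (ρ y * ρ x)) (fun x y hx hy => h α β x hx y hy)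
    ?_ ?_ ?_ ?_ ?_ ?_ (hS α hx) (hS β hy)
  · intro y _; simp
  · intro x _; simp
  · intro x y z _ _ _ h1 h2
    rw [map_add, LinearMap.add_apply, map_add, h1, h2, map_add, add_mul, mul_add, smul_add]
    abel
  · intro x y z _ _ _ h1 h2
    rw [map_add, map_add, h1, h2, map_add, add_mul, mul_add, smul_add]
    abel
  · intro c x y _ _ h1
    rw [map_smul, LinearMap.smul_apply, map_smul, h1, map_smul, smul_mul_assoc, mul_smul_comm,
      smul_sub, smul_comm c]
  · intro c x y _ _ h1
    rw [map_smul, map_smul, h1, map_smul, smul_mul_assoc, mul_smul_comm, smul_sub, smul_comm c]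

namespace TwistDatum

variable {p : ℕ} [Fact p.Prime] {F : Type*} [Field F] [CharP F p] {t : TwistDatum p F}
  {W : Type*} [AddCommGroup W] [Module F W] {c ε : F} {A C : ℤ → Module.End F W}
  {D : ℤ → ℤ → Module.End F W}

open Classical in
variable (t c ε A C) in
/-- The products `A_l C`, if they exist. -/
noncomputable def prod : ℤ → ℤ → Module.End F W :=
  if h : ∃ D, t.Jac c ε A C D then h.choose else 0

theorem prod_eq (hc : ∃ m, t.cls m = c) (h : t.Jac c ε A C D) : t.prod c ε A C = D := by
  rw [prod, dif_pos ⟨D, h⟩]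
  exact (Exists.choose_spec (⟨D, h⟩ : ∃ D, t.Jac c ε A C D)).unique hc h

theorem Jac.isLocal_fst (h : t.Jac c ε A C D) : ∃ N : ℤ, ∀ l ≥ N, ∀ m n w, t.cls m = c →
    t.br ε A (fun n => C n) l m n w = 0 := by
  obtain ⟨N, hN⟩ := h.bound
  refine ⟨N, fun l hl m n w hm => ?_⟩
  rw [h.eq l m n w hm, t.rhs_eq_range _ _ _ _ 0 fun i _ => by
    funext n; rw [hN _ (by omega)]; rfl]
  rfl

/-- A multiple of the identity field fits the class `c` and sign `ε` only if both are trivial or the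
multiple is zero. The condition is demanded only in the former case, as central terms of brackets
require. -/
theorem Jac.smul_unit (hC : IsField fun n => C n) (a : F) (h : a ≠ 0 → c = 1 ∧ ε = 1) :
    t.Jac c ε (a • t.unit W) C (a • fun l => if l = -1 then C else 0) := by
  by_cases ha : a = 0
  · rw [ha, zero_smul, zero_smul]
    exact Jac.zero_left
  · obtain ⟨rfl, rfl⟩ := h ha
    exact (Jac.one_left hC).smul_left a

theorem resHom_frac (m : ℤ) : (bin (t.frac m) 1 : F) = m / t.T := by
  have h := congrArg (resHom p F) t.T_mul_θ
  rw [map_mul, map_natCast, map_one] at h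
  have h1 : (bin (t.frac m) 1 : F) = resHom p F (t.frac m) := by simp
  rw [h1, frac, map_mul, map_intCast, eq_div_iff t.T_ne_zero]
  linear_combination (m : F) * h

end TwistDatum

/-! ### Commutators of generators and locality. -/

namespace AffineDatum

variable {p : ℕ} [Fact p.Prime] {F : Type*} [Field F] [CharP F p] {t : TwistDatum p F}
  {𝔤 : Type*} [AddCommGroup 𝔤] [Module F 𝔤] {D : AffineDatum F 𝔤} {τ : D.Aut} {ℓ : F}
  {W : Type*} [AddCommGroup W] [Module F W]
  {A : 𝔤 →ₗ[F] (ℤ → Module.End F W)}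

variable (t τ) in
/-- The component of given eigenvalue and parity. -/
noncomputable def homComp (r : ℤ) (α : ZMod 2) : 𝔤 →ₗ[F] 𝔤 :=
  t.eigenproj τ.toEquiv.toLinearMap r ∘ₗ if α = 0 then D.proj0 else D.proj1

theorem homComp_mem (r : ℤ) (α : ZMod 2) (a : 𝔤) : homComp t τ r α a ∈ D.part α := by
  refine t.eigenproj_mem (τ.map_part α) r ?_
  rcases zmod_two α with rfl | rfl
  · exact Submodule.projection_apply_mem _ _
  · exact Submodule.projection_apply_mem _ _

theorem homComp_eigen (hτ : τ.toEquiv ^ t.T = 1) (r : ℤ) (α : ZMod 2) (a : 𝔤) :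
    τ.toEquiv (homComp t τ r α a) = t.cls r • homComp t τ r α a :=
  t.map_eigenproj (τ.toLinearMap_pow hτ) r _

open Classical in
theorem homComp_eq {a : 𝔤} {r : ℤ} {α : ZMod 2} (ha : a ∈ D.part α)
    (hr : τ.toEquiv a = t.cls r • a) (s : ℤ) (β : ZMod 2) :
    homComp t τ s β a = if β = α ∧ t.cls s = t.cls r then a else 0 := by
  have h : (if β = 0 then D.proj0 else D.proj1) a = if β = α then a else 0 := by
    rcases zmod_two α with rfl | rfl <;> rcases zmod_two β with rfl | rfl
    · simp [D.proj_even ha]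
    · simp [D.proj_even ha]
    · simp [D.proj_odd ha]
    · simp [D.proj_odd ha]
  rw [homComp, LinearMap.comp_apply, h]
  by_cases hβ : β = α
  · rw [if_pos hβ, t.eigenproj_eigen hr]
    simp [hβ]
  · rw [if_neg hβ, if_neg fun h => hβ h.1, map_zero]

/-- The coefficient of `𝐤` in a bracket can only be nonzero if the entries have the same parity and
inverse eigenvalues. -/
theorem form_ne_zero {a b : 𝔤} {r s : ℤ} {α β : ZMod 2} (ha : a ∈ D.part α) (hb : b ∈ D.part β)
    (hr : τ.toEquiv a = t.cls r • a) (hs : τ.toEquiv b = t.cls s • b) (h : D.form a b ≠ 0) :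
    t.cls r * t.cls s = 1 ∧ α = β := by
  constructor
  · have h1 := τ.map_form a b
    rw [hr, hs, map_smul, map_smul, LinearMap.smul_apply, smul_smul, smul_eq_mul,
      mul_comm (t.cls s)] at h1
    exact mul_right_cancel₀ h (h1.trans (one_mul _).symm)
  · rcases zmod_two α with rfl | rfl <;> rcases zmod_two β with rfl | rfl
    · rfl
    · exact absurd (D.form_even_odd ha hb) h
    · rw [D.form_symm] at h
      exact absurd (D.form_even_odd hb ha) h
    · rfl

variable (A ℓ t) in
/-- The fields in the commutator formula of two generators. -/
noncomputable def commField (D : AffineDatum F 𝔤) (a b : 𝔤) (q : ℕ) : ℤ → Module.End F W :=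
  if q = 0 then A (D.bracket a b) + (ℓ * D.form (D.proj1 a) (D.proj1 b)) • t.unit W
  else (ℓ * D.form (D.proj0 a) (D.proj0 b)) • t.unit W

theorem form_proj_ne_zero {a b : 𝔤} {α β : ZMod 2} (ha : a ∈ D.part α) (hb : b ∈ D.part β)
    (h : D.form (D.proj0 a) (D.proj0 b) ≠ 0 ∨ D.form (D.proj1 a) (D.proj1 b) ≠ 0) :
    D.form a b ≠ 0 := by
  rcases zmod_two α with rfl | rfl <;> rcases zmod_two β with rfl | rfl <;>
    simp_all [D.proj_even, D.proj_odd]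

namespace IsAffineRep

/-- The cocycle in the shape required by `br_br`: the odd form contributes with `q = 0`, at `m + n =
-T`, and the even form with `q = 1`, where the coefficient `m/T` appears, at `m + n = 0`. -/
theorem comm_sum (hA : IsAffineRep t τ ℓ A) {α β : ZMod 2} {r s : ℤ} {a b : 𝔤} (ha : a ∈ D.part α) (hb : b ∈ D.part β)
    (hr : τ.toEquiv a = t.cls r • a) (hs : τ.toEquiv b = t.cls s • b) (m n : ℤ) (w : W)
    (hm : t.cls m = t.cls r) (hn : t.cls n = t.cls s) :
    A a m (A b n w) - sgn F α β • A b n (A a m w) = ∑ q ∈ Finset.range 2,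
      (bin (t.frac m) q : F) • commField t ℓ A D a b q (m + n - t.T * q) w := by
  rw [hA.comm ha hb hr hs m n hm hn, Finset.sum_range_succ, Finset.sum_range_one, commField,
    commField, if_pos rfl, if_neg one_ne_zero, bin_zero, one_smul, TwistDatum.resHom_frac,
    cocycle_apply]
  have h1 : t.unit W (m + n - t.T * (0 : ℕ)) w = (if m + n + t.T = 0 then (1 : F) else 0) • w := by
    rw [TwistDatum.unit]
    by_cases h : m + n + t.T = 0
    · rw [if_pos (by push_cast; linarith), if_pos h, one_smul]; rfl
    · rw [if_neg fun h' => h (by push_cast at h'; linarith), if_neg h, zero_smul]; rfl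
  have h2 : t.unit W (m + n - t.T * (1 : ℕ)) w = (if m + n = 0 then (1 : F) else 0) • w := by
    rw [TwistDatum.unit]
    by_cases h : m + n = 0
    · rw [if_pos (by push_cast; linarith), if_pos h, one_smul]; rfl
    · rw [if_neg fun h' => h (by push_cast at h'; linarith), if_neg h, zero_smul]; rfl
  simp only [Pi.add_apply, Pi.smul_apply, LinearMap.add_apply, LinearMap.smul_apply, h1, h2]
  rw [Nat.cast_zero, mul_zero, sub_zero]
  split_ifs <;> module

theorem commField_isField (hA : IsAffineRep t τ ℓ A) (a b : 𝔤) (q : ℕ) : IsField fun n => commField t ℓ A D a b q n := by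
  intro w
  obtain ⟨N, hN⟩ := hA.field (D.bracket a b) w
  obtain ⟨M, hM⟩ := TwistDatum.unit_isField (t := t) (W := W) w
  refine ⟨max N M, fun n hn => ?_⟩
  have h1 := hN n (le_of_max_le_left hn)
  have h2 := hM n (le_of_max_le_right hn)
  dsimp only at h1 h2 ⊢
  rw [commField]
  split_ifs <;> simp [h1, h2]

end IsAffineRep

variable (t τ) in
/-- `C` is a field of parity `γ` which is local with all generators. -/
def IsLocalField (A : 𝔤 →ₗ[F] (ℤ → Module.End F W)) (γ : ZMod 2) (C : ℤ → Module.End F W) : Prop :=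
  (IsField fun n => C n) ∧ ∀ (r : ℤ) (α : ZMod 2), ∀ a ∈ D.part α, τ.toEquiv a = t.cls r • a →
    ∃ E, t.Jac (t.cls r) (sgn F α γ) (A a) C E

namespace IsAffineRep

variable {γ : ZMod 2} {C C' : ℤ → Module.End F W}

/-- The central part has trivial class and sign whenever its coefficient is nonzero, because the
form pairs only equal parities and inverse eigenvalues. -/
theorem jac_commField (hA : IsAffineRep t τ ℓ A) (hC : IsField fun n => C n) {α β : ZMod 2}
    {r s : ℤ} {a b : 𝔤} (ha : a ∈ D.part α) (hb : b ∈ D.part β) (hr : τ.toEquiv a = t.cls r • a)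
    (hs : τ.toEquiv b = t.cls s • b) {E : ℤ → ℤ → Module.End F W}
    (hE : t.Jac (t.cls (r + s)) (sgn F (α + β) γ) (A (D.bracket a b)) C E) (q : ℕ) :
    t.Jac (t.cls r * t.cls s) (sgn F α γ * sgn F β γ) (commField t ℓ A D a b q) C
      (if q = 0 then E + (ℓ * D.form (D.proj1 a) (D.proj1 b)) • fun l => if l = -1 then C else 0
        else (ℓ * D.form (D.proj0 a) (D.proj0 b)) • fun l => if l = -1 then C else 0) := by
  have key : D.form a b ≠ 0 → t.cls r * t.cls s = 1 ∧ sgn F α γ * sgn F β γ = 1 := fun h => by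
    obtain ⟨h1, rfl⟩ := form_ne_zero ha hb hr hs h
    exact ⟨h1, sgn_mul_self F _ _⟩
  rw [commField]
  split_ifs
  · rw [sgn_add_left, t.cls_add] at hE
    refine TwistDatum.Jac.add_left (hA.field _) ?_ hC hE (TwistDatum.Jac.smul_unit hC _ fun h =>
      key (form_proj_ne_zero ha hb (Or.inr (right_ne_zero_of_mul h))))
    intro w
    obtain ⟨N, hN⟩ := TwistDatum.unit_isField (t := t) (W := W) w
    exact ⟨N, fun n hn => by
      have := hN n hn
      dsimp only at this ⊢
      rw [Pi.smul_apply, LinearMap.smul_apply, this, smul_zero]⟩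
  · exact TwistDatum.Jac.smul_unit hC _ fun h =>
      key (form_proj_ne_zero ha hb (Or.inl (right_ne_zero_of_mul h)))

theorem bracket_eigen {r s : ℤ} {a b : 𝔤} (hr : τ.toEquiv a = t.cls r • a)
    (hs : τ.toEquiv b = t.cls s • b) :
    τ.toEquiv (D.bracket a b) = t.cls (r + s) • D.bracket a b := by
  rw [τ.map_bracket, hr, hs, t.cls_add]
  simp [smul_smul, mul_comm]

/-- Dong's lemma gives locality of the product with every generator, and `exists_jac` turns locality
into the existence of products. -/
theorem isLocalField_prod (hA : IsAffineRep t τ ℓ A) (hC : IsLocalField t τ A γ C) {α : ZMod 2}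
    {r : ℤ} {a : 𝔤} (ha : a ∈ D.part α) (hr : τ.toEquiv a = t.cls r • a)
    {E : ℤ → ℤ → Module.End F W} (hE : t.Jac (t.cls r) (sgn F α γ) (A a) C E) (k : ℤ) :
    IsLocalField t τ A (α + γ) (E k) := by
  refine ⟨hE.field k, fun s β b hb hs => ?_⟩
  obtain ⟨E', hE'⟩ := hC.2 s β b hb hs
  obtain ⟨H, hH⟩ := hC.2 (r + s) (α + β) _ (D.bracket_mem ha hb) (bracket_eigen hr hs)
  obtain ⟨N, hN⟩ := TwistDatum.Jac.isLocal (sgn_mul_self F α β) (hA.field a) (hA.field b) hC.1 2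
    (fun q _ => hA.commField_isField a b q)
    (fun m n w hm hn => hA.comm_sum ha hb hr hs m n w hm hn) ⟨r, rfl⟩ hE hE'.isLocal_fst
    (fun q _ => (hA.jac_commField hC.1 ha hb hr hs hH q).isLocal_fst) k
  rw [sgn_comm F α β, ← sgn_add_right] at hN
  exact TwistDatum.exists_jac (hA.field b) (hE.field k) N hN s rfl

end IsAffineRep

end AffineDatum
end SuperVA

namespace SuperVA

/-! ### The action on local fields -/

namespace AffineDatum

variable {p : ℕ} [Fact p.Prime] {F : Type*} [Field F] [CharP F p] {t : TwistDatum p F}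
  {𝔤 : Type*} [AddCommGroup 𝔤] [Module F 𝔤] {D : AffineDatum F 𝔤} {τ : D.Aut} {ℓ : F}
  {W : Type*} [AddCommGroup W] [Module F W]
  {A : 𝔤 →ₗ[F] (ℤ → Module.End F W)}

namespace IsAffineRep

theorem _root_.SuperVA.IsField.add {C C' : ℤ → Module.End F W} (hC : IsField fun n => C n)
    (hC' : IsField fun n => C' n) : IsField fun n => (C + C') n := by
  intro w
  obtain ⟨N, hN⟩ := hC w
  obtain ⟨M, hM⟩ := hC' w
  refine ⟨max N M, fun n hn => ?_⟩
  have h1 := hN n (le_of_max_le_left hn)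
  have h2 := hM n (le_of_max_le_right hn)
  dsimp only at h1 h2 ⊢
  rw [Pi.add_apply, LinearMap.add_apply, h1, h2, add_zero]

theorem _root_.SuperVA.IsField.smul (c : F) {C : ℤ → Module.End F W} (hC : IsField fun n => C n) :
    IsField fun n => (c • C) n := by
  intro w
  obtain ⟨N, hN⟩ := hC w
  refine ⟨N, fun n hn => ?_⟩
  have h1 := hN n hn
  dsimp only at h1 ⊢
  rw [Pi.smul_apply, LinearMap.smul_apply, h1, smul_zero]

/-- Pairs of an even and an odd field which are local with all generators. -/
def localFields (hA : IsAffineRep t τ ℓ A) : Submodule F (ZMod 2 → ℤ → Module.End F W) where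
  carrier := {ψ | ∀ γ, IsLocalField t τ A γ (ψ γ)}
  add_mem' := fun {ψ φ} hψ hφ γ => ⟨(hψ γ).1.add (hφ γ).1, fun r α a ha hr => by
    obtain ⟨E, hE⟩ := (hψ γ).2 r α a ha hr
    obtain ⟨E', hE'⟩ := (hφ γ).2 r α a ha hr
    exact ⟨_, hE.add_right (hA.field a) (hψ γ).1 (hφ γ).1 hE'⟩⟩
  zero_mem' := fun γ => ⟨fun w => ⟨0, fun _ _ => rfl⟩, fun r α a _ _ =>
    ⟨0, TwistDatum.Jac.zero_right'⟩⟩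
  smul_mem' := fun c ψ hψ γ => ⟨(hψ γ).1.smul c, fun r α a ha hr => by
    obtain ⟨E, hE⟩ := (hψ γ).2 r α a ha hr
    exact ⟨_, hE.smul_right c⟩⟩

variable (t A) in
/-- The action of a homogeneous generator on pairs of fields. -/
noncomputable def homAct (r : ℤ) (α : ZMod 2) (a : 𝔤) (l : ℤ) (ψ : ZMod 2 → ℤ → Module.End F W) :
    ZMod 2 → ℤ → Module.End F W :=
  fun δ => t.prod (t.cls r) (sgn F α (δ - α)) (A a) (ψ (δ - α)) l

variable {r : ℤ} {α : ZMod 2} {a b : 𝔤} {l : ℤ} {ψ φ : ZMod 2 → ℤ → Module.End F W}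

/-- Uniqueness of products makes the choice inside `prod` immaterial; this is what makes the action
linear. -/
theorem homAct_apply {E : ℤ → ℤ → Module.End F W} {γ : ZMod 2}
    (h : t.Jac (t.cls r) (sgn F α γ) (A a) (ψ γ) E) (l : ℤ) :
    homAct t A r α a l ψ (α + γ) = E l := by
  rw [homAct, add_sub_cancel_left, TwistDatum.prod_eq ⟨r, rfl⟩ h]

theorem homAct_mem (hA : IsAffineRep t τ ℓ A) (ha : a ∈ D.part α) (hr : τ.toEquiv a = t.cls r • a)
    (hψ : ψ ∈ hA.localFields) (l : ℤ) : homAct t A r α a l ψ ∈ hA.localFields := by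
  intro δ
  obtain ⟨E, hE⟩ := (hψ (δ - α)).2 r α a ha hr
  have h := hA.isLocalField_prod (hψ (δ - α)) ha hr hE l
  rw [← homAct_apply hE, add_sub_cancel] at h
  exact h

theorem homAct_add (hA : IsAffineRep t τ ℓ A) (ha : a ∈ D.part α) (hr : τ.toEquiv a = t.cls r • a)
    (hψ : ψ ∈ hA.localFields) (hφ : φ ∈ hA.localFields) :
    homAct t A r α a l (ψ + φ) = homAct t A r α a l ψ + homAct t A r α a l φ := by
  funext δ
  obtain ⟨γ, rfl⟩ : ∃ γ, δ = α + γ := ⟨δ - α, by abel⟩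
  obtain ⟨E, hE⟩ := (hψ γ).2 r α a ha hr
  obtain ⟨E', hE'⟩ := (hφ γ).2 r α a ha hr
  rw [homAct_apply (ψ := ψ + φ) (hE.add_right (hA.field a) (hψ γ).1 (hφ γ).1 hE'), Pi.add_apply,
    Pi.add_apply, homAct_apply hE, homAct_apply hE']

theorem homAct_smul (hA : IsAffineRep t τ ℓ A) (ha : a ∈ D.part α) (hr : τ.toEquiv a = t.cls r • a)
    (hψ : ψ ∈ hA.localFields) (c : F) :
    homAct t A r α a l (c • ψ) = c • homAct t A r α a l ψ := by
  funext δ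
  obtain ⟨γ, rfl⟩ : ∃ γ, δ = α + γ := ⟨δ - α, by abel⟩
  obtain ⟨E, hE⟩ := (hψ γ).2 r α a ha hr
  rw [homAct_apply (ψ := c • ψ) (hE.smul_right c), Pi.smul_apply,
    Pi.smul_apply, homAct_apply hE]

theorem add_homAct (hA : IsAffineRep t τ ℓ A) (ha : a ∈ D.part α) (hr : τ.toEquiv a = t.cls r • a)
    (hb : b ∈ D.part α) (hs : τ.toEquiv b = t.cls r • b) (hψ : ψ ∈ hA.localFields) :
    homAct t A r α (a + b) l ψ = homAct t A r α a l ψ + homAct t A r α b l ψ := by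
  funext δ
  obtain ⟨γ, rfl⟩ : ∃ γ, δ = α + γ := ⟨δ - α, by abel⟩
  obtain ⟨E, hE⟩ := (hψ γ).2 r α a ha hr
  obtain ⟨E', hE'⟩ := (hψ γ).2 r α b hb hs
  have h := hE.add_left (hA.field a) (hA.field b) (hψ γ).1 hE'
  rw [← map_add] at h
  rw [homAct_apply h, Pi.add_apply, Pi.add_apply, homAct_apply hE, homAct_apply hE']

theorem smul_homAct (hA : IsAffineRep t τ ℓ A) (ha : a ∈ D.part α) (hr : τ.toEquiv a = t.cls r • a)
    (hψ : ψ ∈ hA.localFields) (c : F) :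
    homAct t A r α (c • a) l ψ = c • homAct t A r α a l ψ := by
  funext δ
  obtain ⟨γ, rfl⟩ : ∃ γ, δ = α + γ := ⟨δ - α, by abel⟩
  obtain ⟨E, hE⟩ := (hψ γ).2 r α a ha hr
  have h := hE.smul_left c
  rw [← map_smul] at h
  rw [homAct_apply h, Pi.smul_apply, Pi.smul_apply, homAct_apply hE]

/-- The action of the loop algebra generators on pairs of local fields. -/
noncomputable def act (hA : IsAffineRep t τ ℓ A) (hτ : τ.toEquiv ^ t.T = 1) :
    𝔤 →ₗ[F] (ℤ → Module.End F hA.localFields) where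
  toFun a l :=
    -- Products are defined only for homogeneous eigenvectors, so `a` is first decomposed; the index
    -- runs over eigenvalue and parity.
    { toFun := fun ψ => ∑ rα ∈ Finset.range t.T ×ˢ Finset.univ,
        ⟨homAct t A rα.1 rα.2 (homComp t τ rα.1 rα.2 a) l ψ.1,
          hA.homAct_mem (homComp_mem _ _ _) (homComp_eigen hτ _ _ _) ψ.2 l⟩
      map_add' := fun ψ φ => by
        rw [← Finset.sum_add_distrib]
        exact Finset.sum_congr rfl fun rα _ => Subtype.ext
          (hA.homAct_add (homComp_mem _ _ _) (homComp_eigen hτ _ _ _) ψ.2 φ.2)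
      map_smul' := fun c ψ => by
        rw [Finset.smul_sum]
        exact Finset.sum_congr rfl fun rα _ => Subtype.ext
          (hA.homAct_smul (homComp_mem _ _ _) (homComp_eigen hτ _ _ _) ψ.2 c) }
  map_add' a b := by
    funext l
    refine LinearMap.ext fun ψ => ?_
    simp only [LinearMap.coe_mk, AddHom.coe_mk, Pi.add_apply, LinearMap.add_apply]
    rw [← Finset.sum_add_distrib]
    refine Finset.sum_congr rfl fun rα _ => Subtype.ext ?_
    simp only [map_add]
    exact hA.add_homAct (homComp_mem _ _ _) (homComp_eigen hτ _ _ _) (homComp_mem _ _ _)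
      (homComp_eigen hτ _ _ _) ψ.2
  map_smul' c a := by
    funext l
    refine LinearMap.ext fun ψ => ?_
    simp only [LinearMap.coe_mk, AddHom.coe_mk, Pi.smul_apply, LinearMap.smul_apply,
      RingHom.id_apply]
    rw [Finset.smul_sum]
    refine Finset.sum_congr rfl fun rα _ => Subtype.ext ?_
    simp only [map_smul]
    exact hA.smul_homAct (homComp_mem _ _ _) (homComp_eigen hτ _ _ _) ψ.2 c

theorem exists_range_cls (t : TwistDatum p F) (r : ℤ) :
    ∃ s : ℕ, s < t.T ∧ t.cls s = t.cls r := by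
  have hT : (t.T : ℤ) ≠ 0 := by exact_mod_cast t.T_pos.ne'
  have h1 := Int.emod_nonneg r hT
  have h2 := Int.emod_lt_of_pos r (show (0 : ℤ) < t.T by exact_mod_cast t.T_pos)
  refine ⟨(r % t.T).toNat, by omega, ?_⟩
  rw [Int.toNat_of_nonneg h1, ← t.cls_add_T_mul (r % t.T) (r / t.T), Int.emod_add_mul_ediv]

theorem act_apply (hA : IsAffineRep t τ ℓ A) (hτ : τ.toEquiv ^ t.T = 1) (ha : a ∈ D.part α)
    (hr : τ.toEquiv a = t.cls r • a) (ψ : hA.localFields) {γ : ZMod 2}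
    {E : ℤ → ℤ → Module.End F W} (h : t.Jac (t.cls r) (sgn F α γ) (A a) (ψ.1 γ) E) (l : ℤ) :
    (hA.act hτ a l ψ).1 (α + γ) = E l := by
  have h1 : (hA.act hτ a l ψ).1 (α + γ) = ∑ rα ∈ Finset.range t.T ×ˢ Finset.univ,
      homAct t A rα.1 rα.2 (homComp t τ rα.1 rα.2 a) l ψ.1 (α + γ) := by
    simp only [act, LinearMap.coe_mk, AddHom.coe_mk]
    rw [Submodule.coe_sum, Finset.sum_apply]
  obtain ⟨s, hs, hsr⟩ := exists_range_cls t r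
  rw [h1, Finset.sum_eq_single ((s : ℕ), α)]
  · rw [homComp_eq ha hr, if_pos ⟨rfl, hsr⟩]
    rw [← hsr] at h
    exact homAct_apply h l
  · rintro ⟨s', β⟩ hs' hne
    rw [homComp_eq ha hr, if_neg]
    · have h0 : t.Jac (t.cls s') (sgn F β (α + γ - β)) (A (0 : 𝔤)) (ψ.1 (α + γ - β)) 0 := by
        rw [map_zero]; exact TwistDatum.Jac.zero_left
      have h2 := homAct_apply h0 l
      rw [add_sub_cancel] at h2
      exact h2
    · rintro ⟨rfl, h2⟩
      rw [← hsr] at h2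
      obtain ⟨k, hk⟩ := t.exists_of_cls_eq h2
      have h3 := Finset.mem_range.1 (Finset.mem_product.1 hs').1
      have h4 : s' = s := by
        have h5 : (s' : ℤ) ≡ s [ZMOD t.T] := by
          rw [hk]; exact (Int.modEq_iff_dvd.2 ⟨-k, by ring⟩)
        exact Nat.ModEq.eq_of_lt_of_lt (Int.natCast_modEq_iff.1 h5) h3 hs
      exact hne (by rw [h4])
  · intro h
    exact absurd (Finset.mem_product.2 ⟨Finset.mem_range.2 hs, Finset.mem_univ _⟩) h

/-- `Jac.commute` for two generators. Its coefficients are `(k choose q)` with integral `k`, and `q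
= 0, 1` reproduce the bracket and the cocycle for `T = 1`, although the fields involved are twisted.
-/
theorem act_comm (hA : IsAffineRep t τ ℓ A) (hτ : τ.toEquiv ^ t.T = 1) {β : ZMod 2} {s : ℤ}
    (ha : a ∈ D.part α) (hb : b ∈ D.part β) (hr : τ.toEquiv a = t.cls r • a)
    (hs : τ.toEquiv b = t.cls s • b) (k l : ℤ) (ψ : hA.localFields) :
    hA.act hτ a k (hA.act hτ b l ψ) - sgn F α β • hA.act hτ b l (hA.act hτ a k ψ)
      = hA.act hτ (D.bracket a b) (k + l) ψ + (ℓ * D.cocycle 1 k l a b) • ψ := by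
  refine Subtype.ext (funext fun δ => ?_)
  obtain ⟨γ, rfl⟩ : ∃ γ, δ = α + β + γ := ⟨δ - α - β, by abel⟩
  have hC := ψ.2 γ
  have hab := D.bracket_mem ha hb
  have hrs := bracket_eigen hr hs
  obtain ⟨E, hE⟩ := hC.2 r α a ha hr
  obtain ⟨E', hE'⟩ := hC.2 s β b hb hs
  obtain ⟨H, hH⟩ := hC.2 (r + s) (α + β) _ hab hrs
  have e1 := fun l => hA.act_apply hτ ha hr ψ hE l
  have e2 := fun l => hA.act_apply hτ hb hs ψ hE' l
  have e3 := hA.act_apply hτ hab hrs ψ hH (k + l)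
  have hM : ∀ l, ∃ M, t.Jac (t.cls r) (sgn F α β * sgn F α γ) (A a) (E' l) M := fun l => by
    have := (hA.act hτ b l ψ).2 (β + γ)
    rw [e2] at this
    obtain ⟨M, hM⟩ := this.2 r α a ha hr
    rw [sgn_add_right] at hM
    exact ⟨M, hM⟩
  choose M hM using hM
  have e4 : (hA.act hτ a k (hA.act hτ b l ψ)).1 (α + β + γ) = M l k := by
    have h := hM l
    rw [← sgn_add_right, ← e2] at h
    rw [add_assoc]
    exact hA.act_apply hτ ha hr _ h k
  have h1 := TwistDatum.Jac.commute (sgn_mul_self F α β) (hA.field a) (hA.field b) hC.1 2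
    (fun q _ => hA.commField_isField a b q)
    (fun m n w hm hn => hA.comm_sum ha hb hr hs m n w hm hn) ⟨r, rfl⟩ hE hE' hM
    (by
      -- Once `B_l C = 0`, its products with `A` are zero by uniqueness.
      obtain ⟨N, hN⟩ := hE'.bound
      refine ⟨N, fun l hl => ?_⟩
      have h := hM l
      rw [hN l hl] at h
      exact h.zero_right ⟨r, rfl⟩)
    (fun q _ => hA.jac_commField hC.1 ha hb hr hs hH q) k
  rw [sgn_comm F α β, ← sgn_add_right, ← e1] at h1
  have e5 := hA.act_apply hτ hb hs _ h1 l
  rw [← add_assoc, add_comm β α] at e5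
  rw [AddSubgroupClass.coe_sub, Submodule.coe_smul, Submodule.coe_add, Submodule.coe_smul,
    Pi.sub_apply, Pi.smul_apply, Pi.add_apply, Pi.smul_apply, e3, e4, e5, sgn_comm F β α,
    smul_smul, sgn_mul_self, one_smul, sub_sub_cancel, Finset.sum_range_succ,
    Finset.sum_range_one, if_pos rfl, if_neg one_ne_zero, bin_zero, one_smul, bin_one,
    map_intCast, cocycle_apply]
  simp only [Pi.add_apply, Pi.smul_apply]
  simp only [Nat.cast_one, div_one, Nat.cast_zero, sub_zero]
  -- For equal parities `α + β + γ = γ`, so the scalar term lands in the right component; for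
  -- different parities the form vanishes.
  by_cases hαβ : α = β
  · have h2 : α + β + γ = γ := by rw [hαβ, CharTwo.add_self_eq_zero, zero_add]
    rw [h2]
    split_ifs <;> first | omega | module
  · have h2 := not_or.1 fun h =>
      hαβ (form_ne_zero ha hb hr hs (form_proj_ne_zero ha hb h)).2
    rw [not_not.1 h2.1, not_not.1 h2.2]
    simp

end IsAffineRep

end AffineDatum
end SuperVA

namespace SuperVA

/-! ### Construction of the fields attached to vectors -/

namespace AffineDatum

variable {p : ℕ} [Fact p.Prime] {F : Type*} [Field F] [CharP F p] {t : TwistDatum p F}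
  {𝔤 : Type*} [AddCommGroup 𝔤] [Module F 𝔤] {D : AffineDatum F 𝔤} {τ : D.Aut} {ℓ : F}
  {W : Type*} [AddCommGroup W] [Module F W]
  {A : 𝔤 →ₗ[F] (ℤ → Module.End F W)}

/-- The linear map on the loop algebra with given values on `a ⊗ tⁿ`, the central element acting by
a scalar. -/
noncomputable def loopMap {M : Type*} [AddCommGroup M] [Module F M]
    (B : 𝔤 →ₗ[F] (ℤ → Module.End F M)) (ℓ : F) : Loop F 𝔤 →ₗ[F] Module.End F M :=
  LinearMap.coprod (Finsupp.lsum F fun n => LinearMap.proj n ∘ₗ B)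
    (LinearMap.toSpanSingleton F (Module.End F M) (ℓ • 1))

theorem loopMap_elt {M : Type*} [AddCommGroup M] [Module F M]
    (B : 𝔤 →ₗ[F] (ℤ → Module.End F M)) (ℓ : F) (n : ℤ) (a : 𝔤) :
    loopMap B ℓ (elt F n a) = B a n := by
  simp [loopMap, elt]

theorem loopMap_central {M : Type*} [AddCommGroup M] [Module F M]
    (B : 𝔤 →ₗ[F] (ℤ → Module.End F M)) (ℓ : F) : loopMap B ℓ (central F 𝔤) = ℓ • 1 := by
  simp [loopMap, central]

/-- Homogeneous generators of the loop algebra that are eigenvectors. -/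
theorem loopPart_le_eigen (hτ : τ.toEquiv ^ t.T = 1) (α : ZMod 2) :
    D.loopPart α ≤ Submodule.span F {x : Loop F 𝔤 | (∃ n, ∃ a ∈ D.part α,
      (∃ r : ℤ, τ.toEquiv a = t.cls r • a) ∧ x = elt F n a) ∨ (α = 0 ∧ x = central F 𝔤)} := by
  refine (D.loopPart_le α).trans (Submodule.span_le.2 ?_)
  rintro x (⟨n, a, ha, rfl⟩ | h)
  · refine Submodule.span_induction (p := fun a _ => elt F n a ∈ Submodule.span F _)
      ?_ ?_ ?_ ?_ (τ.mem_span_eigen hτ α a ha)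
    · rintro a ⟨ha, hr⟩
      exact Submodule.subset_span (Or.inl ⟨n, a, ha, hr, rfl⟩)
    · have : elt F n (0 : 𝔤) = 0 := by simp [elt]
      rw [this]; exact Submodule.zero_mem _
    · intro a b _ _ ha hb
      rw [elt_add]; exact Submodule.add_mem _ ha hb
    · intro c a _ ha
      rw [elt_smul]; exact Submodule.smul_mem _ _ ha
  · exact Submodule.subset_span (Or.inr h)

theorem isModule_loopMap (hτ : τ.toEquiv ^ t.T = 1) {M : Type*} [AddCommGroup M] [Module F M]
    (B : 𝔤 →ₗ[F] (ℤ → Module.End F M))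
    (hB : ∀ {α β : ZMod 2} {r s : ℤ} {a b : 𝔤}, a ∈ D.part α → b ∈ D.part β →
      τ.toEquiv a = t.cls r • a → τ.toEquiv b = t.cls s • b → ∀ (k l : ℤ) (ψ : M),
      B a k (B b l ψ) - sgn F α β • B b l (B a k ψ)
        = B (D.bracket a b) (k + l) ψ + (ℓ * D.cocycle 1 k l a b) • ψ) :
    D.affine.IsModule (loopMap B ℓ) := by
  refine D.affine.isModule_of_span _ _ (loopPart_le_eigen hτ) ?_
  rintro α β x (⟨m, a, ha, ⟨r, hr⟩, rfl⟩ | ⟨rfl, rfl⟩) y (⟨n, b, hb, ⟨s, hs⟩, rfl⟩ | ⟨rfl, rfl⟩)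
  · have h : D.affine.bracket (elt F m a) (elt F n b) = _ := D.loopBracket_elt 1 m n a b
    rw [h, map_add, map_smul, loopMap_elt, loopMap_elt, loopMap_elt, loopMap_central]
    refine LinearMap.ext fun ψ => ?_
    have := hB ha hb hr hs m n ψ
    simp only [LinearMap.add_apply, LinearMap.smul_apply, LinearMap.sub_apply,
      Module.End.mul_apply, Module.End.one_apply]
    rw [this, smul_smul, mul_comm ℓ]
  · have h : D.affine.bracket (elt F m a) (central F 𝔤) = _ := D.loopBracket_central_right 1 _
    rw [h, map_zero, loopMap_central]
    simp
  · have h : D.affine.bracket (central F 𝔤) (elt F n b) = _ := D.loopBracket_central_left 1 _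
    rw [h, map_zero, loopMap_central]
    simp
  · have h : D.affine.bracket (central F 𝔤) (central F 𝔤) = _ := D.loopBracket_central_left 1 _
    rw [h, map_zero, loopMap_central]
    simp

namespace IsAffineRep

variable (hA : IsAffineRep t τ ℓ A) (hτ : τ.toEquiv ^ t.T = 1)

/-- The identity field as a pair of local fields. -/
def localUnit : hA.localFields :=
  ⟨fun γ => if γ = 0 then t.unit W else 0, fun γ => by
    dsimp only
    split_ifs with h
    · refine ⟨TwistDatum.unit_isField, fun r α a ha hr => ?_⟩
      rw [h, sgn_zero_right]
      exact ⟨_, TwistDatum.Jac.one_right (hA.field a) (hA.support r a hr)⟩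
    · exact ⟨fun w => ⟨0, fun _ _ => rfl⟩, fun _ _ _ _ _ => ⟨0, TwistDatum.Jac.zero_right'⟩⟩⟩

/-- The products of a field with the identity field vanish at indices `n ≥ 0` (`Jac.one_right`), so
the identity field satisfies the relations of the vacuum vector. -/
theorem act_localUnit (a : 𝔤) {n : ℤ} (hn : 0 ≤ n) : hA.act hτ a n hA.localUnit = 0 := by
  suffices h : ∀ α, ∀ a ∈ D.part α, hA.act hτ a n hA.localUnit = 0 by
    obtain ⟨a₀, h0, a₁, h1, rfl⟩ := D.exists_parts a
    rw [map_add, Pi.add_apply, LinearMap.add_apply, h 0 _ h0, h 1 _ h1, add_zero]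
  intro α a ha
  refine Submodule.span_induction (p := fun a _ => hA.act hτ a n hA.localUnit = 0)
    ?_ ?_ ?_ ?_ (τ.mem_span_eigen hτ α a ha)
  · rintro a ⟨ha, r, hr⟩
    refine Subtype.ext (funext fun δ => ?_)
    obtain ⟨γ, rfl⟩ : ∃ γ, δ = α + γ := ⟨δ - α, by abel⟩
    by_cases hγ : γ = 0
    · have h : t.Jac (t.cls r) (sgn F α γ) (A a) (hA.localUnit.1 γ)
          (fun l => if l < 0 then t.deriv (-l - 1).toNat (A a) else 0) := by
        rw [localUnit, hγ, sgn_zero_right]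
        exact TwistDatum.Jac.one_right (hA.field a) (hA.support r a hr)
      rw [hA.act_apply hτ ha hr _ h, if_neg (by omega)]
      rfl
    · have h : t.Jac (t.cls r) (sgn F α γ) (A a) (hA.localUnit.1 γ) 0 := by
        simp only [localUnit, if_neg hγ]
        exact TwistDatum.Jac.zero_right'
      rw [hA.act_apply hτ ha hr _ h]
      rfl
  · simp
  · intro a b _ _ ha hb
    rw [map_add, Pi.add_apply, LinearMap.add_apply, ha, hb, add_zero]
  · intro c a _ ha
    rw [map_smul, Pi.smul_apply, LinearMap.smul_apply, ha, smul_zero]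

/-- The action of the enveloping algebra on pairs of local fields. -/
noncomputable def ueaAct : D.affine.UEA →ₐ[F] Module.End F hA.localFields :=
  D.affine.ueaLift _ (isModule_loopMap hτ (hA.act hτ) (hA.act_comm hτ))

theorem ueaAct_vacIdeal (u : D.affine.UEA) (hu : u ∈ D.vacIdeal ℓ) :
    hA.ueaAct hτ u hA.localUnit = 0 := by
  refine Submodule.span_induction (p := fun u _ => hA.ueaAct hτ u hA.localUnit = 0)
    ?_ ?_ ?_ ?_ hu
  · rintro u (⟨n, a, rfl⟩ | rfl)
    · rw [ueaAct, LieSuperalgebra.ueaLift_ι, loopMap_elt]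
      exact hA.act_localUnit hτ a (by omega)
    · rw [map_sub, AlgHom.commutes, ueaAct, LieSuperalgebra.ueaLift_ι, loopMap_central,
        Algebra.algebraMap_eq_smul_one, sub_self, LinearMap.zero_apply]
  · rw [map_zero, LinearMap.zero_apply]
  · intro x y _ _ h1 h2
    rw [map_add, LinearMap.add_apply, h1, h2, add_zero]
  · intro a x _ h
    rw [smul_eq_mul, map_mul, Module.End.mul_apply, h, map_zero]

/-- The module map from the vacuum module to pairs of local fields. -/
noncomputable def toLocal : D.Vac ℓ →ₗ[F] hA.localFields :=
  (Submodule.liftQ ((D.vacIdeal ℓ).restrictScalars F)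
    (LinearMap.applyₗ hA.localUnit ∘ₗ (hA.ueaAct hτ).toLinearMap)
    (hA.ueaAct_vacIdeal hτ)) ∘ₗ
    (Submodule.Quotient.restrictScalarsEquiv F (D.vacIdeal ℓ)).symm.toLinearMap

theorem toLocal_smul_vac (u : D.affine.UEA) :
    hA.toLocal hτ (u • D.vac ℓ) = hA.ueaAct hτ u hA.localUnit := by
  rw [smul_vac]
  rfl

theorem toLocal_vac : hA.toLocal hτ (D.vac ℓ) = hA.localUnit := by
  have := hA.toLocal_smul_vac hτ 1
  rwa [one_smul, map_one, Module.End.one_apply] at this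

theorem toLocal_mode (a : 𝔤) (n : ℤ) (v : D.Vac ℓ) :
    hA.toLocal hτ (D.vacMode ℓ a n v) = hA.act hτ a n (hA.toLocal hτ v) := by
  obtain ⟨u, rfl⟩ := D.exists_smul_vac ℓ v
  rw [vacMode_apply, ← mul_smul, toLocal_smul_vac, toLocal_smul_vac, map_mul,
    Module.End.mul_apply]
  conv_lhs => rw [ueaAct, LieSuperalgebra.ueaLift_ι, loopMap_elt]
  rfl

/-- Generators shift the parity of a pair as they shift that of a vector, so a homogeneous vector
yields a pair with one nonzero entry at most, and nothing is lost by adding the entries. -/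
theorem toLocal_parity {β γ : ZMod 2} {v : D.Vac ℓ} (hv : v ∈ D.vacPart ℓ β) (h : γ ≠ β) :
    (hA.toLocal hτ v).1 γ = 0 := by
  refine D.vacPart_induction ℓ (τ.mem_span_eigen hτ)
    (P := fun β v => ∀ γ, γ ≠ β → (hA.toLocal hτ v).1 γ = 0) ?_ ?_ ?_ ?_ ?_ hv γ h
  · intro γ h
    rw [toLocal_vac]
    exact if_neg h
  · intro β γ _; rw [map_zero]; rfl
  · intro β v w hv hw γ h
    rw [map_add, Submodule.coe_add, Pi.add_apply, hv γ h, hw γ h, add_zero]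
  · intro β c v hv γ h
    rw [map_smul, Submodule.coe_smul, Pi.smul_apply, hv γ h, smul_zero]
  · rintro α β a n v ha ⟨r, hr⟩ _ ih δ h
    obtain ⟨γ, rfl⟩ : ∃ γ, δ = α + γ := ⟨δ - α, by abel⟩
    have h1 : t.Jac (t.cls r) (sgn F α γ) (A a) ((hA.toLocal hτ v).1 γ) 0 := by
      rw [ih γ fun h' => h (by rw [h'])]
      exact TwistDatum.Jac.zero_right'
    rw [toLocal_mode, hA.act_apply hτ ha hr _ h1]
    rfl

/-- The fields attached to the vectors of the vacuum module. -/
noncomputable def vertexMap : D.Vac ℓ →ₗ[F] (ℤ → Module.End F W) :=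
  (LinearMap.proj (R := F) (φ := fun _ : ZMod 2 => ℤ → Module.End F W) 0 +
    LinearMap.proj (R := F) (φ := fun _ : ZMod 2 => ℤ → Module.End F W) 1) ∘ₗ
    hA.localFields.subtype ∘ₗ hA.toLocal hτ

theorem vertexMap_eq {β : ZMod 2} {v : D.Vac ℓ} (hv : v ∈ D.vacPart ℓ β) :
    hA.vertexMap hτ v = (hA.toLocal hτ v).1 β := by
  change (hA.toLocal hτ v).1 0 + (hA.toLocal hτ v).1 1 = _
  rcases zmod_two β with rfl | rfl
  · rw [hA.toLocal_parity hτ hv (γ := 1) (by decide), add_zero]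
  · rw [hA.toLocal_parity hτ hv (γ := 0) (by decide), zero_add]

/-- The map to local fields is `ĝ`-linear and the action is by products, so the field of `a_l v` is
by construction the `l`-th product. -/
theorem isVacRep : IsVacRep t τ ℓ A (hA.vertexMap hτ) where
  field v := ((hA.toLocal hτ v).2 0).1.add ((hA.toLocal hτ v).2 1).1
  vacuum := by
    rw [hA.vertexMap_eq hτ (D.vac_mem ℓ), toLocal_vac]
    rfl
  jac {r α β a v} ha hr hv := by
    obtain ⟨E, hE⟩ := ((hA.toLocal hτ v).2 β).2 r α a ha hr
    have h : (fun l => hA.vertexMap hτ (D.vacMode ℓ a l v)) = E := by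
      funext l
      rw [hA.vertexMap_eq hτ (D.vacMode_mem ℓ ha l hv), toLocal_mode, hA.act_apply hτ ha hr _ hE]
    rw [hA.vertexMap_eq hτ hv, h]
    exact hE

end IsAffineRep

end AffineDatum
end SuperVA

namespace SuperVA

/-! ### The vertex superalgebra and its twisted modules -/

namespace TwistDatum

variable {p : ℕ} [Fact p.Prime] {F : Type*} [Field F] [CharP F p]
  {W : Type*} [AddCommGroup W] [Module F W]

/-- The twist datum attached to a primitive root of unity of order prime to `p`. -/
noncomputable def ofPrimitiveRoot (p : ℕ) [Fact p.Prime] {T : ℕ} (hT : T.Coprime p) {η : Fˣ}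
    (hη : IsPrimitiveRoot η T) : TwistDatum p F where
  T := T
  η := η
  θ := Ring.inverse (T : ℤ_[p])
  T_mul_θ := Ring.mul_inverse_cancel _ (PadicInt.isUnit_iff.2
    (PadicInt.norm_natCast_eq_one_iff.2 hT.symm))
  primitive := hη

variable (t : TwistDatum p F)

theorem binom_intCast (l : ℤ) (i : ℕ) : binom F l i = (bin (l : ℤ_[p]) i : F) :=
  binom_eq_bin l l (by simp) i

theorem binom_div (m : ℤ) (i : ℕ) : binom F ((m : ℚ) / t.T) i = (bin (t.frac m) i : F) := by
  refine binom_eq_bin _ _ ?_ i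
  have h : ((t.T : ℚ_[p])) * (t.θ : ℚ_[p]) = 1 := by exact_mod_cast congrArg Subtype.val t.T_mul_θ
  have h0 : (t.T : ℚ_[p]) ≠ 0 := left_ne_zero_of_mul_eq_one h
  push_cast [frac]
  rw [eq_div_iff h0]
  linear_combination (m : ℚ_[p]) * h

theorem cls_eq_iff (m r : ℤ) : t.cls m = t.cls r ↔ m ≡ r [ZMOD t.T] := by
  constructor
  · intro h
    obtain ⟨k, rfl⟩ := t.exists_of_cls_eq h
    exact Int.modEq_iff_dvd.2 ⟨-k, by ring⟩
  · intro h
    obtain ⟨k, hk⟩ := h.symm.dvd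
    rw [show m = r + t.T * k by linear_combination hk, cls_add_T_mul]

theorem cls_natCast (r : ℕ) : t.cls r = (t.η : F) ^ r := by simp [cls]

theorem br_eq_binom (ε : F) (A : ℤ → Module.End F W) (C : ℤ → Module.End F W) (l m n : ℤ) (w : W) :
    t.br ε A (fun n => C n) l m n w
      = (∑ᶠ i : ℕ, ((-1) ^ i * binom F l i) • A (m + t.T * (l - i)) (C (n + t.T * i) w))
        - (ε * (-1) ^ l) •
          ∑ᶠ i : ℕ, ((-1) ^ i * binom F l i) • C (n + t.T * (l - i)) (A (m + t.T * i) w) := by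
  simp only [br, altSum, binom_intCast (p := p)]

theorem rhs_eq_binom (E : ℤ → ℤ → W) (l m n : ℤ) :
    t.rhs E l m n = ∑ᶠ i : ℕ, binom F ((m : ℚ) / t.T) i • E (l + i) (m + n - t.T * i) := by
  simp only [rhs, binom_div]

end TwistDatum

/-! ### From generating fields to vertex superalgebras and twisted modules, and back. -/

namespace AffineDatum

variable {p : ℕ} [Fact p.Prime] {F : Type*} [Field F] [CharP F p] {t : TwistDatum p F}
  {𝔤 : Type*} [AddCommGroup 𝔤] [Module F 𝔤] {D : AffineDatum F 𝔤} {τ : D.Aut} {ℓ : F}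
  {W : Type*} [AddCommGroup W] [Module F W]
  {A : 𝔤 →ₗ[F] (ℤ → Module.End F W)} {Y : D.Vac ℓ →ₗ[F] (ℤ → Module.End F W)}

theorem Aut.onVac_pow_mode (k : ℕ) (a : 𝔤) (n : ℤ) (v : D.Vac ℓ) :
    (τ.onVac ℓ ^ k) (D.vacMode ℓ a n v)
      = D.vacMode ℓ ((τ.toEquiv ^ k) a) n ((τ.onVac ℓ ^ k) v) := by
  induction k with
  | zero => rfl
  | succ k ih =>
    rw [pow_succ', Module.End.mul_apply, ih, onVac_mode, pow_succ']
    rfl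

theorem Aut.onVac_pow {k : ℕ} (h : τ.toEquiv ^ k = 1) : τ.onVac ℓ ^ k = 1 := by
  refine vac_ext fun β v hv => ?_
  refine D.vacPart_induction ℓ (Q := fun _ => True)
    (P := fun _ v => (τ.onVac ℓ ^ k) v = v)
    (fun α a ha => Submodule.subset_span ⟨ha, trivial⟩) ?_ ?_ ?_ ?_ ?_ hv
  · clear h
    induction k with
    | zero => rfl
    | succ k ih => rw [pow_succ, Module.End.mul_apply, onVac_vac, ih]
  · intro β; exact map_zero _
  · intro β v w hv hw; rw [map_add, hv, hw]
  · intro β c v hv; rw [map_smul, hv]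
  · intro α β a n v _ _ _ hv
    rw [onVac_pow_mode, h, hv]
    rfl

theorem Aut.refl_onVac (v : D.Vac ℓ) : (Aut.refl D).onVac ℓ v = v := by
  have := Aut.onVac_pow (τ := Aut.refl D) (ℓ := ℓ) (k := 1) rfl
  rw [pow_one] at this
  rw [this]; rfl

theorem trivial_pow : (Aut.refl D).toEquiv ^ (TwistDatum.trivial p F).T = 1 := rfl

variable (D ℓ) in
/-- The vertex operators on the vacuum module. -/
noncomputable def vacY (p : ℕ) [Fact p.Prime] [CharP F p] :
    D.Vac ℓ →ₗ[F] (ℤ → Module.End F (D.Vac ℓ)) :=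
  (isAffineRep_vacMode (p := p) (D := D) (ℓ := ℓ)).vertexMap trivial_pow

theorem isRegular_vacY : IsRegular (D.vacY ℓ p) p := isAffineRep_vacMode.isVacRep trivial_pow

variable (D ℓ) in
/-- The vertex superalgebra structure on the vacuum module. -/
noncomputable def vacVA (hp : 2 < p) : VertexSuperalgebra F (D.Vac ℓ) where
  part := D.vacPart ℓ
  isCompl := vacPart_isCompl hp
  vacuum := D.vac ℓ
  vacuum_mem := D.vac_mem ℓ
  Y := D.vacY ℓ p
  Y_mem n hu hv := isRegular_vacY.mem hp hu hv n
  truncation u v := isRegular_vacY.field u v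
  Y_vacuum n := by
    rw [isRegular_vacY.vacuum, TwistDatum.unit]
    simp
  creation v := isRegular_vacY.creation v
  jacobi {α β u v} hu hv w l m n := by
    have h := (IsVacRep.jac_of_eigen trivial_pow isAffineRep_vacMode (isRegular_vacY (p := p)) hp
      isRegular_vacY (r := 0) (by rw [Aut.refl_onVac]; simp) hu hv).eq l m n w (by simp)
    rw [TwistDatum.br_eq_binom, TwistDatum.rhs_eq_binom] at h
    simpa [add_sub_assoc] using h

theorem isAffineVA_vacVA (hp : 2 < p) : D.IsAffineVA ℓ (D.vacVA ℓ hp) where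
  part_eq := rfl
  vacuum_eq := rfl
  Y_state a n v := by
    have := IsVacRep.state (τ := Aut.refl D) (ℓ := ℓ) trivial_pow isAffineRep_vacMode
      (isRegular_vacY (p := p)) a
    exact congrFun (congrArg DFunLike.coe (congrFun this n)) v

theorem isTwistedModule_of_isVacRep (hp : 2 < p) (hτ : τ.toEquiv ^ t.T = 1)
    (hA : IsAffineRep t τ ℓ A) (hY : IsVacRep t τ ℓ A Y) :
    (D.vacVA ℓ hp).IsTwistedModule (τ.onVac ℓ) t.T (t.η : F) Y where
  support r u hu n hn := by
    rw [← t.cls_natCast] at hu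
    exact hY.eq_zero_of_cls hτ hu fun h => hn ((t.cls_eq_iff _ _).1 h)
  truncation := hY.field
  Y_vacuum n := congrFun hY.vacuum n
  jacobi r α β u v hu hα hβ w l m n hm := by
    rw [← t.cls_natCast] at hu
    have h := (hY.jac_of_eigen hτ hA hp isRegular_vacY hu hα hβ).eq l m n w
      ((t.cls_eq_iff _ _).2 hm)
    rwa [TwistDatum.br_eq_binom, TwistDatum.rhs_eq_binom] at h

variable (D ℓ) in
/-- The linear map `a ↦ (a ⊗ t⁻¹)𝟏`. -/
noncomputable def stateMap : 𝔤 →ₗ[F] D.Vac ℓ where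
  toFun a := D.vacMode ℓ a (-1) (D.vac ℓ)
  map_add' a b := by rw [map_add]; rfl
  map_smul' c a := by rw [map_smul]; rfl

theorem onVac_state {c : F} {a : 𝔤} (h : τ.toEquiv a = c • a) :
    τ.onVac ℓ (D.state ℓ a) = c • D.state ℓ a := by
  have := τ.onVac_mode (ℓ := ℓ) a (-1) (D.vac ℓ)
  rw [h, Aut.onVac_vac, map_smul] at this
  exact this

theorem exists_nat_cls (r : ℤ) : ∃ s : ℕ, t.cls s = t.cls r :=
  (IsAffineRep.exists_range_cls t r).imp fun _ h => h.2

/-- The twisted Jacobi identity with left entry a generator, whose products with `v` are prescribed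
by `IsAffineVA`. With `IsVacRep.unique` this gives uniqueness of module structures. -/
theorem isVacRep_of_isTwistedModule {S : VertexSuperalgebra F (D.Vac ℓ)} (hS : D.IsAffineVA ℓ S)
    (hY : S.IsTwistedModule (τ.onVac ℓ) t.T (t.η : F) Y)
    (hA : ∀ (r : ℤ) (a : 𝔤), τ.toEquiv a = t.cls r • a → Y (D.state ℓ a) = A a) :
    IsVacRep t τ ℓ A Y where
  field := hY.truncation
  vacuum := by
    rw [← hS.vacuum_eq]
    exact funext hY.Y_vacuum
  jac {r α β a v} ha hr hv := by
    refine ⟨?_, fun l => hY.truncation _, fun l m n w hm => ?_⟩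
    · obtain ⟨N, hN⟩ := vacMode_isField a v
      refine ⟨N, fun l hl => ?_⟩
      have := hN l hl
      dsimp only at this
      rw [this, map_zero]
    · obtain ⟨s, hs⟩ := exists_nat_cls (t := t) r
      have hu := onVac_state (ℓ := ℓ) hr
      rw [← hs, t.cls_natCast] at hu
      have h := hY.jacobi s α β (D.state ℓ a) v hu (by rw [hS.part_eq]; exact D.state_mem ℓ ha)
        (by rw [hS.part_eq]; exact hv) w l m n ((t.cls_eq_iff _ _).1 (hm.trans hs.symm))
      rw [hA r a hr] at h
      rw [TwistDatum.br_eq_binom, TwistDatum.rhs_eq_binom, h]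
      exact finsum_congr fun i => by rw [hS.Y_state]; rfl

theorem isTwistedModule_self (S : VertexSuperalgebra F (D.Vac ℓ)) :
    S.IsTwistedModule ((Aut.refl D).onVac ℓ) (TwistDatum.trivial p F).T
      ((TwistDatum.trivial p F).η : F) S.Y where
  support r u _ n hn := absurd (Int.modEq_one) hn
  truncation := S.truncation
  Y_vacuum n := by simpa using S.Y_vacuum n
  jacobi r α β u v _ hα hβ w l m n _ := by
    simpa [add_sub_assoc] using S.jacobi hα hβ w l m n

/-- A vertex superalgebra is a module over itself with `T = 1`, so its vertex operators are
determined by those of the generators. -/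
theorem isAffineVA_unique (hp : 2 < p) {S : VertexSuperalgebra F (D.Vac ℓ)}
    (hS : D.IsAffineVA ℓ S) : S = D.vacVA ℓ hp := by
  have h1 : IsVacRep (TwistDatum.trivial p F) (Aut.refl D) ℓ (D.vacMode ℓ) S.Y :=
    isVacRep_of_isTwistedModule hS (isTwistedModule_self S) fun _ a _ =>
      funext fun n => LinearMap.ext fun v => hS.Y_state a n v
  have h2 : S.Y = D.vacY ℓ p := h1.unique trivial_pow isRegular_vacY
  have h3 := hS.part_eq
  have h4 := hS.vacuum_eq
  cases S
  subst h2 h3 h4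
  rfl

theorem isAutomorphism_onVac (hp : 2 < p) (hτ : τ.toEquiv ^ t.T = 1) :
    (D.vacVA ℓ hp).IsAutomorphism (τ.onVac ℓ) where
  bijective := by
    -- A linear map of finite order is invertible.
    have h := Aut.onVac_pow (ℓ := ℓ) hτ
    have h1 := t.T_pos
    rw [← Module.End.isUnit_iff]
    exact IsUnit.of_pow_eq_one h h1.ne'
  map_part _ _ := τ.onVac_mem
  map_vacuum := τ.onVac_vac
  map_Y u v n := isRegular_vacY.map τ u v n

theorem vacMode_state {α β : ZMod 2} {a b : 𝔤} (ha : a ∈ D.part α) (hb : b ∈ D.part β) (q : ℕ) :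
    D.vacMode ℓ a q (D.state ℓ b) = (if q = 0 then D.state ℓ (D.bracket a b) else 0)
      + (ℓ * D.cocycle 1 q (-1) a b) • D.vac ℓ := by
  have h := D.vacMode_comm ℓ ha hb q (-1) (D.vac ℓ)
  rw [D.vacMode_vac ℓ a (by omega), map_zero, smul_zero, zero_add] at h
  refine Eq.trans h ?_
  congr 1
  split_ifs with hq
  · subst hq; rfl
  · exact D.vacMode_vac ℓ _ (by omega)

/-- The case `l = 0` of the Jacobi identity is the commutator formula. Its only terms are `a_0 b =
[a, b]` plus an odd central part and `a_1 b`, an even central part. -/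
theorem isAffineRep_of_isTwistedModule {S : VertexSuperalgebra F (D.Vac ℓ)}
    (hS : D.IsAffineVA ℓ S) (hY : S.IsTwistedModule (τ.onVac ℓ) t.T (t.η : F) Y) :
    IsAffineRep t τ ℓ (Y ∘ₗ D.stateMap ℓ) where
  field a := hY.truncation _
  support r a hr n hn := by
    obtain ⟨s, hs⟩ := exists_nat_cls (t := t) r
    have hu := onVac_state (ℓ := ℓ) hr
    rw [← hs, t.cls_natCast] at hu
    exact hY.support s _ hu n fun h => hn (((t.cls_eq_iff _ _).2 h).trans hs)
  comm {α β r s a b} ha hb hr hs m n hm hn w := by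
    have hV : IsVacRep t τ ℓ (Y ∘ₗ D.stateMap ℓ) Y :=
      isVacRep_of_isTwistedModule hS hY fun _ _ _ => rfl
    have h := hV.comm ha hr (D.state_mem ℓ hb) 2 (fun q hq => by
      rw [vacMode_state ha hb, if_neg (by omega), cocycle_apply, if_neg (by omega),
        if_neg (by push_cast; omega)]
      simp) m n w hm
    refine Eq.trans h ?_
    have e0 : D.vacMode ℓ a ((0 : ℕ) : ℤ) (D.state ℓ b) = D.state ℓ (D.bracket a b)
        + (ℓ * D.form (D.proj1 a) (D.proj1 b)) • D.vac ℓ := by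
      rw [vacMode_state ha hb, if_pos rfl, cocycle_apply]
      simp
    have e1 : D.vacMode ℓ a ((1 : ℕ) : ℤ) (D.state ℓ b)
        = (ℓ * D.form (D.proj0 a) (D.proj0 b)) • D.vac ℓ := by
      rw [vacMode_state ha hb, if_neg one_ne_zero, cocycle_apply]
      simp
    rw [Finset.sum_range_succ, Finset.sum_range_one, e0, e1, bin_zero, one_smul,
      TwistDatum.resHom_frac, cocycle_apply, map_add, map_smul, map_smul, hV.vacuum]
    simp only [Pi.add_apply, Pi.smul_apply, LinearMap.add_apply, LinearMap.smul_apply,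
      LinearMap.comp_apply, stateMap, LinearMap.coe_mk, AddHom.coe_mk, TwistDatum.unit, Nat.cast_zero, Nat.cast_one, mul_zero,
      mul_one, sub_zero, add_assoc]
    congr 1
    have i1 : m + n = -t.T ↔ m + (n + t.T) = 0 := by omega
    have i2 : m + n - t.T = -t.T ↔ m + n = 0 := by omega
    simp only [i1, i2]
    split_ifs <;> simp <;> module

end AffineDatum
end SuperVA

namespace SuperVA

/-! ### Twisted affine modules -/

namespace AffineDatum

variable {p : ℕ} [Fact p.Prime] {F : Type*} [Field F] [CharP F p] {t : TwistDatum p F}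
  {𝔤 : Type*} [AddCommGroup 𝔤] [Module F 𝔤] {D : AffineDatum F 𝔤} {τ : D.Aut} {ℓ : F}
  {W : Type*} [AddCommGroup W] [Module F W]
  {A : 𝔤 →ₗ[F] (ℤ → Module.End F W)} {ρ : τ.twistedSpace t.η →ₗ[F] Module.End F W}

theorem twisted_eq_sum {η : Fˣ} (x : τ.twistedSpace η) :
    x = (∑ n ∈ x.1.1.support, τ.mode η n (x.1.1 n) (x.2 n))
      + x.1.2 • ⟨central F 𝔤, τ.central_mem_twisted η⟩ := by
  refine Subtype.ext ?_
  rw [Submodule.coe_add, Submodule.coe_sum, Submodule.coe_smul]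
  exact loop_eq_sum x.1

theorem twisted_ext {η : Fˣ} {X : Type*} [AddCommGroup X] [Module F X]
    {f g : τ.twistedSpace η →ₗ[F] X} (h : ∀ n a h, f (τ.mode η n a h) = g (τ.mode η n a h))
    (hc : f ⟨central F 𝔤, τ.central_mem_twisted η⟩ = g ⟨central F 𝔤, τ.central_mem_twisted η⟩) :
    f = g := by
  refine LinearMap.ext fun x => ?_
  rw [twisted_eq_sum x]
  simp only [map_add, map_sum, map_smul, h, hc]

theorem twistedPart_le {T : ℕ} {η : Fˣ} (α : ZMod 2) : (τ.twistedAffine T η).part α ≤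
    Submodule.span F {x | (∃ n a, ∃ h : τ.toEquiv a = ((η ^ n : Fˣ) : F) • a, a ∈ D.part α ∧
      x = τ.mode η n a h) ∨ (α = 0 ∧ x = ⟨central F 𝔤, τ.central_mem_twisted η⟩)} := by
  intro x hx
  have hx' : x.1 ∈ D.loopPart α := hx
  rw [twisted_eq_sum x]
  refine Submodule.add_mem _ (Submodule.sum_mem _ fun n _ =>
    Submodule.subset_span (Or.inl ⟨n, _, x.2 n, hx'.1 n, rfl⟩)) ?_
  rcases zmod_two α with rfl | rfl
  · exact Submodule.smul_mem _ _ (Submodule.subset_span (Or.inr ⟨rfl, rfl⟩))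
  · rw [hx'.2 rfl, zero_smul]
    exact Submodule.zero_mem _

theorem mode_congr {η : Fˣ} {n n' : ℤ} {a a' : 𝔤} (hn : n = n') (ha : a = a')
    (h : τ.toEquiv a = ((η ^ n : Fˣ) : F) • a) (h' : τ.toEquiv a' = ((η ^ n' : Fˣ) : F) • a') :
    τ.mode η n a h = τ.mode η n' a' h' := by
  subst hn ha; rfl

/-- The projection of `𝔤 ⊗ t^{n/T}` onto the twisted affine Lie superalgebra. -/
noncomputable def modeProj (hτ : τ.toEquiv ^ t.T = 1) (n : ℤ) : 𝔤 →ₗ[F] τ.twistedSpace t.η :=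
  LinearMap.codRestrict (τ.twistedSpace t.η)
    (LinearMap.inl F (ℤ →₀ 𝔤) F ∘ₗ Finsupp.lsingle n ∘ₗ t.eigenproj τ.toEquiv.toLinearMap n)
    fun a => τ.elt_mem_twisted t.η (t.map_eigenproj (τ.toLinearMap_pow hτ) n a)

theorem modeProj_apply (hτ : τ.toEquiv ^ t.T = 1) (n : ℤ) (a : 𝔤) : modeProj hτ n a
    = τ.mode t.η n _ (t.map_eigenproj (τ.toLinearMap_pow hτ) n a) := rfl

/-- The fields attached to a representation of the twisted affine Lie superalgebra. -/
noncomputable def modes (hτ : τ.toEquiv ^ t.T = 1)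
    (ρ : τ.twistedSpace t.η →ₗ[F] Module.End F W) : 𝔤 →ₗ[F] (ℤ → Module.End F W) :=
  LinearMap.pi fun n => ρ ∘ₗ modeProj hτ n

theorem modes_of_eq (hτ : τ.toEquiv ^ t.T = 1) {r n : ℤ} {a : 𝔤}
    (hr : τ.toEquiv a = t.cls r • a) (hn : t.cls n = t.cls r) :
    modes hτ ρ a n = ρ (τ.mode t.η n a (by rw [hr, ← hn]; rfl)) := by
  change ρ (modeProj hτ n a) = _
  rw [modeProj_apply]
  congr 1
  refine mode_congr rfl ?_ _ _
  rw [t.eigenproj_eigen hr, if_pos hn]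

theorem modes_of_ne (hτ : τ.toEquiv ^ t.T = 1) {r n : ℤ} {a : 𝔤}
    (hr : τ.toEquiv a = t.cls r • a) (hn : t.cls n ≠ t.cls r) : modes hτ ρ a n = 0 := by
  change ρ (modeProj hτ n a) = _
  have : modeProj hτ n a = 0 := by
    refine Subtype.ext ?_
    change elt F n (t.eigenproj τ.toEquiv.toLinearMap n a) = 0
    rw [t.eigenproj_eigen hr, if_neg hn]
    simp [elt]
  rw [this, map_zero]

theorem twistedField_eq_modes (hτ : τ.toEquiv ^ t.T = 1) (i : ℤ) (a : 𝔤)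
    (h : τ.toEquiv a = ((t.η ^ i : Fˣ) : F) • a) :
    τ.twistedField t.primitive ρ i a h = modes hτ ρ a := by
  funext k
  rw [Aut.twistedField]
  split_ifs with hk
  · rw [modes_of_eq hτ h ((t.cls_eq_iff _ _).2 hk)]
  · rw [modes_of_ne hτ h fun h' => hk ((t.cls_eq_iff _ _).1 h')]

theorem twisted_bracket {T : ℕ} {η : Fˣ} {m n : ℤ} {a b : 𝔤}
    (ha : τ.toEquiv a = ((η ^ m : Fˣ) : F) • a) (hb : τ.toEquiv b = ((η ^ n : Fˣ) : F) • b)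
    (hab : τ.toEquiv (D.bracket a b) = ((η ^ (m + n) : Fˣ) : F) • D.bracket a b) :
    (τ.twistedAffine T η).bracket (τ.mode η m a ha) (τ.mode η n b hb)
      = τ.mode η (m + n) (D.bracket a b) hab
        + D.cocycle T m n a b • ⟨central F 𝔤, τ.central_mem_twisted η⟩ :=
  Subtype.ext (D.loopBracket_elt T m n a b)

theorem isAffineRep_modes (hτ : τ.toEquiv ^ t.T = 1)
    (hρ : τ.IsLocallyTruncatedModule t.T t.η ℓ ρ) : IsAffineRep t τ ℓ (modes hτ ρ) where
  field a w := by
    obtain ⟨N, hN⟩ := hρ.truncated w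
    exact ⟨N, fun n hn => hN n hn _ (t.map_eigenproj (τ.toLinearMap_pow hτ) n a)⟩
  support r a hr n hn := modes_of_ne hτ hr hn
  comm {α β r s a b} ha hb hr hs m n hm hn w := by
    have hab := IsAffineRep.bracket_eigen hr hs
    have hmn : t.cls (m + n) = t.cls (r + s) := by rw [t.cls_add, t.cls_add, hm, hn]
    have h := hρ.isModule α β (τ.mode t.η m a (by rw [hr, ← hm]; rfl))
      (τ.mode t.η n b (by rw [hs, ← hn]; rfl)) (D.elt_mem m ha) (D.elt_mem n hb)
    rw [twisted_bracket _ _ (by rw [hab, ← hmn]; rfl), map_add, map_smul, hρ.level,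
      ← modes_of_eq hτ hr hm, ← modes_of_eq hτ hs hn, ← modes_of_eq hτ hab hmn] at h
    have h1 := congrArg (fun f : Module.End F W => f w) h
    simp only [LinearMap.add_apply, LinearMap.smul_apply, LinearMap.sub_apply,
      Module.End.mul_apply, Module.End.one_apply] at h1
    rw [← h1, smul_smul, mul_comm ℓ]

/-- The representation of the twisted affine Lie superalgebra attached to generating fields. -/
noncomputable def toTwisted (τ : D.Aut) (η : Fˣ) (A : 𝔤 →ₗ[F] (ℤ → Module.End F W)) (ℓ : F) :
    τ.twistedSpace η →ₗ[F] Module.End F W :=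
  loopMap A ℓ ∘ₗ (τ.twistedSpace η).subtype

theorem toTwisted_mode {η : Fˣ} {n : ℤ} {a : 𝔤} (h : τ.toEquiv a = ((η ^ n : Fˣ) : F) • a) :
    toTwisted τ η A ℓ (τ.mode η n a h) = A a n := loopMap_elt A ℓ n a

theorem toTwisted_central {η : Fˣ} :
    toTwisted τ η A ℓ ⟨central F 𝔤, τ.central_mem_twisted η⟩ = ℓ • 1 := loopMap_central A ℓ

/-- Local truncation asks for one bound valid for all `a`; a finite basis of `𝔤` turns the bounds
for single fields into such a bound. -/
theorem IsAffineRep.truncated [FiniteDimensional F 𝔤] (hA : IsAffineRep t τ ℓ A) (w : W) :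
    ∃ N : ℤ, ∀ n ≥ N, ∀ a : 𝔤, A a n w = 0 := by
  have b := Module.finBasis F 𝔤
  choose K hK using fun i => hA.field (b i) w
  obtain ⟨N, hN⟩ := (Set.finite_range K).bddAbove
  refine ⟨N, fun n hn a => ?_⟩
  have h : LinearMap.applyₗ w ∘ₗ LinearMap.proj (R := F) (φ := fun _ : ℤ => Module.End F W) n ∘ₗ A
      = 0 := b.ext fun i => hK i n (le_trans (hN ⟨i, rfl⟩) hn)
  exact congrArg (fun f : 𝔤 →ₗ[F] W => f a) h

theorem isLocallyTruncated_toTwisted [FiniteDimensional F 𝔤] (hA : IsAffineRep t τ ℓ A) :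
    τ.IsLocallyTruncatedModule t.T t.η ℓ (toTwisted τ t.η A ℓ) where
  isModule := by
    refine LieSuperalgebra.isModule_of_span _ _ _ twistedPart_le ?_
    rintro α β x (⟨m, a, ha, haα, rfl⟩ | ⟨rfl, rfl⟩) y (⟨n, b, hb, hbβ, rfl⟩ | ⟨rfl, rfl⟩)
    · have hab : τ.toEquiv (D.bracket a b) = ((t.η ^ (m + n) : Fˣ) : F) • D.bracket a b :=
        IsAffineRep.bracket_eigen (t := t) (r := m) (s := n) ha hb
      rw [twisted_bracket ha hb hab, map_add, map_smul, toTwisted_mode, toTwisted_mode, toTwisted_mode, toTwisted_central]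
      refine LinearMap.ext fun w => ?_
      have := hA.comm haα hbβ ha hb m n rfl rfl w
      simp only [LinearMap.add_apply, LinearMap.smul_apply, LinearMap.sub_apply,
        Module.End.mul_apply, Module.End.one_apply]
      rw [this, smul_smul, mul_comm ℓ]
    · have h : (τ.twistedAffine t.T t.η).bracket (τ.mode t.η m a ha)
        ⟨central F 𝔤, τ.central_mem_twisted t.η⟩ = 0 :=
        Subtype.ext (D.loopBracket_central_right t.T _)
      rw [h, map_zero, toTwisted_central]
      simp
    · have h : (τ.twistedAffine t.T t.η).bracket ⟨central F 𝔤, τ.central_mem_twisted t.η⟩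
        (τ.mode t.η n b hb) = 0 := Subtype.ext (D.loopBracket_central_left t.T _)
      rw [h, map_zero, toTwisted_central]
      simp
    · have h : (τ.twistedAffine t.T t.η).bracket ⟨central F 𝔤, τ.central_mem_twisted t.η⟩
        ⟨central F 𝔤, τ.central_mem_twisted t.η⟩ = 0 :=
        Subtype.ext (D.loopBracket_central_left t.T _)
      rw [h, map_zero, toTwisted_central]
      simp
  level := toTwisted_central
  truncated w := by
    obtain ⟨N, hN⟩ := hA.truncated w
    exact ⟨N, fun n hn a h => by rw [toTwisted_mode]; exact hN n hn a⟩

end AffineDatum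

end SuperVA

/-! ### Assembly of the two correspondences. -/

theorem mainTheorem6 {F : Type*} [Field F] [IsAlgClosed F] (p : ℕ) [Fact p.Prime]
    [CharP F p] (hp : 2 < p)
    {𝔤 : Type*} [AddCommGroup 𝔤] [Module F 𝔤] [FiniteDimensional F 𝔤] (D : AffineDatum F 𝔤)
    (τ : D.Aut) (T : ℕ) (hT : T.Coprime p) (hτ : τ.toEquiv ^ T = 1)
    (η : Fˣ) (hη : IsPrimitiveRoot η T) (ℓ : F) :
    ∃ S : VertexSuperalgebra F (D.Vac ℓ),
      D.IsAffineVA ℓ S ∧ (∀ S' : VertexSuperalgebra F (D.Vac ℓ), D.IsAffineVA ℓ S' → S' = S) ∧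
      S.IsAutomorphism (τ.onVac ℓ) ∧ τ.onVac ℓ ^ T = 1 ∧
      ∀ (W : Type*) [AddCommGroup W] [Module F W],
        (∀ ρ : τ.twistedSpace η →ₗ[F] Module.End F W, τ.IsLocallyTruncatedModule T η ℓ ρ →
          ∃! Y : D.Vac ℓ →ₗ[F] (ℤ → Module.End F W),
            S.IsTwistedModule (τ.onVac ℓ) T (η : F) Y ∧
            ∀ (i : ℤ) (a : 𝔤) (h : τ.toEquiv a = ((η ^ i : Fˣ) : F) • a),
              Y (D.state ℓ a) = τ.twistedField hη ρ i a h) ∧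
        (∀ Y : D.Vac ℓ →ₗ[F] (ℤ → Module.End F W),
          S.IsTwistedModule (τ.onVac ℓ) T (η : F) Y →
          ∃! ρ : τ.twistedSpace η →ₗ[F] Module.End F W,
            τ.IsLocallyTruncatedModule T η ℓ ρ ∧
            ∀ (i : ℤ) (a : 𝔤) (h : τ.toEquiv a = ((η ^ i : Fˣ) : F) • a),
              τ.twistedField hη ρ i a h = Y (D.state ℓ a)) := by
  obtain ⟨t, rfl, rfl⟩ : ∃ t : TwistDatum p F, t.T = T ∧ t.η = η :=
    ⟨TwistDatum.ofPrimitiveRoot p hT hη, rfl, rfl⟩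
  have hS := AffineDatum.isAffineVA_vacVA (D := D) (ℓ := ℓ) hp
  refine ⟨D.vacVA ℓ hp, hS, fun S' hS' => AffineDatum.isAffineVA_unique hp hS',
    AffineDatum.isAutomorphism_onVac hp hτ, AffineDatum.Aut.onVac_pow hτ, fun W _ _ => ⟨?_, ?_⟩⟩
  · intro ρ hρ
    have hA := AffineDatum.isAffineRep_modes hτ hρ
    have hY := hA.isVacRep hτ
    refine ⟨hA.vertexMap hτ, ⟨AffineDatum.isTwistedModule_of_isVacRep hp hτ hA hY, ?_⟩, ?_⟩
    · intro i a h
      rw [AffineDatum.twistedField_eq_modes hτ]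
      exact hY.state hτ hA a
    · rintro Y ⟨hT', hY'⟩
      exact (AffineDatum.isVacRep_of_isTwistedModule hS hT' fun r a hr =>
        (hY' r a hr).trans (AffineDatum.twistedField_eq_modes hτ r a hr)).unique hτ hY
  · intro Y hY
    have hA := AffineDatum.isAffineRep_of_isTwistedModule hS hY
    refine ⟨AffineDatum.toTwisted τ t.η (Y ∘ₗ D.stateMap ℓ) ℓ,
      ⟨AffineDatum.isLocallyTruncated_toTwisted hA, ?_⟩, ?_⟩
    · intro i a h
      funext k
      rw [AffineDatum.Aut.twistedField]
      split_ifs with hk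
      · exact AffineDatum.toTwisted_mode _
      · exact (hA.support i a h k fun h' => hk ((t.cls_eq_iff _ _).1 h')).symm
    -- The modes and `𝐤` span `ĝ[τ]`: the fields fix the former and the level fixes the latter.
    · rintro ρ ⟨hρ, hρ'⟩
      refine AffineDatum.twisted_ext (fun n a h => ?_) ?_
      · rw [AffineDatum.toTwisted_mode]
        have := congrFun (hρ' n a h) n
        rw [AffineDatum.Aut.twistedField, dif_pos (Int.ModEq.refl n)] at this
        exact this
      · rw [hρ.level, AffineDatum.toTwisted_central]
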